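/- A boolean circuit consists of AND, OR and NOT gates (fan-in at most 2); its size is its number of gates. Write $\log=\log_2$, let $\log^{(c)}$ denote the $c$-fold iterated logarithm, and let $\log^* m$ be the smallest $i\in\mathbb{N}$ with $\log^{(i)} m\le 1$. A tight compaction circuit for $n$ elements of $w$ bits takes as input any array of $n$ elements, each consisting of a $w$-bit payload and a 1-bit key, and outputs a permutation of this array (each payload staying with its key) in which all elements with key 0 precede all elements with key 1; stability is not required. There is a universal constant $K$ such that for every $\epsilon>0$ there is a family of tight compaction circuits $\Phi_{n,w}$ for $n$ elements of $w$ bits ($n\ge 0$, $w\ge 1$), in which every input wire and every gate output has fan-out at most $K$, with $$\mathrm{size}(\Phi_{n,w}) = O(nw)\cdot\min\left(\max\left(1,(\log^* n-\log^* w)^{2+\epsilon}\right),\ \frac{2^w}{w}\right),$$ where the constant in $O(\cdot)$ depends only on $\epsilon$, and where the maximum is read as $1$ if $\log^* n\le\log^* w$. In particular, for every constant $c\ge 1$, the size is $O(nw)$ over all $n,w$ with $w\ge\log^{(c)} n$ (the condition being regarded as satisfied when $\log^{(c)}n$ is undefined), with a constant depending only on $\epsilon$ and $c$; and for every constant $w_0$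 the size is $O(nw)$ over all $n$ and all $w\le w_0$, with a constant depending only on $\epsilon$ and $w_0$. -/

import Mathlib

/-! ### Boolean circuits over AND, OR and NOT -/

/-- A boolean gate reading its inputs from the wires in `W`; its fan-in is at most two. -/
inductive BoolGate (W : Type) where
  | and (a b : W) : BoolGate W
  | or (a b : W) : BoolGate W
  | not (a : W) : BoolGate W

namespace BoolGate

/-- The wires read by a gate, with multiplicity. -/
def inputs {W : Type} : BoolGate W → List W
  | .and a b => [a, b]
  | .or a b => [a, b]
  | .not a => [a]

/-- The bit computed by a gate, given the bits on all wires. -/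
def eval {W : Type} (v : W → Bool) : BoolGate W → Bool
  | .and a b => v a && v b
  | .or a b => v a || v b
  | .not a => !(v a)

theorem eval_congr {W : Type} (u v : W → Bool) (g : BoolGate W)
    (h : ∀ a ∈ g.inputs, u a = v a) : g.eval u = g.eval v := by
  cases g <;> simp_all [inputs, eval]

end BoolGate

/-- A boolean circuit with input wires `ι` and output positions `o`.
The wires are the input wires and the outputs of the gates. The gates are listed in a
topological order of the underlying directed acyclic graph. -/
structure BoolCircuit (ι o : Type) where
  /-- the size of the circuit: its number of gates -/
  size : ℕ
  /-- the gates -/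
  gate : Fin size → BoolGate (ι ⊕ Fin size)
  /-- a gate reads only input wires and outputs of earlier gates -/
  acyclic : ∀ i j : Fin size, Sum.inr j ∈ (gate i).inputs → j < i
  /-- the wire carrying each output bit -/
  output : o → ι ⊕ Fin size

namespace BoolCircuit

variable {ι o : Type}

/-- The bit computed by the gate `k` on the input `x`. The default value `false` is never used,
see `gateVal_eq`. -/
def gateVal (c : BoolCircuit ι o) (x : ι → Bool) (k : Fin c.size) : Bool :=
  (c.gate k).eval (Sum.elim x (fun j => if _h : j < k then c.gateVal x j else false))
termination_by k.val

/-- The bit carried by a wire on the input `x`. -/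
def wireVal (c : BoolCircuit ι o) (x : ι → Bool) : ι ⊕ Fin c.size → Bool :=
  Sum.elim x (c.gateVal x)

/-- The output of the circuit on the input `x`. -/
def eval (c : BoolCircuit ι o) (x : ι → Bool) : o → Bool :=
  fun q => c.wireVal x (c.output q)

/-- Every gate computes its operation on the bits carried by the wires it reads. -/
theorem gateVal_eq (c : BoolCircuit ι o) (x : ι → Bool) (k : Fin c.size) :
    c.gateVal x k = (c.gate k).eval (c.wireVal x) := by
  rw [gateVal]
  apply BoolGate.eval_congr
  rintro (a | j) ha
  · rfl
  · simp [wireVal, c.acyclic k j ha]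

/-- The fan-out of a wire (a circuit input or the output of a gate): the number of gate inputs and
of circuit outputs that it feeds. -/
def fanOut [DecidableEq ι] [Fintype o] (c : BoolCircuit ι o) (s : ι ⊕ Fin c.size) : ℕ :=
  (∑ i : Fin c.size, (c.gate i).inputs.count s) + Fintype.card {q : o // c.output q = s}

end BoolCircuit

/-! ### Sorting elements that carry a one-bit key -/

/-- An element: a one-bit key together with a `w`-bit payload. -/
abbrev KeyedElement (w : ℕ) : Type := Bool × (Fin w → Bool)

/-- The names of the `n * (w + 1)` bits of an array of `n` elements: `(i, none)` is the key of the
`i`-th element, and `(i, some j)` is the `j`-th bit of its payload. -/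
abbrev ArrayBit (n w : ℕ) : Type := Fin n × Option (Fin w)

/-- The bits of an array. -/
def arrayToBits {n w : ℕ} (A : Fin n → KeyedElement w) : ArrayBit n w → Bool
  | (i, none) => (A i).1
  | (i, some j) => (A i).2 j

/-- A tight compaction circuit: on every input array it outputs a rearrangement of the array (each
element being moved together with its key) in which all elements with key 0 precede all elements
with key 1. Stability is not required. -/
def IsTightCompactor {n w : ℕ} (c : BoolCircuit (ArrayBit n w) (ArrayBit n w)) : Prop :=
  ∀ A : Fin n → KeyedElement w, ∃ σ : Equiv.Perm (Fin n),
    c.eval (arrayToBits A) = arrayToBits (fun i => A (σ i)) ∧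
    Monotone (fun i => (A (σ i)).1)

/-! ### Iterated logarithms -/

/-- The `c`-fold iterated binary logarithm of `x`. Negative values are replaced by `0` (and the
logarithm of `0` is `0`); so this is the usual iterated logarithm whenever that one is
defined and nonnegative, and it is `0` for all other `x ≥ 0` if `c ≥ 1`. -/
noncomputable def iterLog (c : ℕ) (x : ℝ) : ℝ := (fun y : ℝ => max 0 (Real.logb 2 y))^[c] x

theorem exists_iterLog_le_one (x : ℝ) : ∃ i : ℕ, iterLog i x ≤ 1 := by
  have step : ∀ y : ℝ, max 0 (Real.logb 2 y) ≤ max 1 (|y| - 1) := by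
    intro y
    refine max_le (le_max_of_le_left zero_le_one) ?_
    rcases le_or_gt |y| 2 with h | h
    · refine le_max_of_le_left ?_
      rw [← Real.logb_abs]
      rcases (abs_nonneg y).eq_or_lt with h0 | h0
      · simp [← h0]
      · rw [Real.logb_le_iff_le_rpow (by norm_num) h0]; simpa using h
    · refine le_max_of_le_right ?_
      rw [← Real.logb_abs, Real.logb_le_iff_le_rpow (by norm_num) (by linarith)]
      have := one_add_mul_self_le_rpow_one_add (s := 1) (by norm_num) (p := |y| - 1) (by linarith)
      norm_num at this
      simpa using this
  have key : ∀ k : ℕ, |iterLog k x| ≤ max 1 (|x| - k) := by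
    intro k
    induction k with
    | zero => simp [iterLog]
    | succ k ih =>
      have e : iterLog (k + 1) x = max 0 (Real.logb 2 (iterLog k x)) := by
        simp only [iterLog, Function.iterate_succ_apply']
      rw [e, abs_of_nonneg (le_max_left _ _)]
      refine (step _).trans (max_le (le_max_left _ _) ?_)
      push_cast
      rcases le_max_iff.1 ih with h | h
      · exact le_max_of_le_left (by linarith)
      · exact le_max_of_le_right (by linarith)
  obtain ⟨k, hk⟩ := exists_nat_ge |x|
  exact ⟨k, (le_abs_self _).trans ((key k).trans (max_le le_rfl (by linarith)))⟩

/-- `log* x`: the smallest `i` such that the `i`-fold iterated binary logarithm of `x` is at most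
one; it exists by `exists_iterLog_le_one`. -/
noncomputable def logStar (x : ℝ) : ℕ := sInf {i : ℕ | iterLog i x ≤ 1}

/-- `max(1, (log* n - log* w)^(2 + ε))`, which is `1` when the difference is not positive. -/
noncomputable def logStarFactor (ε : ℝ) (n w : ℕ) : ℝ :=
  max 1 ((max 0 ((logStar n : ℝ) - (logStar w : ℝ))) ^ (2 + ε))

/-! The cost splits into deciding and moving. If compaction is done by `b` conditional swaps whose
controls are computed from the keys with `a` gates (`HasCompaction n a b`), the same controls serve
all `w + 1` bit planes and the circuit has `a + O(b * w)` gates. So the goal is `b` close to linear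
in `n` while `a` may be larger by a factor `w`.

Compaction means rearranging the array to a prescribed key pattern (`HasMatching`), once the zeros
have been counted in unary with linearly many gates (`computes_thresholds`). Matching reduces to a
constant-factor smaller instance (`HasMatching.of_looseCompaction`): one pass over `O(n)`
well-mixing random pairs swaps misplaced elements of opposite keys, leaving only a small fraction
misplaced. Loose compaction brings these into a smaller array, the recursion repairs them there, and
the loose compaction is undone. The costs form a geometric series (`exists_hasMatching`).

Loose compaction is available in two ways. Along a random expander
(`hasLooseCompaction_of_expander`) it takes `8 * n` swaps but `O(n log n)` control gates, for
logarithmically many rounds of a matching algorithm. From compaction itself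
(`HasCompaction.hasLooseCompaction`): compact inside short chunks, then compact the array of chunks
so that the few dense ones come first; in all other chunks only a short prefix matters.

Starting from the expander, the second construction is iterated (`exists_compactionLevel`). With
chunks of length about `log^(2^k) n`, control cost `n log^(2^k) n` improves to `n log^(2^(k+1)) n`:
each step doubles the number of logarithms. The swaps grow by a factor 2 for rows and columns, 2 for
doing and undoing, and one arbitrarily close to 1 for the recursion, so level `k` costs `O(ρ^k * n)`
for any fixed `ρ > 4`. Put `ρ = 2^(2+ε)` and choose `k` least with `2^k ≥ max(0, log* n - log* w) +
1`: then `log^(2^k) n ≤ w`, and `ρ^k` is within a constant of the claimed factor.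

The bound with `2^w` comes from sorting by counting (`exists_tightCompactor_short`): for each of the
`2^(w+1)` values one counts the smaller elements and recreates the sorted array from the counts.
Finally, chains of copy gates reduce the fan-out to 3 at constant-factor cost
(`BoolCircuit.exists_fanOut_le`). -/

/-! ### Wires computed by straight-line programs -/

/-- The Boolean function `f` is the output of one gate that reads wires in `S`. A wire is
identified with the function of the world `ω` that it carries. -/
inductive GateOver {Ω : Type} (S : Set (Ω → Bool)) : (Ω → Bool) → Prop
  | and {f g : Ω → Bool} : f ∈ S → g ∈ S → GateOver S (fun ω => f ω && g ω)
  | or {f g : Ω → Bool} : f ∈ S → g ∈ S → GateOver S (fun ω => f ω || g ω)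
  | not {f : Ω → Bool} : f ∈ S → GateOver S (fun ω => !(f ω))

theorem GateOver.mono {Ω : Type} {S T : Set (Ω → Bool)} (h : S ⊆ T) {f : Ω → Bool}
    (hf : GateOver S f) : GateOver T f := by
  cases hf with
  | and a b => exact .and (h a) (h b)
  | or a b => exact .or (h a) (h b)
  | not a => exact .not (h a)

/-- A list of gate outputs, the latest first, each reading wires in `S` or earlier outputs. -/
inductive GateProgram {Ω : Type} (S : Set (Ω → Bool)) : List (Ω → Bool) → Prop
  | nil : GateProgram S []
  | cons {f : Ω → Bool} {l : List (Ω → Bool)} : GateProgram S l →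
      GateOver (S ∪ {g | g ∈ l}) f → GateProgram S (f :: l)

/-- All wires in `T` can be obtained from those in `S` with at most `k` gates. -/
def Computes {Ω : Type} (S : Set (Ω → Bool)) (k : ℕ) (T : Set (Ω → Bool)) : Prop :=
  ∃ l, GateProgram S l ∧ l.length ≤ k ∧ T ⊆ S ∪ {g | g ∈ l}

section

variable {Ω Ω' : Type}

theorem GateProgram.mono {S S' : Set (Ω → Bool)} (h : S ⊆ S') {l : List (Ω → Bool)}
    (hl : GateProgram S l) : GateProgram S' l := by
  induction hl with
  | nil => exact .nil
  | cons _ hf ih => exact .cons ih (hf.mono (Set.union_subset_union_left _ h))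

theorem GateProgram.append {S : Set (Ω → Bool)} {l l' : List (Ω → Bool)}
    (hl : GateProgram S l) (hl' : GateProgram (S ∪ {g | g ∈ l}) l') :
    GateProgram S (l' ++ l) := by
  induction hl' with
  | nil => exact hl
  | cons _ hf ih =>
    refine .cons ih (hf.mono ?_)
    intro g hg
    rcases hg with (hg | hg) | hg
    · exact Or.inl hg
    · exact Or.inr (List.mem_append.2 (Or.inr hg))
    · exact Or.inr (List.mem_append.2 (Or.inl hg))

/-- Precomposing with `φ` substitutes other wires for the inputs. A program designed once for
abstract inputs can thereby be run on any wires already computed; all recursive constructions below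
use it this way. -/
theorem GateProgram.comp (φ : Ω' → Ω) {S : Set (Ω → Bool)} {l : List (Ω → Bool)}
    (hl : GateProgram S l) : GateProgram ((· ∘ φ) '' S) (l.map (· ∘ φ)) := by
  induction hl with
  | nil => exact .nil
  | @cons f l _ hf ih =>
    refine .cons ih ?_
    have key : ∀ g ∈ S ∪ {g | g ∈ l},
        g ∘ φ ∈ ((· ∘ φ) '' S) ∪ {g | g ∈ l.map (· ∘ φ)} := by
      rintro g (hg | hg)
      · exact Or.inl ⟨g, hg, rfl⟩
      · exact Or.inr (List.mem_map.2 ⟨g, hg, rfl⟩)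
    cases hf with
    | and a b => exact .and (key _ a) (key _ b)
    | or a b => exact .or (key _ a) (key _ b)
    | not a => exact .not (key _ a)

namespace Computes

variable {S S' T T' U : Set (Ω → Bool)} {k l : ℕ} {f g : Ω → Bool}

theorem mono (h : Computes S k T) (hS : S ⊆ S') (hk : k ≤ l) (hT : T' ⊆ T) :
    Computes S' l T' := by
  obtain ⟨p, hp, hl, hsub⟩ := h
  exact ⟨p, hp.mono hS, hl.trans hk,
    (hT.trans hsub).trans (Set.union_subset_union_left _ hS)⟩

theorem mono_left (h : Computes S k T) (hS : S ⊆ S') : Computes S' k T :=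
  h.mono hS le_rfl subset_rfl

theorem mono_cost (h : Computes S k T) (hk : k ≤ l) : Computes S l T :=
  h.mono subset_rfl hk subset_rfl

theorem mono_right (h : Computes S k T) (hT : T' ⊆ T) : Computes S k T' :=
  h.mono subset_rfl le_rfl hT

theorem of_subset (h : T ⊆ S) : Computes S k T :=
  ⟨[], .nil, Nat.zero_le _, h.trans Set.subset_union_left⟩

theorem of_mem (h : f ∈ S) : Computes S 0 {f} := of_subset (by simpa using h)

theorem trans (h : Computes S k T) (h' : Computes (S ∪ T) l U) :
    Computes S (k + l) (T ∪ U) := by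
  obtain ⟨p, hp, hpl, hpT⟩ := h
  obtain ⟨q, hq, hql, hqU⟩ := h'
  have hST : S ∪ T ⊆ S ∪ {g | g ∈ p} := Set.union_subset Set.subset_union_left hpT
  refine ⟨q ++ p, hp.append (hq.mono hST), by simp; omega, ?_⟩
  rintro g (hg | hg)
  · rcases hpT hg with h | h
    · exact Or.inl h
    · exact Or.inr (List.mem_append.2 (Or.inr h))
  · rcases hqU hg with h | h
    · rcases hST h with h | h
      · exact Or.inl h
      · exact Or.inr (List.mem_append.2 (Or.inr h))
    · exact Or.inr (List.mem_append.2 (Or.inl h))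

/-- As `trans`, forgetting the intermediate wires. -/
theorem trans' (h : Computes S k T) (h' : Computes (S ∪ T) l U) : Computes S (k + l) U :=
  (h.trans h').mono_right Set.subset_union_right

theorem union (h : Computes S k T) (h' : Computes S l U) : Computes S (k + l) (T ∪ U) :=
  h.trans (h'.mono_left Set.subset_union_left)

theorem biUnion {ι : Type*} (s : Finset ι) {k : ι → ℕ} {T : ι → Set (Ω → Bool)}
    (h : ∀ i ∈ s, Computes S (k i) (T i)) : Computes S (∑ i ∈ s, k i) (⋃ i ∈ s, T i) := by
  classical
  induction s using Finset.induction_on with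
  | empty => exact of_subset (by simp)
  | insert a s ha ih =>
    rw [Finset.sum_insert ha, Finset.set_biUnion_insert]
    exact (h a (Finset.mem_insert_self _ _)).union
      (ih fun i hi => h i (Finset.mem_insert_of_mem hi))

theorem iUnion {ι : Type*} [Fintype ι] {k : ι → ℕ} {T : ι → Set (Ω → Bool)}
    (h : ∀ i, Computes S (k i) (T i)) : Computes S (∑ i, k i) (⋃ i, T i) := by
  simpa using biUnion Finset.univ fun i _ => h i

theorem range {ι : Type*} [Fintype ι] {F : ι → Ω → Bool} (h : ∀ i, Computes S k {F i}) :
    Computes S (Fintype.card ι * k) (Set.range F) := by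
  have := iUnion h
  simpa [Set.iUnion_singleton_eq_range] using this

theorem comp (φ : Ω' → Ω) (h : Computes S k T) :
    Computes ((· ∘ φ) '' S) k ((· ∘ φ) '' T) := by
  obtain ⟨p, hp, hpl, hpT⟩ := h
  refine ⟨_, hp.comp φ, by simpa using hpl, ?_⟩
  rintro _ ⟨g, hg, rfl⟩
  rcases hpT hg with h | h
  · exact Or.inl ⟨g, h, rfl⟩
  · exact Or.inr (List.mem_map.2 ⟨g, h, rfl⟩)

theorem of_gate (h : GateOver S f) : Computes S 1 {f} :=
  ⟨[f], .cons .nil (h.mono Set.subset_union_left), le_rfl, by simp⟩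

theorem and (hf : Computes S k {f}) (hg : Computes S l {g}) :
    Computes S (k + l + 1) {fun ω => f ω && g ω} :=
  (hf.union hg).trans' (of_gate (.and (by simp) (by simp)))

theorem or (hf : Computes S k {f}) (hg : Computes S l {g}) :
    Computes S (k + l + 1) {fun ω => f ω || g ω} :=
  (hf.union hg).trans' (of_gate (.or (by simp) (by simp)))

theorem not (hf : Computes S k {f}) : Computes S (k + 1) {fun ω => !(f ω)} :=
  hf.trans' (of_gate (.not (by simp)))

theorem xor (hf : Computes S k {f}) (hg : Computes S l {g}) :
    Computes S (k + l + 4) {fun ω => f ω ^^ g ω} := by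
  refine (hf.union hg).trans' ?_
  have h1 : Computes (S ∪ ({f} ∪ {g})) 0 {f} := of_mem (by simp)
  have h2 : Computes (S ∪ ({f} ∪ {g})) 0 {g} := of_mem (by simp)
  have := (h1.or h2).and (h1.and h2).not
  have e : (fun ω => f ω ^^ g ω) = fun ω => (f ω || g ω) && !(f ω && g ω) := by
    funext ω; cases f ω <;> cases g ω <;> rfl
  rw [e]
  exact this

theorem ite {c : Ω → Bool} {m : ℕ} (hc : Computes S m {c}) (hf : Computes S k {f})
    (hg : Computes S l {g}) :
    Computes S (m + k + l + 4) {fun ω => if c ω then f ω else g ω} := by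
  refine ((hc.union hf).union hg).trans' ?_
  have h0 : Computes (S ∪ (({c} ∪ {f}) ∪ {g})) 0 {c} := of_mem (by simp)
  have h1 : Computes (S ∪ (({c} ∪ {f}) ∪ {g})) 0 {f} := of_mem (by simp)
  have h2 : Computes (S ∪ (({c} ∪ {f}) ∪ {g})) 0 {g} := of_mem (by simp)
  have := (h0.and h1).or (h0.not.and h2)
  have e : (fun ω => if c ω then f ω else g ω) =
      fun ω => (c ω && f ω) || (!(c ω) && g ω) := by
    funext ω; cases c ω <;> simp
  rw [e]
  exact this

/-- The disjunction of a list of wires. -/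
theorem any {ι : Type*} (L : List ι) (F : ι → Ω → Bool) (hc : (fun _ => false) ∈ S)
    (h : ∀ i ∈ L, Computes S k {F i}) :
    Computes S (L.length * (k + 1)) {fun ω => L.any fun i => F i ω} := by
  induction L with
  | nil => exact of_subset (by simpa using hc)
  | cons a L ih =>
    have := (h a (by simp)).or (ih fun i hi => h i (by simp [hi]))
    simp only [List.any_cons, List.length_cons]
    exact this.mono_cost (by ring_nf; omega)

end Computes

end

/-- The two constant wires. -/
def constWires (Ω : Type) : Set (Ω → Bool) := {fun _ => false, fun _ => true}

theorem false_mem_constWires {Ω : Type} : (fun _ => false) ∈ constWires Ω := Or.inl rfl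

theorem true_mem_constWires {Ω : Type} : (fun _ => true) ∈ constWires Ω := Or.inr rfl

/-- Constants are `f ∧ ¬f` and `f ∨ ¬f`. There are no constant gates, so some wire must exist, which
excludes empty arrays later on. -/
theorem Computes.constWires {Ω : Type} {S : Set (Ω → Bool)} (h : S.Nonempty) :
    Computes S 5 (constWires Ω) := by
  obtain ⟨f, hf⟩ := h
  have h1 := Computes.of_mem hf
  have := (h1.and h1.not).union (h1.or h1.not)
  refine this.mono_cost (by norm_num) |>.mono_right ?_
  rintro g (rfl | rfl)
  · left; funext ω; simp
  · right; funext ω; simp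

theorem constWires_comp {Ω Ω' : Type} (φ : Ω' → Ω) {f : Ω → Bool} (h : f ∈ constWires Ω) :
    f ∘ φ ∈ constWires Ω' := by
  rcases h with rfl | rfl
  · exact Or.inl rfl
  · exact Or.inr rfl

/-! ### From programs to circuits -/

/-- Reading the list from its end gives an indexing in topological order, as circuits require. -/
theorem GateProgram.exists_family {Ω : Type} {S : Set (Ω → Bool)} {l : List (Ω → Bool)}
    (hl : GateProgram S l) : ∃ F : Fin l.length → Ω → Bool,
      (∀ i, GateOver (S ∪ {g | ∃ j < i, F j = g}) (F i)) ∧ ∀ g ∈ l, ∃ i, F i = g := by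
  induction hl with
  | nil => exact ⟨fun i => i.elim0, fun i => i.elim0, by simp⟩
  | @cons f l _ hf ih =>
    obtain ⟨F, hF, hsurj⟩ := ih
    refine ⟨Fin.snoc (α := fun _ => Ω → Bool) F f, ?_, ?_⟩
    · intro i
      induction i using Fin.lastCases with
      | last =>
        simp only [Fin.snoc_last]
        refine hf.mono ?_
        rintro g (hg | hg)
        · exact Or.inl hg
        · obtain ⟨j, rfl⟩ := hsurj g hg
          exact Or.inr ⟨j.castSucc, Fin.castSucc_lt_last j, by simp⟩
      | cast i =>
        simp only [Fin.snoc_castSucc]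
        refine (hF i).mono ?_
        rintro g (hg | ⟨j, hj, rfl⟩)
        · exact Or.inl hg
        · exact Or.inr ⟨j.castSucc, by simpa using hj, by simp⟩
    · intro g hg
      rcases List.mem_cons.1 hg with rfl | hg
      · exact ⟨Fin.last _, by simp⟩
      · obtain ⟨j, rfl⟩ := hsurj g hg
        exact ⟨j.castSucc, by simp⟩

/-- By acyclicity the local gate equations have only one solution, so it suffices to check these
equations to identify the values of a circuit. -/
theorem BoolCircuit.gateVal_unique {ι o : Type} (c : BoolCircuit ι o) (x : ι → Bool)
    (v : Fin c.size → Bool) (hv : ∀ k, v k = (c.gate k).eval (Sum.elim x v)) :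
    c.gateVal x = v := by
  have key : ∀ m (k : Fin c.size), k.val < m → c.gateVal x k = v k := by
    intro m
    induction m with
    | zero => intro k hk; omega
    | succ m ih =>
      intro k hk
      rw [c.gateVal_eq, hv]
      apply BoolGate.eval_congr
      rintro (a | j) ha
      · rfl
      · have := c.acyclic k j ha
        exact ih j (by rw [Fin.lt_def] at this; omega)
  funext k
  exact key _ k (Nat.lt_succ_self _)

/-- A family of wires computed from the input wires is computed by a circuit. -/
theorem Computes.exists_circuit {ι o : Type} {k : ℕ} (f : (ι → Bool) → o → Bool)
    (h : Computes (Set.range fun i (x : ι → Bool) => x i) k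
      (Set.range fun q (x : ι → Bool) => f x q)) :
    ∃ c : BoolCircuit ι o, c.size ≤ k ∧ ∀ x, c.eval x = f x := by
  classical
  obtain ⟨l, hl, hk, hsub⟩ := h
  obtain ⟨F, hF, hsurj⟩ := hl.exists_family
  set val : (ι → Bool) → ι ⊕ Fin l.length → Bool := fun x => Sum.elim x fun j => F j x
    with hval
  have wire : ∀ (P : Fin l.length → Prop) (g : (ι → Bool) → Bool),
      g ∈ (Set.range fun i (x : ι → Bool) => x i) ∪ {g | ∃ j, P j ∧ F j = g} →
      ∃ a : ι ⊕ Fin l.length, (∀ j, a = Sum.inr j → P j) ∧ ∀ x, val x a = g x := by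
    rintro P g (⟨i, rfl⟩ | ⟨j, hj, rfl⟩)
    · exact ⟨Sum.inl i, by simp, fun x => rfl⟩
    · exact ⟨Sum.inr j, by simpa using hj, fun x => rfl⟩
  have gates : ∀ i, ∃ g : BoolGate (ι ⊕ Fin l.length),
      (∀ j, Sum.inr j ∈ g.inputs → j < i) ∧ ∀ x, g.eval (val x) = F i x := by
    intro i
    generalize hFi : F i = fi
    have := hF i
    rw [hFi] at this
    cases this with
    | and ha hb =>
      obtain ⟨a, ha, ha'⟩ := wire (· < i) _ ha
      obtain ⟨b, hb, hb'⟩ := wire (· < i) _ hb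
      refine ⟨.and a b, ?_, fun x => by simp [BoolGate.eval, ha', hb']⟩
      intro j hj
      simp only [BoolGate.inputs, List.mem_cons, List.not_mem_nil, or_false] at hj
      rcases hj with h | h
      · exact ha j h.symm
      · exact hb j h.symm
    | or ha hb =>
      obtain ⟨a, ha, ha'⟩ := wire (· < i) _ ha
      obtain ⟨b, hb, hb'⟩ := wire (· < i) _ hb
      refine ⟨.or a b, ?_, fun x => by simp [BoolGate.eval, ha', hb']⟩
      intro j hj
      simp only [BoolGate.inputs, List.mem_cons, List.not_mem_nil, or_false] at hj
      rcases hj with h | h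
      · exact ha j h.symm
      · exact hb j h.symm
    | not ha =>
      obtain ⟨a, ha, ha'⟩ := wire (· < i) _ ha
      refine ⟨.not a, ?_, fun x => by simp [BoolGate.eval, ha']⟩
      intro j hj
      simp only [BoolGate.inputs, List.mem_cons, List.not_mem_nil, or_false] at hj
      exact ha j hj.symm
  choose G hG hGe using gates
  have outs : ∀ q : o, ∃ a : ι ⊕ Fin l.length, ∀ x, val x a = f x q := by
    intro q
    have hq := hsub ⟨q, rfl⟩
    obtain ⟨a, -, ha⟩ := wire (fun _ => True) (fun x => f x q) (by
      rcases hq with hq | hq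
      · exact Or.inl hq
      · obtain ⟨j, hj⟩ := hsurj _ hq
        exact Or.inr ⟨j, trivial, hj⟩)
    exact ⟨a, ha⟩
  choose out hout using outs
  let c : BoolCircuit ι o := ⟨l.length, G, hG, out⟩
  have hc : ∀ x, c.gateVal x = fun j => F j x := fun x =>
    c.gateVal_unique x _ fun j => (hGe j x).symm
  refine ⟨c, hk, fun x => ?_⟩
  funext q
  rw [← hout q x]
  show Sum.elim x (c.gateVal x) (out q) = _
  rw [hval]
  rw [hc x]

/-! ### Reducing the fan-out -/

/-- Fan-out is counted in lists over a sum type of wires; the counting lemmas need Boolean equality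
there to agree with equality. -/
instance Sum.lawfulBEq {α β : Type*} [BEq α] [LawfulBEq α] [BEq β] [LawfulBEq β] :
    LawfulBEq (α ⊕ β) where
  eq_of_beq {a b} h := by
    rcases a with a | a <;> rcases b with b | b
    · exact congrArg _ (eq_of_beq (α := α) h)
    · exact absurd h Bool.false_ne_true
    · exact absurd h Bool.false_ne_true
    · exact congrArg _ (eq_of_beq (α := β) h)
  rfl {a} := by
    rcases a with a | a
    · exact beq_self_eq_true (α := α) a
    · exact beq_self_eq_true (α := β) a

namespace BoolGate

/-- The gate with its wires renamed. -/
def map {V W : Type} (f : V → W) : BoolGate V → BoolGate W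
  | .and a b => .and (f a) (f b)
  | .or a b => .or (f a) (f b)
  | .not a => .not (f a)

theorem inputs_map {V W : Type} (f : V → W) (g : BoolGate V) :
    (g.map f).inputs = g.inputs.map f := by
  cases g <;> rfl

theorem eval_map {V W : Type} (f : V → W) (g : BoolGate V) (v : W → Bool) :
    (g.map f).eval v = g.eval (v ∘ f) := by
  cases g <;> rfl

/-- The wires read by a gate; a gate with one input reads it at both positions. -/
def source {W : Type} : BoolGate W → Bool → W
  | .and a b => fun t => if t then b else a
  | .or a b => fun t => if t then b else a
  | .not a => fun _ => a

theorem source_mem_inputs {W : Type} (g : BoolGate W) (t : Bool) : g.source t ∈ g.inputs := by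
  cases g <;> cases t <;> simp [source, inputs]

/-- The same gate reading other wires. -/
def rewire {V W : Type} (f : Bool → W) : BoolGate V → BoolGate W
  | .and _ _ => .and (f false) (f true)
  | .or _ _ => .or (f false) (f true)
  | .not _ => .not (f false)

theorem mem_inputs_rewire {V W : Type} {f : Bool → W} {g : BoolGate V} {a : W}
    (h : a ∈ (g.rewire f).inputs) : ∃ t, a = f t := by
  cases g <;> simp [rewire, inputs] at h
  · rcases h with h | h <;> exact ⟨_, h⟩
  · rcases h with h | h <;> exact ⟨_, h⟩
  · exact ⟨_, h⟩

theorem count_inputs_rewire_le {V W : Type} [BEq W] [LawfulBEq W] [DecidableEq W] (f : Bool → W) (g : BoolGate V)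
    (a : W) : (g.rewire f).inputs.count a ≤
      (if f false = a then 1 else 0) + (if f true = a then 1 else 0) := by
  cases g <;> simp [rewire, inputs, List.count_cons, beq_iff_eq] <;> omega

theorem eval_rewire {V W : Type} (f : Bool → W) (g : BoolGate V) (v : V → Bool) (w : W → Bool)
    (h : ∀ t, w (f t) = v (g.source t)) : (g.rewire f).eval w = g.eval v := by
  have h0 := h false
  have h1 := h true
  cases g <;> simp_all [rewire, eval, source]

end BoolGate

/-- A circuit whose gates are indexed by a finite type with a topological order. -/
theorem exists_circuit_of_rank {ι o G : Type} [Fintype G] (gate : G → BoolGate (ι ⊕ G))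
    (rank : G → ℕ) (hrank : Function.Injective rank)
    (hacyc : ∀ g h, Sum.inr h ∈ (gate g).inputs → rank h < rank g) (out : o → ι ⊕ G) :
    ∃ (c : BoolCircuit ι o) (e : G ≃ Fin c.size), c.size = Fintype.card G ∧
      (∀ g, c.gate (e g) = (gate g).map (Sum.map id e)) ∧
      ∀ q, c.output q = Sum.map id e (out q) := by
  let _ : LinearOrder G := LinearOrder.lift' rank hrank
  let e : G ≃o Fin (Fintype.card G) := (Fintype.orderIsoFinOfCardEq G rfl).symm
  refine ⟨⟨Fintype.card G, fun i => (gate (e.symm i)).map (Sum.map id e), ?_,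
    fun q => Sum.map id e (out q)⟩, e.toEquiv, rfl, fun g => ?_, fun q => rfl⟩
  · intro i j hj
    rw [BoolGate.inputs_map, List.mem_map] at hj
    obtain ⟨a, ha, haj⟩ := hj
    cases a with
    | inl a => simp at haj
    | inr h =>
      have h1 : e h = j := by simpa using haj
      have h2 : h < e.symm i := hacyc _ _ ha
      rw [← h1]
      simpa using e.lt_iff_lt.2 h2
  · simp

theorem sum_ite_eq_le_one {κ W : Type*} [Fintype κ] [DecidableEq W] {F : κ → W}
    (hF : Function.Injective F) (a : W) : (∑ k, if F k = a then 1 else 0) ≤ 1 := by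
  rw [← Finset.card_filter, Finset.card_le_one]
  intro x hx y hy
  simp only [Finset.mem_filter, Finset.mem_univ, true_and] at hx hy
  exact hF (hx.trans hy.symm)

/-- Successive consumers of the same wire form a chain. -/
theorem exists_chain {κ W : Type} [Finite κ] (wire : κ → W) (rank : κ → ℕ)
    (hrank : Function.Injective rank) :
    ∃ src : κ → W ⊕ κ, Function.Injective src ∧
      (∀ k a, src k = Sum.inl a → a = wire k) ∧
      ∀ k l, src k = Sum.inr l → wire l = wire k ∧ rank l < rank k := by
  classical
  have _ := Fintype.ofFinite κ
  -- The source of `k` is its predecessor, by rank, among the consumers of its wire, or the wire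
  -- itself if `k` is the first. A predecessor determines its successor, hence the injectivity.
  have key : ∀ k, ∃ s : W ⊕ κ, (s = Sum.inl (wire k) ∧ ∀ l, wire l = wire k → rank k ≤ rank l) ∨
      ∃ l, s = Sum.inr l ∧ wire l = wire k ∧ rank l < rank k ∧
        ∀ m, wire m = wire k → rank m < rank k → rank m ≤ rank l := by
    intro k
    by_cases h : ∃ l, wire l = wire k ∧ rank l < rank k
    · obtain ⟨l, hl, hmax⟩ := Finset.exists_max_image
        (Finset.univ.filter fun l => wire l = wire k ∧ rank l < rank k) rank
        (by obtain ⟨l, hl⟩ := h; exact ⟨l, by simpa using hl⟩)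
      simp only [Finset.mem_filter, Finset.mem_univ, true_and] at hl hmax
      exact ⟨Sum.inr l, Or.inr ⟨l, rfl, hl.1, hl.2, fun m h1 h2 => hmax m ⟨h1, h2⟩⟩⟩
    · push Not at h
      exact ⟨_, Or.inl ⟨rfl, h⟩⟩
  choose src hsrc using key
  refine ⟨src, ?_, ?_, ?_⟩
  · intro k l hkl
    apply hrank
    rcases hsrc k with ⟨h1, h2⟩ | ⟨p, h1, h2, h3, h4⟩ <;>
      rcases hsrc l with ⟨h1', h2'⟩ | ⟨p', h1', h2', h3', h4'⟩
    · rw [h1, h1', Sum.inl.injEq] at hkl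
      exact le_antisymm (h2 l hkl.symm) (h2' k hkl)
    · rw [h1, h1'] at hkl; cases hkl
    · rw [h1, h1'] at hkl; cases hkl
    · rw [h1, h1', Sum.inr.injEq] at hkl
      subst hkl
      rcases lt_trichotomy (rank k) (rank l) with h | h | h
      · have := h4' k (by rw [← h2, h2']) h; omega
      · exact h
      · have := h4 l (by rw [← h2, h2']) h; omega
  · intro k a h
    rcases hsrc k with ⟨h1, -⟩ | ⟨p, h1, -⟩
    · rw [h1, Sum.inl.injEq] at h; exact h.symm
    · rw [h1] at h; cases h
  · intro k l h
    rcases hsrc k with ⟨h1, -⟩ | ⟨p, h1, h2, h3, -⟩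
    · rw [h1] at h; cases h
    · rw [h1, Sum.inr.injEq] at h; subst h; exact ⟨h2, h3⟩

/-- Each gate position and each output gets its own copy gate `x ∧ x`, and the copies of one wire
form a chain. A wire then feeds at most one copy gate, which reads it twice, and at most one
original consumer: fan-out `2 + 1`. Negations get two copies as well and ignore the second. -/
theorem BoolCircuit.exists_fanOut_le {ι o : Type} [DecidableEq ι] [Fintype o]
    (c : BoolCircuit ι o) :
    ∃ c' : BoolCircuit ι o, c'.size = 3 * c.size + Fintype.card o ∧
      (∀ x, c'.eval x = c.eval x) ∧ ∀ s, c'.fanOut s ≤ 3 := by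
  classical
  let wire : ((Fin c.size × Bool) ⊕ o) → ι ⊕ Fin c.size := Sum.elim (fun p => (c.gate p.1).source p.2) c.output
  -- Topological order: gate `i` sits at `3 * i + 2`, preceded by its copies at `3 * i` and `3 * i +
  -- 1`; the copies for outputs come last.
  let rank : ((Fin c.size × Bool) ⊕ o) → ℕ := Sum.elim (fun p => 3 * p.1.val + p.2.toNat)
    (fun q => 3 * c.size + (Fintype.equivFin o q).val)
  have hrank : Function.Injective rank := by
    rintro (⟨i, s⟩ | q) (⟨j, t⟩ | r) h
    · simp only [rank, Sum.elim_inl] at h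
      have hs := Bool.toNat_le s
      have ht := Bool.toNat_le t
      have h1 : i = j := Fin.ext (by omega)
      have h2 : s.toNat = t.toNat := by omega
      have h3 : s = t := by cases s <;> cases t <;> simp_all
      rw [h1, h3]
    · simp only [rank, Sum.elim_inl, Sum.elim_inr] at h
      have hs := Bool.toNat_le s
      have := i.isLt
      omega
    · simp only [rank, Sum.elim_inl, Sum.elim_inr] at h
      have hs := Bool.toNat_le t
      have := j.isLt
      omega
    · simp only [rank, Sum.elim_inr] at h
      have : (Fintype.equivFin o) q = (Fintype.equivFin o) r := Fin.ext (by omega)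
      rw [(Fintype.equivFin o).injective this]
  obtain ⟨src, hinj, hsl, hsr⟩ := exists_chain wire rank hrank
  let emb : (ι ⊕ Fin c.size) ⊕ ((Fin c.size × Bool) ⊕ o) → ι ⊕ (((Fin c.size × Bool) ⊕ o) ⊕ Fin c.size) :=
    Sum.elim (Sum.map id Sum.inr) (fun k => Sum.inr (Sum.inl k))
  have hemb : Function.Injective emb := by
    rintro ((a | a) | a) ((b | b) | b) h <;> simp_all [emb]
  let gate : (((Fin c.size × Bool) ⊕ o) ⊕ Fin c.size) → BoolGate (ι ⊕ (((Fin c.size × Bool) ⊕ o) ⊕ Fin c.size)) := Sum.elim (fun k => .and (emb (src k)) (emb (src k)))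
    (fun i => (c.gate i).rewire fun t => Sum.inr (Sum.inl (Sum.inl (i, t))))
  let rankG : (((Fin c.size × Bool) ⊕ o) ⊕ Fin c.size) → ℕ := Sum.elim rank fun i => 3 * i.val + 2
  have hrankG : Function.Injective rankG := by
    rintro (k | i) (l | j) h
    · exact congrArg _ (hrank h)
    · exfalso
      simp only [rankG, Sum.elim_inl, Sum.elim_inr] at h
      have := j.isLt
      rcases k with ⟨i, s⟩ | q
      · simp only [rank, Sum.elim_inl] at h
        have hs := Bool.toNat_le s
        omega
      · simp only [rank, Sum.elim_inr] at h
        omega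
    · exfalso
      simp only [rankG, Sum.elim_inl, Sum.elim_inr] at h
      have := i.isLt
      rcases l with ⟨j, s⟩ | q
      · simp only [rank, Sum.elim_inl] at h
        have hs := Bool.toNat_le s
        omega
      · simp only [rank, Sum.elim_inr] at h
        omega
    · simp only [rankG, Sum.elim_inr] at h
      exact congrArg _ (Fin.ext (by omega))
  have hacyc : ∀ g h, Sum.inr h ∈ (gate g).inputs → rankG h < rankG g := by
    rintro (k | i) h hh
    · have hh' : emb (src k) = Sum.inr h := by
        simpa [gate, BoolGate.inputs, eq_comm] using hh
      rcases hs : src k with a | l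
      · have ha := hsl k a hs
        rw [hs] at hh'
        rcases a with a | j
        · simp [emb] at hh'
        · have hj : h = Sum.inr j := by simpa [emb, eq_comm] using hh'
          subst hj
          show 3 * j.val + 2 < rank k
          rcases k with ⟨i, s⟩ | q
          · have := c.acyclic i j (by
              rw [ha]; exact BoolGate.source_mem_inputs _ _)
            simp only [rank, Sum.elim_inl]
            rw [Fin.lt_def] at this
            omega
          · simp only [rank, Sum.elim_inr]
            omega
      · rw [hs] at hh'
        have hj : h = Sum.inl l := by simpa [emb, eq_comm] using hh'
        subst hj
        exact (hsr k l hs).2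
    · obtain ⟨t, ht⟩ := BoolGate.mem_inputs_rewire
        (f := fun t => Sum.inr (Sum.inl (Sum.inl (i, t)))) (g := c.gate i) hh
      simp only [Sum.inr.injEq] at ht
      subst ht
      have := Bool.toNat_le t
      simp only [rankG, rank, Sum.elim_inl, Sum.elim_inr]
      omega
  obtain ⟨c', e, hsize, hgate, hout⟩ := exists_circuit_of_rank gate rankG hrankG hacyc
    (fun q => Sum.inr (Sum.inl (Sum.inr q)))
  refine ⟨c', ?_, ?_, ?_⟩
  · rw [hsize]
    simp
    ring
  · intro x
    let v : (((Fin c.size × Bool) ⊕ o) ⊕ Fin c.size) → Bool := Sum.elim (fun k => c.wireVal x (wire k)) (c.gateVal x)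
    have hv : ∀ g, v g = (gate g).eval (Sum.elim x v) := by
      rintro (k | i)
      · show c.wireVal x (wire k) = (Sum.elim x v (emb (src k)) && Sum.elim x v (emb (src k)))
        rw [Bool.and_self]
        rcases hs : src k with a | l
        · rw [← hsl k a hs]
          rcases a with a | j <;> rfl
        · rw [← (hsr k l hs).1]
          rfl
      · show c.gateVal x i = _
        rw [c.gateVal_eq]
        exact (BoolGate.eval_rewire (fun t => Sum.inr (Sum.inl (Sum.inl (i, t)))) (c.gate i)
          (c.wireVal x) (Sum.elim x v) fun t => rfl).symm
    have hval : c'.gateVal x = v ∘ e.symm := by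
      apply c'.gateVal_unique
      intro k
      obtain ⟨g, rfl⟩ := e.surjective k
      rw [hgate, BoolGate.eval_map]
      have : Sum.elim x (v ∘ e.symm) ∘ Sum.map id e = Sum.elim x v := by
        funext a; rcases a with a | a <;> simp
      rw [this]
      simpa using hv g
    funext q
    show c'.wireVal x (c'.output q) = _
    rw [hout, BoolCircuit.wireVal, hval]
    simp [v, wire, BoolCircuit.eval]
  · intro s
    have hE : Function.Bijective (Sum.map id e : ι ⊕ (((Fin c.size × Bool) ⊕ o) ⊕ Fin c.size) → ι ⊕ Fin c'.size) :=
      (Equiv.sumCongr (Equiv.refl ι) e).bijective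
    obtain ⟨s, rfl⟩ := hE.2 s
    have h1 : (∑ i : Fin c'.size, (c'.gate i).inputs.count (Sum.map id e s)) =
        ∑ g : (((Fin c.size × Bool) ⊕ o) ⊕ Fin c.size), (gate g).inputs.count s := by
      rw [← e.sum_comp]
      refine Finset.sum_congr rfl fun g _ => ?_
      rw [hgate, BoolGate.inputs_map, List.count_map_of_injective _ _ hE.1]
    have h2 : Fintype.card {q : o // c'.output q = Sum.map id e s} =
        ∑ q : o, if (Sum.inr (Sum.inl (Sum.inr q)) : ι ⊕ (((Fin c.size × Bool) ⊕ o) ⊕ Fin c.size)) = s then 1 else 0 := by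
      rw [← Finset.card_filter, Fintype.card_subtype]
      congr 1
      ext q
      simp only [Finset.mem_filter, Finset.mem_univ, true_and]
      rw [hout]
      exact hE.1.eq_iff
    rw [BoolCircuit.fanOut, h1, h2, Fintype.sum_sum_type]
    have h3 : (∑ k : ((Fin c.size × Bool) ⊕ o), (gate (Sum.inl k)).inputs.count s) ≤ 2 := by
      have : ∀ k : ((Fin c.size × Bool) ⊕ o), (gate (Sum.inl k)).inputs.count s =
          2 * if emb (src k) = s then 1 else 0 := by
        intro k
        show List.count s [emb (src k), emb (src k)] = _
        rw [List.count_cons, List.count_cons, List.count_nil]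
        by_cases h : emb (src k) = s <;> simp [h]
      rw [Finset.sum_congr rfl fun k _ => this k, ← Finset.mul_sum]
      have := sum_ite_eq_le_one (hemb.comp hinj) s
      simp only [Function.comp_apply] at this
      omega
    have h4 : (∑ i : Fin c.size, (gate (Sum.inr i)).inputs.count s) ≤
        ∑ p : Fin c.size × Bool, if (Sum.inr (Sum.inl (Sum.inl p)) : ι ⊕ (((Fin c.size × Bool) ⊕ o) ⊕ Fin c.size)) = s then 1 else 0 := by
      rw [Fintype.sum_prod_type]
      refine Finset.sum_le_sum fun i _ => ?_
      rw [Fintype.sum_bool, add_comm]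
      exact BoolGate.count_inputs_rewire_le (fun t => Sum.inr (Sum.inl (Sum.inl (i, t))))
        (c.gate i) s
    have h5 := sum_ite_eq_le_one (F := fun k : ((Fin c.size × Bool) ⊕ o) => (Sum.inr (Sum.inl k) : ι ⊕ (((Fin c.size × Bool) ⊕ o) ⊕ Fin c.size)))
      (fun a b h => by simpa using h) s
    rw [Fintype.sum_sum_type] at h5
    omega

/-! ### Networks of controlled swaps -/

/-- A list of controlled swaps; each swaps two positions in the worlds where its control wire
carries `true`. -/
abbrev SwapNet (ι Ω : Type) : Type := List ((ι × ι) × (Ω → Bool))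

namespace SwapNet

variable {ι κ Ω Ω' : Type}

/-- The wires controlling the swaps. -/
def controls (N : SwapNet ι Ω) : Set (Ω → Bool) := {c | ∃ s ∈ N, s.2 = c}

/-- The network with positions and worlds renamed. -/
def map (f : ι → κ) (φ : Ω' → Ω) (N : SwapNet ι Ω) : SwapNet κ Ω' :=
  List.map (fun s => ((f s.1.1, f s.1.2), s.2 ∘ φ)) N

theorem length_map (f : ι → κ) (φ : Ω' → Ω) (N : SwapNet ι Ω) :
    List.length (N.map f φ) = List.length N := List.length_map _

theorem controls_map (f : ι → κ) (φ : Ω' → Ω) (N : SwapNet ι Ω) :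
    (N.map f φ).controls = (· ∘ φ) '' N.controls := by
  ext c
  constructor
  · rintro ⟨s, hs, rfl⟩
    obtain ⟨t, ht, rfl⟩ := List.mem_map.1 hs
    exact ⟨t.2, ⟨t, ht, rfl⟩, rfl⟩
  · rintro ⟨_, ⟨t, ht, rfl⟩, rfl⟩
    exact ⟨_, List.mem_map.2 ⟨t, ht, rfl⟩, rfl⟩

theorem controls_append (N N' : SwapNet ι Ω) :
    controls (N ++ N') = N.controls ∪ N'.controls := by
  ext c
  constructor
  · rintro ⟨s, hs, rfl⟩
    rcases List.mem_append.1 hs with h | h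
    · exact Or.inl ⟨s, h, rfl⟩
    · exact Or.inr ⟨s, h, rfl⟩
  · rintro (⟨s, hs, rfl⟩ | ⟨s, hs, rfl⟩)
    · exact ⟨s, List.mem_append.2 (Or.inl hs), rfl⟩
    · exact ⟨s, List.mem_append.2 (Or.inr hs), rfl⟩

theorem controls_cons (s : (ι × ι) × (Ω → Bool)) (N : SwapNet ι Ω) :
    controls (s :: N) = {s.2} ∪ controls N := by
  ext c
  constructor
  · rintro ⟨t, ht, rfl⟩
    rcases List.mem_cons.1 ht with rfl | h
    · exact Or.inl rfl
    · exact Or.inr ⟨t, h, rfl⟩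
  · rintro (rfl | ⟨t, ht, rfl⟩)
    · exact ⟨s, List.mem_cons_self, rfl⟩
    · exact ⟨t, List.mem_cons_of_mem _ ht, rfl⟩

theorem controls_reverse (N : SwapNet ι Ω) : controls (List.reverse N) = controls N := by
  ext c; simp [controls]

variable [DecidableEq ι] [DecidableEq κ]

/-- The permutation realized in the world `ω`: after the network has been applied, position `p`
holds what was at position `N.perm ω p` before. -/
def perm : SwapNet ι Ω → Ω → Equiv.Perm ι
  | [], _ => 1
  | s :: N, ω => (if s.2 ω then Equiv.swap s.1.1 s.1.2 else 1) * perm N ω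

@[simp] theorem perm_nil (ω : Ω) : perm ([] : SwapNet ι Ω) ω = 1 := rfl

theorem perm_cons (s : (ι × ι) × (Ω → Bool)) (N : SwapNet ι Ω) (ω : Ω) :
    perm (s :: N) ω = (if s.2 ω then Equiv.swap s.1.1 s.1.2 else 1) * perm N ω := rfl

theorem perm_append (N N' : SwapNet ι Ω) (ω : Ω) :
    perm (N ++ N') ω = perm N ω * perm N' ω := by
  induction N with
  | nil => simp
  | cons s N ih => rw [List.cons_append, perm_cons, perm_cons, ih, mul_assoc]

/-- Swaps are involutions, so the same controls in reversed order undo the network. Undoing needs no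
new control gates. -/
theorem perm_reverse (N : SwapNet ι Ω) (ω : Ω) :
    perm (List.reverse N) ω = (perm N ω)⁻¹ := by
  induction N with
  | nil => simp
  | cons s N ih =>
    rw [List.reverse_cons, perm_append, ih, perm_cons, perm_cons, perm_nil, mul_one, mul_inv_rev]
    congr 1
    split_ifs
    · exact (Equiv.swap_inv _ _).symm
    · exact inv_one.symm

theorem perm_map_apply {f : ι → κ} (hf : Function.Injective f) (φ : Ω' → Ω) (N : SwapNet ι Ω)
    (ω : Ω') (p : ι) : (N.map f φ).perm ω (f p) = f (N.perm (φ ω) p) := by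
  induction N with
  | nil => rfl
  | cons s N ih =>
    have e : SwapNet.map f φ (s :: N) =
        (((f s.1.1, f s.1.2), s.2 ∘ φ) : (κ × κ) × (Ω' → Bool)) :: SwapNet.map f φ N := rfl
    rw [e, perm_cons, perm_cons, Equiv.Perm.mul_apply, Equiv.Perm.mul_apply, ih]
    simp only [Function.comp_apply]
    split_ifs
    · exact (hf.map_swap _ _ _).symm
    · rfl

theorem perm_map_of_notMem {f : ι → κ} (φ : Ω' → Ω) (N : SwapNet ι Ω) (ω : Ω') {p : κ}
    (hp : p ∉ Set.range f) : (N.map f φ).perm ω p = p := by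
  induction N with
  | nil => rfl
  | cons s N ih =>
    have e : SwapNet.map f φ (s :: N) =
        (((f s.1.1, f s.1.2), s.2 ∘ φ) : (κ × κ) × (Ω' → Bool)) :: SwapNet.map f φ N := rfl
    rw [e, perm_cons, Equiv.Perm.mul_apply, ih]
    split_ifs
    · exact Equiv.swap_apply_of_ne_of_ne (fun h => hp ⟨_, h.symm⟩) (fun h => hp ⟨_, h.symm⟩)
    · rfl

/-- Applying a network to an array of bits takes a constant number of gates per swap. -/
theorem computes_apply (N : SwapNet ι Ω) (X : ι → Ω → Bool) {S : Set (Ω → Bool)}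
    (hc : N.controls ⊆ S) (hX : ∀ p, X p ∈ S) :
    Computes S (8 * List.length N) (Set.range fun p ω => X (N.perm ω p) ω) := by
  induction N generalizing X S with
  | nil => exact Computes.of_subset (by rintro _ ⟨p, rfl⟩; exact hX p)
  | cons s N ih =>
    rw [controls_cons] at hc
    -- The array after the first swap. Only two positions change, each by one multiplexer of four
    -- gates.
    let Y : ι → Ω → Bool := fun p ω => X ((if s.2 ω then Equiv.swap s.1.1 s.1.2 else 1) p) ω
    have hs : Computes S 0 {s.2} := .of_mem (hc (Or.inl rfl))
    have h1 := hs.ite (Computes.of_mem (hX s.1.2)) (Computes.of_mem (hX s.1.1))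
    have h2 := hs.ite (Computes.of_mem (hX s.1.1)) (Computes.of_mem (hX s.1.2))
    have hY : Computes S 8 (S ∪ Set.range Y) := by
      have h3 := (Computes.of_subset (k := 0) (subset_refl S)).union (h1.union h2)
      refine h3.mono_cost (by norm_num) |>.mono_right ?_
      refine Set.union_subset Set.subset_union_left ?_
      rintro _ ⟨p, rfl⟩
      by_cases hp : p = s.1.1
      · right; left
        funext ω
        simp only [Y, hp]
        by_cases h : s.2 ω <;> simp [h]
      · by_cases hp' : p = s.1.2
        · right; right
          funext ω
          simp only [Y, hp']
          by_cases h : s.2 ω <;> simp [h]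
        · left
          have : Y p = X p := by
            funext ω
            simp only [Y]
            by_cases h : s.2 ω <;> simp [h, Equiv.swap_apply_of_ne_of_ne hp hp']
          rw [this]
          exact hX p
    have h4 := hY.trans' (ih Y (S := S ∪ (S ∪ Set.range Y))
      (fun c hc' => Or.inl (hc (Or.inr hc'))) (fun p => Or.inr (Or.inr ⟨p, rfl⟩)))
    refine h4.mono_cost (by rw [List.length_cons]; ring_nf; omega) |>.mono_right ?_
    rintro _ ⟨p, rfl⟩
    exact ⟨p, rfl⟩

end SwapNet

/-! ### Routing problems -/

/-- The positions of `n` elements, and infinitely many dummy positions. -/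
abbrev Slot (n : ℕ) : Type := Fin n ⊕ ℕ

/-- An array of bits, extended by zeros to the dummy positions. -/
def extendBits {n : ℕ} (x : Fin n → Bool) : Slot n → Bool := Sum.elim x fun _ => false

/-- The input wires carrying an array of `n` bits, and the constant wires. -/
def bitWires (n : ℕ) : Set ((Fin n → Bool) → Bool) :=
  constWires _ ∪ Set.range fun i x => x i

/-- The input wires carrying two arrays of `n` bits, and the constant wires. -/
def pairWires (n : ℕ) : Set ((Fin n → Bool) × (Fin n → Bool) → Bool) :=
  constWires _ ∪ ((Set.range fun i ω => ω.1 i) ∪ Set.range fun i ω => ω.2 i)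

/-- Tight compaction of `n` elements by a network of at most `b` swaps whose controls are computed
from the keys with at most `a` gates. -/
def HasCompaction (n a b : ℕ) : Prop :=
  ∃ N : SwapNet (Slot n) (Fin n → Bool), List.length N ≤ b ∧
    Computes (bitWires n) a N.controls ∧
    ∀ x, ∃ σ : Equiv.Perm (Fin n), N.perm x = Equiv.sumCongr σ (Equiv.refl ℕ) ∧
      Monotone (x ∘ σ)

/-- Rearranging `n` elements such that their keys form a prescribed pattern with the right number
of ones. Elements whose keys already agree with the pattern stay in place. -/
def HasMatching (n a b : ℕ) : Prop :=
  ∃ N : SwapNet (Slot n) ((Fin n → Bool) × (Fin n → Bool)), List.length N ≤ b ∧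
    Computes (pairWires n) a N.controls ∧
    ∀ x t : Fin n → Bool,
      (Finset.univ.filter fun i => x i = true).card =
        (Finset.univ.filter fun i => t i = true).card →
      ∃ σ : Equiv.Perm (Fin n), N.perm (x, t) = Equiv.sumCongr σ (Equiv.refl ℕ) ∧
        (∀ i, x (σ i) = t i) ∧ ∀ i, x i = t i → σ i = i

/-- Loose compaction: moving at most `M` marked elements to `n'` fixed positions. -/
def HasLooseCompaction (n M n' a b : ℕ) : Prop :=
  ∃ N : SwapNet (Slot n) (Fin n → Bool), List.length N ≤ b ∧
    Computes (bitWires n) a N.controls ∧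
    ∃ g : Slot n' → Slot n, Function.Injective g ∧
    ∀ m : Fin n → Bool, (Finset.univ.filter fun i => m i = true).card ≤ M →
      ∀ p, (∀ i, p ≠ g (Sum.inl i)) → extendBits m (N.perm m p) = false

/-! ### Matching misplaced elements -/

section SwapPass

variable {ι Ω : Type} [DecidableEq ι]

/-- The control of a swap that repairs two misplaced elements with different keys. -/
def repairControl (T X : ι → Ω → Bool) (e : ι × ι) (ω : Ω) : Bool :=
  (X e.1 ω ^^ X e.2 ω) && ((X e.1 ω ^^ T e.1 ω) && (X e.2 ω ^^ T e.2 ω))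

/-- One pass over a list of pairs that swaps two misplaced elements whenever this puts both of them
in a right place; `X` are the keys and `T` is the desired pattern. -/
def swapPass (T : ι → Ω → Bool) : List (ι × ι) → (ι → Ω → Bool) → SwapNet ι Ω
  | [], _ => []
  | e :: E, X => (e, repairControl T X e) :: swapPass T E fun i ω =>
      X ((if repairControl T X e ω then Equiv.swap e.1 e.2 else 1) i) ω

theorem length_swapPass (T : ι → Ω → Bool) (E : List (ι × ι)) (X : ι → Ω → Bool) :
    List.length (swapPass T E X) = E.length := by
  induction E generalizing X with
  | nil => rfl
  | cons e E ih => simp [swapPass, ih]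

/-- A swap is made only when it puts two wrong elements right, and right positions are never touched
again. So a position wrong at the end never moved; if both ends of an inspected pair stay wrong,
they held their original keys at the inspection, and only equal keys prevented the swap. -/
theorem swapPass_spec (T : ι → Ω → Bool) (E : List (ι × ι)) (X : ι → Ω → Bool) (ω : Ω) :
    (∀ i, X i ω = T i ω → (swapPass T E X).perm ω i = i) ∧
    (∀ i, X ((swapPass T E X).perm ω i) ω ≠ T i ω → (swapPass T E X).perm ω i = i) ∧
    ∀ e ∈ E, X ((swapPass T E X).perm ω e.1) ω ≠ T e.1 ω →
      X ((swapPass T E X).perm ω e.2) ω ≠ T e.2 ω → X e.1 ω = X e.2 ω := by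
  induction E generalizing X with
  | nil => simp [swapPass]
  | cons e E ih =>
    set c := repairControl T X e ω with hc
    set s : Equiv.Perm ι := if c then Equiv.swap e.1 e.2 else 1 with hs
    set Y : ι → Ω → Bool := fun i ω =>
      X ((if repairControl T X e ω then Equiv.swap e.1 e.2 else 1) i) ω with hY
    obtain ⟨ha, hb, hd⟩ := ih Y
    have hσ : ∀ i, (swapPass T (e :: E) X).perm ω i = s ((swapPass T E Y).perm ω i) :=
      fun i => rfl
    have hYX : ∀ i, Y i ω = X (s i) ω := fun i => rfl
    have hcases : (c = false ∧ s = 1) ∨ (s = Equiv.swap e.1 e.2 ∧ X e.1 ω ≠ X e.2 ω ∧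
        X e.1 ω ≠ T e.1 ω ∧ X e.2 ω ≠ T e.2 ω) := by
      cases h : c with
      | false => left; simp [hs, h]
      | true =>
        right
        rw [hc] at h
        refine ⟨by rw [hs, hc, if_pos h], ?_⟩
        revert h
        simp only [repairControl]
        cases X e.1 ω <;> cases X e.2 ω <;> cases T e.1 ω <;> cases T e.2 ω <;> simp
    have hfix : ∀ i, X i ω = T i ω → s i = i := by
      intro i hi
      rcases hcases with ⟨-, h⟩ | ⟨h, h1, h2, h3⟩
      · rw [h]; rfl
      · rw [h]
        refine Equiv.swap_apply_of_ne_of_ne ?_ ?_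
        · rintro rfl; exact h2 hi
        · rintro rfl; exact h3 hi
    have hfix' : ∀ i, X (s i) ω ≠ T i ω → s i = i := by
      intro i hi
      rcases hcases with ⟨-, h⟩ | ⟨h, h1, h2, h3⟩
      · rw [h]; rfl
      · rw [h]
        refine Equiv.swap_apply_of_ne_of_ne ?_ ?_
        · rintro rfl
          rw [h, Equiv.swap_apply_left] at hi
          revert h1 h2 hi
          cases X e.1 ω <;> cases X e.2 ω <;> cases T e.1 ω <;> simp
        · rintro rfl
          rw [h, Equiv.swap_apply_right] at hi
          revert h1 h3 hi
          cases X e.1 ω <;> cases X e.2 ω <;> cases T e.2 ω <;> simp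
    have hb' : ∀ i, X (s ((swapPass T E Y).perm ω i)) ω ≠ T i ω →
        (swapPass T E Y).perm ω i = i ∧ s i = i := by
      intro i hi
      have h1 := hb i (by rwa [hYX])
      rw [h1] at hi
      exact ⟨h1, hfix' i hi⟩
    refine ⟨fun i hi => ?_, fun i hi => ?_, fun e' he' h1 h2 => ?_⟩
    · rw [hσ, ha i (by rw [hYX, hfix i hi, hi]), hfix i hi]
    · rw [hσ] at hi ⊢
      obtain ⟨h1, h2⟩ := hb' i hi
      rw [h1, h2]
    · rw [hσ] at h1 h2
      obtain ⟨h3, h4⟩ := hb' _ h1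
      obtain ⟨h5, h6⟩ := hb' _ h2
      rcases List.mem_cons.1 he' with rfl | he'
      · rw [h3, h4] at h1
        rw [h5, h6] at h2
        rcases hcases with ⟨h, -⟩ | ⟨h, h7, -⟩
        · by_contra hne
          rw [hc] at h
          revert h h1 h2 hne
          simp only [repairControl]
          cases X e'.1 ω <;> cases X e'.2 ω <;> cases T e'.1 ω <;> cases T e'.2 ω <;> simp
        · rw [h, Equiv.swap_apply_left] at h4
          rw [h4] at h7
          exact absurd rfl h7
      · have := hd e' he' (by rwa [hYX]) (by rwa [hYX])
        rwa [hYX, hYX, h4, h6] at this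

theorem computes_swapPass (T : ι → Ω → Bool) (E : List (ι × ι)) (X : ι → Ω → Bool)
    {S : Set (Ω → Bool)} (hT : ∀ i, T i ∈ S) (hX : ∀ i, X i ∈ S) :
    Computes S (22 * E.length) ((swapPass T E X).controls ∪
      Set.range fun i ω => X ((swapPass T E X).perm ω i) ω) := by
  induction E generalizing X S with
  | nil =>
    refine Computes.of_subset ?_
    rintro _ (⟨s, hs, -⟩ | ⟨i, rfl⟩)
    · simp [swapPass] at hs
    · exact hX i
  | cons e E ih =>
    set Y : ι → Ω → Bool := fun i ω =>
      X ((if repairControl T X e ω then Equiv.swap e.1 e.2 else 1) i) ω with hY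
    have m : ∀ i, Computes S 0 {X i} := fun i => .of_mem (hX i)
    have m' : ∀ i, Computes S 0 {T i} := fun i => .of_mem (hT i)
    -- Fourteen gates for the control and eight for updating the keys, which later controls read: 22
    -- per pair.
    have h1 : Computes S 14 {repairControl T X e} :=
      ((m e.1).xor (m e.2)).and (((m e.1).xor (m' e.1)).and ((m e.2).xor (m' e.2)))
    have h2 := SwapNet.computes_apply [(e, repairControl T X e)] X
      (S := S ∪ {repairControl T X e}) (by
        rw [SwapNet.controls_cons]
        rintro c (hc | ⟨s, hs, -⟩)
        · exact Or.inr hc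
        · simp at hs) (fun i => Or.inl (hX i))
    have h3 := h1.trans h2
    have h4 := ih Y (S := S ∪ ({repairControl T X e} ∪ Set.range fun p ω =>
      X (SwapNet.perm [(e, repairControl T X e)] ω p) ω)) (fun i => Or.inl (hT i)) (by
        intro i
        exact Or.inr (Or.inr ⟨i, rfl⟩))
    refine (h3.trans h4).mono_cost ?_ |>.mono_right ?_
    · simp only [List.length_cons, List.length_nil]; omega
    · rintro f (hf | ⟨i, rfl⟩)
      · rw [swapPass, SwapNet.controls_cons] at hf
        rcases hf with hf | hf
        · exact Or.inl (Or.inl hf)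
        · exact Or.inr (Or.inl hf)
      · exact Or.inr (Or.inr ⟨i, rfl⟩)

end SwapPass

/-! ### Reducing matching to loose compaction -/

theorem card_filter_true_eq_iff {n : ℕ} (x t : Fin n → Bool) :
    ((Finset.univ.filter fun i => x i = true).card =
        (Finset.univ.filter fun i => t i = true).card) ↔
      (Finset.univ.filter fun i => x i = true ∧ t i = false).card =
        (Finset.univ.filter fun i => x i = false ∧ t i = true).card := by
  have h1 : (Finset.univ.filter fun i => x i = true).card =
      (Finset.univ.filter fun i => x i = true ∧ t i = true).card +
      (Finset.univ.filter fun i => x i = true ∧ t i = false).card := by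
    rw [← Finset.card_union_of_disjoint]
    · congr 1; ext i; cases x i <;> cases h : t i <;> simp [h]
    · rw [Finset.disjoint_left]; intro i; cases x i <;> cases h : t i <;> simp [h]
  have h2 : (Finset.univ.filter fun i => t i = true).card =
      (Finset.univ.filter fun i => x i = true ∧ t i = true).card +
      (Finset.univ.filter fun i => x i = false ∧ t i = true).card := by
    rw [← Finset.card_union_of_disjoint]
    · congr 1; ext i; cases h : x i <;> cases t i <;> simp [h]
    · rw [Finset.disjoint_left]; intro i; cases h : x i <;> cases t i <;> simp [h]
  omega

theorem Equiv.Perm.eq_sumCongr_refl {α β : Type*} (π : Equiv.Perm (α ⊕ β))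
    (h : ∀ b, π (Sum.inr b) = Sum.inr b) :
    ∃ σ : Equiv.Perm α, π = Equiv.sumCongr σ (Equiv.refl β) := by
  have key : ∀ ρ : Equiv.Perm (α ⊕ β), (∀ b, ρ (Sum.inr b) = Sum.inr b) →
      ∀ a, ∃ a', ρ (Sum.inl a) = Sum.inl a' := by
    intro ρ hρ a
    rcases hx : ρ (Sum.inl a) with a' | b
    · exact ⟨a', rfl⟩
    · have := ρ.injective (hx.trans (hρ b).symm)
      cases this
  have h' : ∀ b, π.symm (Sum.inr b) = Sum.inr b := fun b => by
    rw [Equiv.symm_apply_eq, h]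
  choose f hf using key π h
  choose g hg using key π.symm h'
  refine ⟨⟨f, g, fun a => ?_, fun a => ?_⟩, ?_⟩
  · have := hg (f a)
    rw [← hf, Equiv.symm_apply_apply] at this
    exact (Sum.inl.inj this).symm
  · have := hf (g a)
    rw [← hg, Equiv.apply_symm_apply] at this
    exact (Sum.inl.inj this).symm
  · ext p
    rcases p with a | b
    · exact hf a
    · exact h b

/-- Every two sets with equally many, but more than `μ`, elements are joined by a pair in `E`. -/
def IsMixing {n : ℕ} (E : List (Fin n × Fin n)) (μ : ℕ) : Prop :=
  ∀ R B : Finset (Fin n), R.card = B.card → μ < R.card → ∃ e ∈ E, e.1 ∈ R ∧ e.2 ∈ B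

/-- Misplaced ones and misplaced zeros are equally many. If there were more than `μ` of each, mixing
would provide a pair joining the two kinds, which the pass would have repaired. -/
theorem card_misplaced_le {n μ : ℕ} {E : List (Fin n × Fin n)} (hE : IsMixing E μ)
    (y t : Fin n → Bool)
    (hcard : (Finset.univ.filter fun i => y i = true).card =
        (Finset.univ.filter fun i => t i = true).card)
    (hpass : ∀ e ∈ E, y e.1 ≠ t e.1 → y e.2 ≠ t e.2 → y e.1 = y e.2) :
    (Finset.univ.filter fun i => (y i ^^ t i) = true).card ≤ 2 * μ := by
  rw [card_filter_true_eq_iff] at hcard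
  have h1 : (Finset.univ.filter fun i => y i = true ∧ t i = false).card ≤ μ := by
    by_contra hlt
    obtain ⟨e, he, h1, h2⟩ := hE _ _ hcard (not_le.1 hlt)
    simp only [Finset.mem_filter, Finset.mem_univ, true_and] at h1 h2
    have := hpass e he (by simp [h1]) (by simp [h2])
    simp [h1, h2] at this
  have h2 : (Finset.univ.filter fun i => (y i ^^ t i) = true) ⊆
      (Finset.univ.filter fun i => y i = true ∧ t i = false) ∪
      (Finset.univ.filter fun i => y i = false ∧ t i = true) := by
    intro i
    simp only [Finset.mem_filter, Finset.mem_univ, true_and, Finset.mem_union]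
    cases y i <;> cases t i <;> simp
  have h3 := (Finset.card_le_card h2).trans (Finset.card_union_le _ _)
  omega

theorem card_filter_comp_perm {n : ℕ} (x : Fin n → Bool) (σ : Equiv.Perm (Fin n)) :
    (Finset.univ.filter fun i => x (σ i) = true).card =
      (Finset.univ.filter fun i => x i = true).card := by
  refine Finset.card_bij (fun i _ => σ i) (by simp) (fun a _ b _ h => σ.injective h) ?_
  intro b hb
  exact ⟨σ.symm b, by simpa using hb, by simp⟩

/-- Run the pass, move the at most `2 * μ` misplaced elements into `n'` positions, match there, and
undo the move. Matching keeps correct elements in place, so undoing returns everything else to where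
it was. The term `16 * b₁` pays for sending both keys and target bits through the loose compaction,
the input of the recursion. -/
theorem HasMatching.of_looseCompaction {n n' μ a₁ b₁ a₂ b₂ : ℕ} (E : List (Fin n × Fin n))
    (hE : IsMixing E μ) (h₁ : HasLooseCompaction n (2 * μ) n' a₁ b₁)
    (h₂ : HasMatching n' a₂ b₂) :
    HasMatching n (22 * E.length + 4 * n + a₁ + 16 * b₁ + a₂) (E.length + 2 * b₁ + b₂) := by
  obtain ⟨N₁, hb₁, ha₁, g, hg, hN₁⟩ := h₁
  obtain ⟨N₂, hb₂, ha₂, hN₂⟩ := h₂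
  let Ω := (Fin n → Bool) × (Fin n → Bool)
  let X : Fin n → Ω → Bool := fun i ω => ω.1 i
  let T : Fin n → Ω → Bool := fun i ω => ω.2 i
  let P := swapPass T E X
  let y : Fin n → Ω → Bool := fun i ω => X (P.perm ω i) ω
  let φ : Ω → Fin n → Bool := fun ω i => y i ω ^^ T i ω
  let K : Slot n → Ω → Bool := fun p ω => extendBits (fun i => y i ω) p
  let U : Slot n → Ω → Bool := fun p ω => extendBits ω.2 p
  let N₁' : SwapNet (Slot n) Ω := N₁.map id φ
  let ψ : Ω → (Fin n' → Bool) × (Fin n' → Bool) := fun ω =>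
    (fun i => K (N₁'.perm ω (g (Sum.inl i))) ω, fun i => U (N₁'.perm ω (g (Sum.inl i))) ω)
  have hN₁' : ∀ ω, N₁'.perm ω = N₁.perm (φ ω) := by
    intro ω
    ext p
    exact SwapNet.perm_map_apply Function.injective_id φ N₁ ω p
  refine ⟨P.map Sum.inl id ++ (N₁' ++ (N₂.map g ψ ++ N₁'.reverse)), ?_, ?_, ?_⟩
  · have e1 : List.length (P.map Sum.inl id : SwapNet (Slot n) Ω) = E.length := by
      rw [SwapNet.length_map, length_swapPass]
    have e2 : List.length N₁' = List.length N₁ := SwapNet.length_map _ _ _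
    have e3 : List.length (N₂.map g ψ) = List.length N₂ := SwapNet.length_map _ _ _
    rw [List.length_append, List.length_append, List.length_append, List.length_reverse, e1, e2, e3]
    omega
  · have hX : ∀ i, X i ∈ pairWires n := fun i => Or.inr (Or.inl ⟨i, rfl⟩)
    have hT : ∀ i, T i ∈ pairWires n := fun i => Or.inr (Or.inr ⟨i, rfl⟩)
    have hF : (fun _ => false) ∈ pairWires n := Or.inl false_mem_constWires
    have c1 := computes_swapPass T E X hT hX
    have c2 : Computes (pairWires n ∪ (P.controls ∪ Set.range y)) (n * 4)
        (Set.range fun i ω => φ ω i) := by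
      have := Computes.range (S := pairWires n ∪ (P.controls ∪ Set.range y)) (k := 4)
        (F := fun (i : Fin n) ω => φ ω i) (fun i =>
          (Computes.of_mem (f := y i) (Or.inr (Or.inr ⟨i, rfl⟩))).xor
            (Computes.of_mem (f := T i) (Or.inl (hT i))))
      simpa using this
    have c12 := c1.trans c2
    set S₂ := pairWires n ∪ ((P.controls ∪ Set.range y) ∪ Set.range fun i ω => φ ω i) with hS₂
    have c3 : Computes S₂ a₁ N₁'.controls := by
      rw [SwapNet.controls_map]
      refine (ha₁.comp φ).mono_left ?_
      rintro _ ⟨f, hf | ⟨i, rfl⟩, rfl⟩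
      · exact Or.inl (Or.inl (constWires_comp φ hf))
      · exact Or.inr (Or.inr ⟨i, rfl⟩)
    have hK : ∀ p, K p ∈ S₂ := by
      rintro (i | d)
      · exact Or.inr (Or.inl (Or.inr ⟨i, rfl⟩))
      · exact Or.inl hF
    have hU : ∀ p, U p ∈ S₂ := by
      rintro (i | d)
      · exact Or.inl (hT i)
      · exact Or.inl hF
    have c4 := N₁'.computes_apply K (S := S₂ ∪ N₁'.controls) Set.subset_union_right
      (fun p => Or.inl (hK p))
    have c5 := N₁'.computes_apply U (S := S₂ ∪ N₁'.controls) Set.subset_union_right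
      (fun p => Or.inl (hU p))
    have c35 := c3.trans (c4.union c5)
    have c15 := c12.trans (c35.mono_left (by rw [hS₂]))
    refine (c15.trans (l := a₂) (U := (N₂.map g ψ).controls) ?_).mono_cost ?_ |>.mono_right ?_
    · have hc₂ : (N₂.map g ψ).controls = _ := SwapNet.controls_map g ψ N₂
      rw [hc₂]
      refine (ha₂.comp ψ).mono_left ?_
      rintro _ ⟨f, hf | (⟨i, rfl⟩ | ⟨i, rfl⟩), rfl⟩
      · exact Or.inl (Or.inl (constWires_comp ψ hf))
      · exact Or.inr (Or.inr (Or.inr (Or.inl ⟨g (Sum.inl i), rfl⟩)))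
      · exact Or.inr (Or.inr (Or.inr (Or.inr ⟨g (Sum.inl i), rfl⟩)))
    · have e2 : List.length N₁' = List.length N₁ := SwapNet.length_map _ _ _
      rw [e2]
      omega
    · rw [SwapNet.controls_append, SwapNet.controls_append, SwapNet.controls_append,
        SwapNet.controls_reverse]
      rintro f (hf | (hf | (hf | hf)))
      · rw [SwapNet.controls_map] at hf
        obtain ⟨f, hf, rfl⟩ := hf
        exact Or.inl (Or.inl (Or.inl (Or.inl hf)))
      · exact Or.inl (Or.inr (Or.inl hf))
      · exact Or.inr hf
      · exact Or.inl (Or.inr (Or.inl hf))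
  · intro x t hxt
    obtain ⟨hp1, hp2, hp3⟩ := swapPass_spec T E X (x, t)
    set ω : Ω := (x, t) with hω
    set σ := P.perm ω with hσ
    have hP : ∀ p, (P.map Sum.inl id : SwapNet (Slot n) Ω).perm ω p =
        Equiv.sumCongr σ (Equiv.refl ℕ) p := by
      rintro (i | d)
      · exact SwapNet.perm_map_apply Sum.inl_injective id P ω i
      · exact SwapNet.perm_map_of_notMem id P ω (by simp)
    have hycard : (Finset.univ.filter fun i => y i ω = true).card =
        (Finset.univ.filter fun i => t i = true).card := by
      rw [← hxt]
      exact card_filter_comp_perm x σ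
    have hmis : (Finset.univ.filter fun i => φ ω i = true).card ≤ 2 * μ := by
      refine card_misplaced_le hE (fun i => y i ω) t hycard fun e he h1 h2 => ?_
      have h3 := hp3 e he h1 h2
      have h4 := hp2 _ h1
      have h5 := hp2 _ h2
      show X (σ e.1) ω = X (σ e.2) ω
      rw [h4, h5]
      exact h3
    set π := N₁'.perm ω with hπ
    -- Outside the `n'` collecting positions nothing is misplaced; dummies carry key and target
    -- `false`.
    have hout : ∀ p, (∀ i, p ≠ g (Sum.inl i)) → K (π p) ω = U (π p) ω := by
      intro p hp
      have := hN₁ (φ ω) hmis p hp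
      rw [← hN₁', ← hπ] at this
      revert this
      rcases π p with i | d
      · show (y i ω ^^ t i) = false → y i ω = t i
        cases y i ω <;> cases t i <;> simp
      · exact fun _ => rfl
    have hcard' : (Finset.univ.filter fun i => (ψ ω).1 i = true).card =
        (Finset.univ.filter fun i => (ψ ω).2 i = true).card := by
      rw [card_filter_true_eq_iff] at hycard ⊢
      let j : Fin n' ↪ Slot n := ⟨fun i => π (g (Sum.inl i)), fun a b h =>
        Sum.inl_injective (hg (π.injective h))⟩
      -- All misplaced elements of either kind lie in the collecting positions, so both kinds are
      -- still equally many in the smaller instance, as its matching requires.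
      have key : ∀ b : Bool,
          (Finset.univ.filter fun i => (ψ ω).1 i = b ∧ (ψ ω).2 i = !b).map j =
          (Finset.univ.filter fun i => y i ω = b ∧ t i = !b).map Function.Embedding.inl := by
        intro b
        ext p
        simp only [Finset.mem_map, Finset.mem_filter, Finset.mem_univ, true_and]
        constructor
        · rintro ⟨i, hi, rfl⟩
          have hi' : K (j i) ω = b ∧ U (j i) ω = !b := hi
          rcases hj : j i with r | d <;> rw [hj] at hi'
          · exact ⟨r, hi', rfl⟩
          · have h1 : false = b := hi'.1
            have h2 : false = !b := hi'.2
            rw [← h1] at h2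
            cases h2
        · rintro ⟨r, hr, rfl⟩
          by_cases hex : ∃ i, π.symm (Sum.inl r) = g (Sum.inl i)
          · obtain ⟨i, hi⟩ := hex
            have hji : j i = Sum.inl r := by
              show π (g (Sum.inl i)) = _
              rw [← hi, Equiv.apply_symm_apply]
            refine ⟨i, ?_, hji⟩
            show K (j i) ω = b ∧ U (j i) ω = !b
            rw [hji]
            exact hr
          · push Not at hex
            have := hout _ hex
            rw [Equiv.apply_symm_apply] at this
            have h1 : y r ω = t r := this
            rw [hr.1, hr.2] at h1
            cases b <;> simp at h1
      have k1 := congrArg Finset.card (key true)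
      have k2 := congrArg Finset.card (key false)
      rw [Finset.card_map, Finset.card_map] at k1 k2
      simp only [Bool.not_true, Bool.not_false] at k1 k2
      rw [k1, k2, hycard]
    obtain ⟨τ, hτ, hτ1, hτ2⟩ := hN₂ (ψ ω).1 (ψ ω).2 hcard'
    set ρ := (N₂.map g ψ).perm ω with hρ
    have hρ1 : ∀ i, ρ (g (Sum.inl i)) = g (Sum.inl (τ i)) := by
      intro i
      rw [hρ, SwapNet.perm_map_apply hg]
      have : N₂.perm (ψ ω) = Equiv.sumCongr τ (Equiv.refl ℕ) := hτ
      rw [this]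
      rfl
    have hρ2 : ∀ p, (∀ i, p ≠ g (Sum.inl i)) → ρ p = p := by
      intro p hp
      by_cases hpr : p ∈ Set.range g
      · obtain ⟨i | d, rfl⟩ := hpr
        · exact absurd rfl (hp i)
        · rw [hρ, SwapNet.perm_map_apply hg]
          have : N₂.perm (ψ ω) = Equiv.sumCongr τ (Equiv.refl ℕ) := hτ
          rw [this]
          rfl
      · exact SwapNet.perm_map_of_notMem _ _ _ hpr
    have hmatch : ∀ p, K (π (ρ p)) ω = U (π p) ω := by
      intro p
      by_cases hex : ∃ i, p = g (Sum.inl i)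
      · obtain ⟨i, rfl⟩ := hex
        rw [hρ1]
        exact hτ1 i
      · push Not at hex
        rw [hρ2 p hex]
        exact hout p hex
    have hstay : ∀ p, K (π p) ω = U (π p) ω → ρ p = p := by
      intro p hp
      by_cases hex : ∃ i, p = g (Sum.inl i)
      · obtain ⟨i, rfl⟩ := hex
        rw [hρ1, hτ2 i hp]
      · push Not at hex
        exact hρ2 p hex
    set total := SwapNet.perm (P.map Sum.inl id ++ (N₁' ++ (N₂.map g ψ ++ N₁'.reverse))) ω
      with htotal
    have htot : ∀ p, total p =
        Equiv.sumCongr σ (Equiv.refl ℕ) (π (ρ (π.symm p))) := by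
      intro p
      rw [htotal, SwapNet.perm_append, SwapNet.perm_append, SwapNet.perm_append,
        SwapNet.perm_reverse, Equiv.Perm.mul_apply, Equiv.Perm.mul_apply, Equiv.Perm.mul_apply, hP]
      rfl
    have hKx : ∀ p, extendBits x (Equiv.sumCongr σ (Equiv.refl ℕ) p) = K p ω := by
      rintro (i | d) <;> rfl
    have hval : ∀ p, extendBits x (total p) = extendBits t p := by
      intro p
      rw [htot, hKx, hmatch, Equiv.apply_symm_apply]
    have hfix : ∀ p, extendBits x p = extendBits t p → total p = p := by
      intro p hp
      have h1 : Equiv.sumCongr σ (Equiv.refl ℕ) p = p := by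
        rcases p with i | d
        · exact congrArg Sum.inl (hp1 i hp)
        · rfl
      have h2 : K p ω = U p ω := by
        rw [← hKx, h1]
        exact hp
      rw [htot, hstay _ (by rwa [Equiv.apply_symm_apply]), Equiv.apply_symm_apply, h1]
    obtain ⟨θ, hθ⟩ := total.eq_sumCongr_refl fun d => hfix _ rfl
    refine ⟨θ, hθ, fun i => ?_, fun i hi => ?_⟩
    · have := hval (Sum.inl i)
      rw [hθ] at this
      exact this
    · have := hfix (Sum.inl i) hi
      rw [hθ] at this
      exact Sum.inl_injective this

/-! ### Counting with linearly many gates -/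

section Counting

variable {Ω : Type}

/-- The number of wires in a list that carry `true`. -/
def countWires (l : List (Ω → Bool)) (ω : Ω) : ℕ := l.countP fun f => f ω

theorem countWires_le (l : List (Ω → Bool)) (ω : Ω) : countWires l ω ≤ l.length :=
  List.countP_le_length

/-- A chain of full adders: it adds the bits of a list to `s`, and returns the last bit of the sum
and the carries. -/
def adderChain : (Ω → Bool) → List (Ω → Bool) → (Ω → Bool) × List (Ω → Bool)
  | s, [] => (s, [])
  | s, [x] => (fun ω => s ω ^^ x ω, [fun ω => s ω && x ω])
  | s, x :: y :: l =>
    ((adderChain (fun ω => s ω ^^ (x ω ^^ y ω)) l).1,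
      (fun ω => if x ω ^^ y ω then s ω else x ω) ::
        (adderChain (fun ω => s ω ^^ (x ω ^^ y ω)) l).2)

theorem countWires_cons (x : Ω → Bool) (l : List (Ω → Bool)) (ω : Ω) :
    countWires (x :: l) ω = (x ω).toNat + countWires l ω := by
  simp only [countWires, List.countP_cons]
  cases x ω <;> simp [add_comm]

/-- Each full adder preserves the sum: two bits and the running bit become a new running bit and a
carry of weight two. -/
theorem adderChain_count (s : Ω → Bool) (l : List (Ω → Bool)) (ω : Ω) :
    (s ω).toNat + countWires l ω =
      ((adderChain s l).1 ω).toNat + 2 * countWires (adderChain s l).2 ω := by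
  induction s, l using adderChain.induct with
  | case1 s => simp [adderChain, countWires]
  | case2 s x =>
    simp only [adderChain, countWires_cons]
    simp only [countWires, List.countP_nil]
    cases s ω <;> cases x ω <;> simp
  | case3 s x y l ih =>
    simp only [adderChain, countWires_cons]
    have ih : (s ω ^^ (x ω ^^ y ω)).toNat + countWires l ω = _ := ih
    revert ih
    generalize ((adderChain (fun ω => s ω ^^ (x ω ^^ y ω)) l).1 ω).toNat = u
    cases s ω <;> cases x ω <;> cases y ω <;> simp <;> omega

theorem adderChain_length (s : Ω → Bool) (l : List (Ω → Bool)) :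
    2 * (adderChain s l).2.length ≤ l.length + 1 := by
  induction s, l using adderChain.induct with
  | case1 s => simp [adderChain]
  | case2 s x => simp [adderChain]
  | case3 s x y l ih =>
    simp only [adderChain, List.length_cons]
    omega

theorem computes_adderChain (s : Ω → Bool) (l : List (Ω → Bool)) {S : Set (Ω → Bool)}
    (hs : s ∈ S) (hl : ∀ f ∈ l, f ∈ S) :
    Computes S (6 * l.length) ({(adderChain s l).1} ∪ {f | f ∈ (adderChain s l).2}) := by
  induction s, l using adderChain.induct generalizing S with
  | case1 s =>
    refine Computes.of_subset ?_
    rintro f (rfl | hf)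
    · exact hs
    · cases hf
  | case2 s x =>
    have h1 := Computes.of_mem hs
    have h2 := Computes.of_mem (hl x (by simp))
    refine ((h1.xor h2).union (h1.and h2)).mono_cost (by simp) |>.mono_right ?_
    rintro f (rfl | hf)
    · exact Or.inl rfl
    · exact Or.inr (List.mem_singleton.1 hf)
  | case3 s x y l ih =>
    have h1 := Computes.of_mem hs
    have h2 := Computes.of_mem (hl x (by simp))
    have h3 := Computes.of_mem (hl y (by simp))
    have h4 := h2.xor h3
    set S₁ := S ∪ {fun ω => x ω ^^ y ω} with hS₁
    have h5 : Computes S₁ 0 {fun ω => x ω ^^ y ω} := .of_mem (Or.inr rfl)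
    have h6 := (h1.mono_left (S' := S₁) Set.subset_union_left).xor h5
    have h7 := h5.ite (h1.mono_left (S' := S₁) Set.subset_union_left)
      (h2.mono_left (S' := S₁) Set.subset_union_left)
    have h8 := h4.trans (h6.union h7)
    have h9 := h8.trans (ih (Or.inr (Or.inr (Or.inl rfl)))
      (fun f hf => Or.inl (hl f (by simp [hf]))))
    refine h9.mono_cost (by simp only [List.length_cons]; omega) |>.mono_right ?_
    rintro f (hf | hf)
    · exact Or.inr (Or.inl hf)
    · rcases List.mem_cons.1 hf with hf | hf
      · exact Or.inl (Or.inr (Or.inr hf))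
      · exact Or.inr (Or.inr hf)

/-- The unary representation of the number of wires carrying `true`. -/
theorem computes_thresholds (l : List (Ω → Bool)) {S : Set (Ω → Bool)}
    (hc : constWires Ω ⊆ S) (hl : ∀ f ∈ l, f ∈ S) :
    Computes S (16 * l.length) (Set.range fun (i : ℕ) ω => decide (i < countWires l ω)) := by
  induction hn : l.length using Nat.strong_induction_on generalizing l S with
  | _ n ih =>
  subst hn
  rcases l with _ | ⟨s, r⟩
  · refine Computes.of_subset ?_
    rintro _ ⟨i, rfl⟩
    have : (fun ω : Ω => decide (i < countWires [] ω)) = fun _ => false := by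
      funext ω; simp [countWires]
    show (fun ω : Ω => decide (i < countWires [] ω)) ∈ S
    rw [this]
    exact hc false_mem_constWires
  -- The count is `u + 2 * c`, where `c` counts the carries. There are about half as many carries as
  -- bits, so recursing on them costs a geometric series.
  · have h1 := computes_adderChain s r (hl s (by simp)) (fun f hf => hl f (by simp [hf]))
    have hcount := adderChain_count s r
    have hlen := adderChain_length s r
    set u := (adderChain s r).1
    set cs := (adderChain s r).2
    have h2 := ih cs.length (by simp only [List.length_cons]; omega) cs
      (S := S ∪ ({u} ∪ {f | f ∈ cs})) (fun f hf => Or.inl (hc hf))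
      (fun f hf => Or.inr (Or.inr hf)) rfl
    have h3 := h1.trans h2
    set W := S ∪ (({u} ∪ {f | f ∈ cs}) ∪
      Set.range fun (i : ℕ) ω => decide (i < countWires cs ω)) with hW
    have hu : Computes W 0 {u} := .of_mem (Or.inr (Or.inl (Or.inl rfl)))
    have ht : ∀ i : ℕ, Computes W 0 {fun ω => decide (i < countWires cs ω)} :=
      fun i => .of_mem (Or.inr (Or.inr ⟨i, rfl⟩))
    -- Only even thresholds need gates: `2 * j + 1 < u + 2 * c` is equivalent to `j < c`, whatever
    -- `u` is.
    have h4 : ∀ j : Fin ((r.length + 2) / 2),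
        Computes W 2 {fun ω => decide (2 * j.val < countWires (s :: r) ω)} := by
      rintro ⟨j, hj⟩
      rcases j with _ | j
      · have := (ht 0).or hu
        have e : (fun ω => decide (2 * 0 < countWires (s :: r) ω)) =
            fun ω => decide (0 < countWires cs ω) || u ω := by
          funext ω
          have := hcount ω
          rw [countWires_cons, this]
          cases u ω <;> simp
        rw [e]
        exact this.mono_cost (by norm_num)
      · have := (ht (j + 1)).or (hu.and (ht j))
        have e : (fun ω => decide (2 * (j + 1) < countWires (s :: r) ω)) =
            fun ω => decide (j + 1 < countWires cs ω) || (u ω && decide (j < countWires cs ω)) := by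
          funext ω
          have := hcount ω
          rw [countWires_cons, this]
          cases u ω
          · simp
          · simp only [Bool.toNat_true, Bool.true_and, ← Bool.decide_or, decide_eq_decide]
            omega
        rw [e]
        exact this.mono_cost (by norm_num)
    have h5 := Computes.range h4
    rw [Fintype.card_fin] at h5
    have h6 := h3.trans h5
    have h7 := (Computes.of_subset (k := 0) (subset_refl S)).union h6
    refine h7.mono_cost ?_ |>.mono_right ?_
    · simp only [List.length_cons]; omega
    · rintro _ ⟨i, rfl⟩
      show (fun ω => decide (i < countWires (s :: r) ω)) ∈ _
      by_cases hi : r.length + 1 ≤ i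
      · left
        have e : (fun ω => decide (i < countWires (s :: r) ω)) = fun _ => false := by
          funext ω
          have := countWires_le (s :: r) ω
          simp only [List.length_cons] at this
          simp only [decide_eq_false_iff_not]
          omega
        rw [e]
        exact hc false_mem_constWires
      · right
        rcases Nat.even_or_odd' i with ⟨j, rfl | rfl⟩
        · right
          exact ⟨⟨j, by omega⟩, rfl⟩
        · left; right
          refine ⟨j, ?_⟩
          funext ω
          have := hcount ω
          rw [countWires_cons, this]
          simp only [decide_eq_decide]
          cases u ω <;> simp <;> omega

theorem countWires_map_finRange {n : ℕ} (X : Fin n → Ω → Bool) (ω : Ω) :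
    countWires ((List.finRange n).map X) ω = (Finset.univ.filter fun i => X i ω = true).card := by
  rw [countWires, List.countP_map]
  induction n with
  | zero => simp
  | succ n ih =>
    rw [List.finRange_succ, List.countP_cons, List.countP_map, Fin.card_filter_univ_succ]
    have := ih (fun i => X i.succ)
    simp only [Function.comp_def] at this ⊢
    rw [this]
    by_cases h : X 0 ω = true <;> simp [h]

theorem computes_card_thresholds {n : ℕ} (X : Fin n → Ω → Bool) {S : Set (Ω → Bool)}
    (hc : constWires Ω ⊆ S) (hX : ∀ i, X i ∈ S) :
    Computes S (16 * n) (Set.range fun (i : ℕ) ω =>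
      decide (i < (Finset.univ.filter fun j => X j ω = true).card)) := by
  have := computes_thresholds ((List.finRange n).map X) hc (by simpa using hX)
  simpa [countWires_map_finRange] using this

end Counting

/-- The target pattern is zero on the first `z` positions, with `z` the number of zero keys. Its
bits are negated thresholds of the unary count: `16 * n` gates plus two rounds of negations. -/
theorem HasMatching.hasCompaction {n a b : ℕ} (h : HasMatching n a b) :
    HasCompaction n (a + 18 * n) b := by
  obtain ⟨N, hb, ha, hN⟩ := h
  let z : (Fin n → Bool) → ℕ := fun x => (Finset.univ.filter fun i => (!(x i)) = true).card
  let t : (Fin n → Bool) → Fin n → Bool := fun x i => !(decide (i.val < z x))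
  have hz : ∀ x, z x ≤ n := fun x =>
    (Finset.card_le_univ (Finset.univ.filter fun i => (!(x i)) = true)).trans (by simp)
  refine ⟨N.map id fun x => (x, t x), by rw [SwapNet.length_map]; exact hb, ?_, fun x => ?_⟩
  · have h1 : Computes (bitWires n) (n * 1) (Set.range fun i (x : Fin n → Bool) => !(x i)) := by
      simpa using Computes.range (S := bitWires n) (k := 1)
        (F := fun (i : Fin n) (x : Fin n → Bool) => !(x i)) (fun i =>
          (Computes.of_mem (f := fun x : Fin n → Bool => x i) (Or.inr ⟨i, rfl⟩)).not)
    have h2 := computes_card_thresholds (fun i (x : Fin n → Bool) => !(x i))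
      (S := bitWires n ∪ Set.range fun i (x : Fin n → Bool) => !(x i))
      (fun f hf => Or.inl (Or.inl hf)) (fun i => Or.inr ⟨i, rfl⟩)
    have h3 := h1.trans' h2
    set W := bitWires n ∪ Set.range fun (i : ℕ) (x : Fin n → Bool) =>
      decide (i < (Finset.univ.filter fun j => (!(x j)) = true).card) with hW
    have h4 : Computes W (n * 1) (Set.range fun i (x : Fin n → Bool) => t x i) := by
      simpa using Computes.range (S := W) (k := 1)
        (F := fun (i : Fin n) (x : Fin n → Bool) => t x i) (fun i =>
          (Computes.of_mem (f := fun x : Fin n → Bool => decide (i.val < z x))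
            (Or.inr ⟨i.val, rfl⟩)).not)
    have h5 := h3.trans' h4
    refine (h5.trans' (l := a) (U := (N.map id fun x => (x, t x)).controls) ?_).mono_cost (by omega)
    rw [SwapNet.controls_map]
    refine (ha.comp _).mono_left ?_
    rintro _ ⟨f, hf | (⟨i, rfl⟩ | ⟨i, rfl⟩), rfl⟩
    · exact Or.inl (Or.inl (constWires_comp _ hf))
    · exact Or.inl (Or.inr ⟨i, rfl⟩)
    · exact Or.inr ⟨i, rfl⟩
  · have hcard : (Finset.univ.filter fun i => x i = true).card =
        (Finset.univ.filter fun i => t x i = true).card := by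
      have e1 : (Finset.univ.filter fun i => x i = true).card + z x = n := by
        have := Finset.card_filter_add_card_filter_not (s := (Finset.univ : Finset (Fin n)))
          (p := fun i => x i = true)
        simpa [z] using this
      have e2 : (Finset.univ.filter fun i => t x i = true).card + z x = n := by
        have h1 := Finset.card_filter_add_card_filter_not (s := (Finset.univ : Finset (Fin n)))
          (p := fun i => t x i = true)
        have h2 : (Finset.univ.filter fun i => ¬ t x i = true).card = z x := by
          have : (Finset.univ.filter fun i => ¬ t x i = true) =
              Finset.univ.filter fun i : Fin n => i.val < z x := by
            ext i; simp [t]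
          rw [this, Fin.card_filter_val_lt]
          have := hz x
          omega
        rw [h2] at h1
        simpa using h1
      omega
    obtain ⟨σ, hσ, hσ1, -⟩ := hN x (t x) hcard
    refine ⟨σ, ?_, ?_⟩
    · rw [← hσ]
      ext p
      exact SwapNet.perm_map_apply Function.injective_id _ N x p
    · intro i j hij
      simp only [Function.comp_apply, hσ1, t]
      have : i.val ≤ j.val := hij
      by_cases h : j.val < z x
      · simp [h, lt_of_le_of_lt this h]
      · simp [h]

/-! ### Loose compaction from tight compaction of chunks -/

namespace SwapNet

variable {ι κ Ω Ω' : Type}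

theorem length_flatMap_le {N : κ → SwapNet ι Ω} {b : ℕ} (l : List κ)
    (h : ∀ i, List.length (N i) ≤ b) : List.length (l.flatMap N) ≤ l.length * b := by
  induction l with
  | nil => simp
  | cons i l ih =>
    rw [List.flatMap_cons, List.length_append, List.length_cons]
    have := h i
    linarith [ih, Nat.succ_mul l.length b]

theorem controls_flatMap (N : κ → SwapNet ι Ω) (l : List κ) :
    controls (l.flatMap N) = ⋃ i ∈ l, (N i).controls := by
  ext c
  simp only [Set.mem_iUnion]
  constructor
  · rintro ⟨s, hs, rfl⟩
    obtain ⟨i, hi, hs⟩ := List.mem_flatMap.1 hs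
    exact ⟨i, hi, s, hs, rfl⟩
  · rintro ⟨i, hi, s, hs, rfl⟩
    exact ⟨s, List.mem_flatMap.2 ⟨i, hi, hs⟩, rfl⟩

/-- Networks acting on disjoint sets of positions do not interfere. -/
theorem perm_flatMap [DecidableEq ι] (N : κ → SwapNet ι Ω) (A : κ → Set ι) (ω : Ω)
    (hdisj : ∀ i j, i ≠ j → Disjoint (A i) (A j))
    (hfix : ∀ i, ∀ p ∉ A i, (N i).perm ω p = p) (l : List κ) (hl : l.Nodup) :
    (∀ i ∈ l, ∀ p ∈ A i, SwapNet.perm (l.flatMap N) ω p = (N i).perm ω p) ∧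
      ∀ p, (∀ i ∈ l, p ∉ A i) → SwapNet.perm (l.flatMap N) ω p = p := by
  have hmaps : ∀ i, ∀ p ∈ A i, (N i).perm ω p ∈ A i := by
    intro i p hp
    by_contra h
    have := ((N i).perm ω).injective (hfix i _ h)
    rw [this] at h
    exact h hp
  induction l with
  | nil => simp
  | cons i₀ l ih =>
    obtain ⟨ih1, ih2⟩ := ih hl.of_cons
    have hi₀ := (List.nodup_cons.1 hl).1
    have e : ∀ p, SwapNet.perm ((i₀ :: l).flatMap N) ω p =
        (N i₀).perm ω (SwapNet.perm (l.flatMap N) ω p) := by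
      intro p
      rw [List.flatMap_cons, perm_append, Equiv.Perm.mul_apply]
    refine ⟨fun i hi p hp => ?_, fun p hp => ?_⟩
    · rw [e]
      rcases List.mem_cons.1 hi with rfl | hi'
      · rw [ih2]
        intro j hj hpj
        exact Set.disjoint_left.1 (hdisj i j (by rintro rfl; exact hi₀ hj)) hp hpj
      · rw [ih1 i hi' p hp]
        refine hfix _ _ fun h => ?_
        exact Set.disjoint_left.1 (hdisj i i₀ (by rintro rfl; exact hi₀ hi')) (hmaps i p hp) h
    · rw [e, ih2 p fun i hi => hp i (List.mem_cons_of_mem _ hi)]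
      exact hfix _ _ (hp _ List.mem_cons_self)

end SwapNet

/-- Running compactions side by side on the disjoint parts `f i` of an array. -/
theorem SwapNet.perm_flatMap_parts {n B q : ℕ} {Ω : Type} (N : SwapNet (Slot B) (Fin B → Bool))
    (f : Fin q → Fin B → Fin n) (hf : Function.Injective fun p : Fin q × Fin B => f p.1 p.2)
    (φ : Fin q → Ω → Fin B → Bool) (ω : Ω) (σ : Fin q → Equiv.Perm (Fin B))
    (hσ : ∀ i, N.perm (φ i ω) = Equiv.sumCongr (σ i) (Equiv.refl ℕ)) :
    (∀ i j, SwapNet.perm ((List.finRange q).flatMap fun i => N.map (Sum.map (f i) id) (φ i)) ω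
      (Sum.inl (f i j)) = Sum.inl (f i (σ i j))) ∧
    ∀ p, (∀ i j, p ≠ Sum.inl (f i j)) →
      SwapNet.perm ((List.finRange q).flatMap fun i => N.map (Sum.map (f i) id) (φ i)) ω p = p := by
  have hinj : ∀ i, Function.Injective (Sum.map (f i) id : Slot B → Slot n) := by
    intro i
    refine Function.Injective.sumMap (fun a b h => ?_) Function.injective_id
    have := @hf (i, a) (i, b) h
    exact (Prod.mk.inj this).2
  have hone : ∀ i s, SwapNet.perm (N.map (Sum.map (f i) id) (φ i)) ω (Sum.map (f i) id s) =
      Sum.map (f i) id (Equiv.sumCongr (σ i) (Equiv.refl ℕ) s) := by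
    intro i s
    rw [SwapNet.perm_map_apply (hinj i), hσ]
  obtain ⟨h1, h2⟩ := SwapNet.perm_flatMap (fun i => N.map (Sum.map (f i) id) (φ i))
    (fun i => Set.range fun j => (Sum.inl (f i j) : Slot n)) ω (by
      intro i i' hii'
      rw [Set.disjoint_left]
      rintro _ ⟨j, rfl⟩ ⟨j', h⟩
      have := @hf (i', j') (i, j) (Sum.inl_injective h)
      exact hii' (Prod.mk.inj this).1.symm) (by
      intro i p hp
      by_cases hr : p ∈ Set.range (Sum.map (f i) id : Slot B → Slot n)
      · obtain ⟨j | d, rfl⟩ := hr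
        · exact absurd ⟨j, rfl⟩ hp
        · rw [hone]; rfl
      · exact SwapNet.perm_map_of_notMem _ _ _ hr) (List.finRange q) (List.nodup_finRange q)
  refine ⟨fun i j => ?_, fun p hp => h2 p ?_⟩
  · rw [h1 i (List.mem_finRange i) _ ⟨j, rfl⟩]
    exact hone i (Sum.inl j)
  · rintro i - ⟨j, rfl⟩
    exact hp i j rfl

/-- View `q * B` elements as a `q` by `B` matrix. Compact every row to bring marked elements
forward, then sort the rows, moving those with more than `θ` marks to the front. At most `E` rows
are that dense, since `E + 1` of them would hold more than `M` marks. So all marks end up in the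
first `E` rows, the first `θ` columns, or the leftover `n - q * B` positions. All columns share the
controls of the row sort, so `aq` is paid only once. -/
theorem HasCompaction.hasLooseCompaction {n M B q θ E aB bB aq bq : ℕ} (hB : HasCompaction B aB bB)
    (hq : HasCompaction q aq bq) (hn : q * B ≤ n) (hθ : θ < B) (hE : M < (E + 1) * (θ + 1)) :
    ∃ n' ≤ E * B + q * θ + (n - q * B),
      HasLooseCompaction n M n' (q * aB + aq + 8 * (q * bB) + 2 * n) (q * bB + B * bq) := by
  classical
  obtain ⟨NB, hbB, haB, hNB⟩ := hB
  obtain ⟨Nq, hbq, haq, hNq⟩ := hq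
  obtain ⟨f, hf⟩ : ∃ f : Fin q → Fin B → Fin n,
      Function.Injective fun p : Fin q × Fin B => f p.1 p.2 :=
    ⟨fun i j => Fin.castLE hn (finProdFinEquiv (i, j)), fun p p' h => by
      simpa [Prod.ext_iff] using h⟩
  choose σB hσB hσBm using hNB
  choose σq hσq hσqm using hNq
  -- Marks are negated because compaction puts key 0 first.
  let φ : Fin q → (Fin n → Bool) → Fin B → Bool := fun i m j => !(m (f i j))
  let N₁ : SwapNet (Slot n) (Fin n → Bool) :=
    (List.finRange q).flatMap fun i => NB.map (Sum.map (f i) id) (φ i)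
  -- In a compacted row, position `θ` is marked exactly if the row has more than `θ` marks; such
  -- dense rows get key 0.
  let κ : (Fin n → Bool) → Fin q → Bool := fun m i =>
    !(extendBits m (N₁.perm m (Sum.inl (f i ⟨θ, hθ⟩))))
  let N₂ : SwapNet (Slot n) (Fin n → Bool) :=
    (List.finRange B).flatMap fun j => Nq.map (Sum.map (fun i => f i j) id) κ
  let P : Finset (Fin n) :=
    Finset.univ.filter fun r => ∀ i j, r = f i j → j.val < θ ∨ i.val < E
  have hP : P.card ≤ E * B + q * θ + (n - q * B) := by
    let F : Fin q × Fin B → Fin n := fun p => f p.1 p.2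
    have hsub : P ⊆ (((Finset.univ.filter fun i : Fin q => i.val < E) ×ˢ
        (Finset.univ : Finset (Fin B))).image F ∪
        ((Finset.univ : Finset (Fin q)) ×ˢ
          (Finset.univ.filter fun j : Fin B => j.val < θ)).image F) ∪
        (Finset.univ \ Finset.univ.image F) := by
      intro r hr
      by_cases hex : ∃ p, F p = r
      · obtain ⟨⟨i, j⟩, rfl⟩ := hex
        rw [Finset.mem_union, Finset.mem_union]
        left
        rcases (Finset.mem_filter.1 hr).2 i j rfl with h | h
        · right
          exact Finset.mem_image.2 ⟨(i, j), by simp [h], rfl⟩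
        · left
          exact Finset.mem_image.2 ⟨(i, j), by simp [h], rfl⟩
      · rw [Finset.mem_union]
        right
        push Not at hex
        simpa using fun i j => hex (i, j)
    refine (Finset.card_le_card hsub).trans ((Finset.card_union_le _ _).trans ?_)
    refine add_le_add ((Finset.card_union_le _ _).trans (add_le_add ?_ ?_)) ?_
    · refine Finset.card_image_le.trans ?_
      rw [Finset.card_product, Fin.card_filter_val_lt, Finset.card_fin]
      exact Nat.mul_le_mul_right _ (min_le_right _ _)
    · refine Finset.card_image_le.trans ?_
      rw [Finset.card_product, Fin.card_filter_val_lt, Finset.card_fin]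
      exact Nat.mul_le_mul_left _ (min_le_right _ _)
    · rw [Finset.card_sdiff_of_subset (Finset.subset_univ _),
        Finset.card_image_of_injective _ hf]
      simp
  refine ⟨P.card, hP, N₁ ++ N₂, ?_, ?_, Sum.map (fun k => (P.equivFin.symm k).val) id, ?_, ?_⟩
  · rw [List.length_append]
    have h1 := SwapNet.length_flatMap_le (N := fun i => NB.map (Sum.map (f i) id) (φ i))
      (List.finRange q) (fun i => (SwapNet.length_map _ _ _).le.trans hbB)
    have h2 := SwapNet.length_flatMap_le (N := fun j => Nq.map (Sum.map (fun i => f i j) id) κ)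
      (List.finRange B) (fun i => (SwapNet.length_map _ _ _).le.trans hbq)
    rw [List.length_finRange] at h1 h2
    exact add_le_add h1 h2
  · have hlen : List.length N₁ ≤ q * bB := by
      have h1 := SwapNet.length_flatMap_le (N := fun i => NB.map (Sum.map (f i) id) (φ i))
        (List.finRange q) (fun i => (SwapNet.length_map _ _ _).le.trans hbB)
      rwa [List.length_finRange] at h1
    have c1 : Computes (bitWires n) (n * 1) (Set.range fun i (m : Fin n → Bool) => !(m i)) := by
      simpa using Computes.range (S := bitWires n) (k := 1)
        (F := fun (i : Fin n) (x : Fin n → Bool) => !(x i)) (fun i =>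
          (Computes.of_mem (f := fun x : Fin n → Bool => x i) (Or.inr ⟨i, rfl⟩)).not)
    set S₁ := bitWires n ∪ Set.range fun i (m : Fin n → Bool) => !(m i) with hS₁
    have c2 : Computes S₁ (q * aB) N₁.controls := by
      have : ∀ i, Computes S₁ aB (NB.map (Sum.map (f i) id) (φ i)).controls := by
        intro i
        rw [SwapNet.controls_map]
        refine (haB.comp _).mono_left ?_
        rintro _ ⟨g, hg | ⟨j, rfl⟩, rfl⟩
        · exact Or.inl (Or.inl (constWires_comp _ hg))
        · exact Or.inr ⟨f i j, rfl⟩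
      have := Computes.iUnion this
      rw [SwapNet.controls_flatMap]
      simpa using this
    have c3 := N₁.computes_apply (fun p m => extendBits m p) (S := S₁ ∪ N₁.controls)
      Set.subset_union_right (by
        rintro (i | d)
        · exact Or.inl (Or.inl (Or.inr ⟨i, rfl⟩))
        · exact Or.inl (Or.inl (Or.inl false_mem_constWires)))
    have c23 := c2.trans c3
    have c13 := c1.trans c23
    set S₂ := bitWires n ∪ ((Set.range fun i (m : Fin n → Bool) => !(m i)) ∪ (N₁.controls ∪
      Set.range fun p (m : Fin n → Bool) => extendBits m (N₁.perm m p))) with hS₂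
    have c4 : Computes S₂ (q * 1) (Set.range fun i m => κ m i) := by
      simpa using Computes.range (S := S₂) (k := 1) (F := fun i m => κ m i) (fun i =>
        (Computes.of_mem (f := fun m : Fin n → Bool =>
          extendBits m (N₁.perm m (Sum.inl (f i ⟨θ, hθ⟩))))
            (Or.inr (Or.inr (Or.inr ⟨_, rfl⟩)))).not)
    have c14 := c13.trans c4
    have c5 : Computes (bitWires n ∪ (((Set.range fun i (m : Fin n → Bool) => !(m i)) ∪
        (N₁.controls ∪ Set.range fun p (m : Fin n → Bool) => extendBits m (N₁.perm m p))) ∪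
        Set.range fun i m => κ m i)) aq ((· ∘ κ) '' Nq.controls) := by
      refine (haq.comp κ).mono_left ?_
      rintro _ ⟨g, hg | ⟨j, rfl⟩, rfl⟩
      · exact Or.inl (Or.inl (constWires_comp _ hg))
      · exact Or.inr (Or.inr ⟨j, rfl⟩)
    have hqn : q ≤ n := (Nat.le_mul_of_pos_right q (by omega)).trans hn
    refine (c14.trans c5).mono_cost ?_ |>.mono_right ?_
    · omega
    · rw [SwapNet.controls_append]
      rintro c (hc | hc)
      · exact Or.inl (Or.inl (Or.inr (Or.inl hc)))
      · right
        have e : N₂.controls = _ := SwapNet.controls_flatMap _ _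
        rw [e] at hc
        simp only [Set.mem_iUnion] at hc
        obtain ⟨j, -, hc⟩ := hc
        rwa [SwapNet.controls_map] at hc
  · exact Function.Injective.sumMap
      (fun a b h => P.equivFin.symm.injective (Subtype.ext h)) Function.injective_id
  · intro m hm p hp
    have hf' : Function.Injective fun p : Fin B × Fin q => f p.2 p.1 := fun a b h => by
      have := @hf (a.2, a.1) (b.2, b.1) h
      simp only [Prod.mk.injEq] at this
      exact Prod.ext this.2 this.1
    obtain ⟨r1, r2⟩ := SwapNet.perm_flatMap_parts NB f hf φ m (fun i => σB (φ i m))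
      (fun i => hσB _)
    obtain ⟨r3, r4⟩ := SwapNet.perm_flatMap_parts Nq (fun j i => f i j) hf' (fun _ => κ) m
      (fun _ => σq (κ m)) (fun _ => hσq _)
    rw [SwapNet.perm_append, Equiv.Perm.mul_apply]
    rcases p with r | d
    · have hr : r ∉ P := fun h => hp (P.equivFin ⟨r, h⟩) (by simp)
      simp only [P, Finset.mem_filter, Finset.mem_univ, true_and, not_forall, not_or,
        not_lt] at hr
      obtain ⟨i, j, rfl, hj, hi⟩ := hr
      set τ := σq (κ m) with hτ
      have hval : ∀ i j, N₁.perm m (Sum.inl (f i j)) = Sum.inl (f i (σB (φ i m) j)) := r1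
      have e2 : N₂.perm m (Sum.inl (f i j)) = Sum.inl (f (τ i) j) := r3 j i
      rw [e2, hval]
      by_contra hne
      have hne : m (f (τ i) (σB (φ (τ i) m) j)) = true := by
        simpa [extendBits] using hne
      have hmono : ∀ (i : Fin q) (j j' : Fin B), j ≤ j' →
          m (f i (σB (φ i m) j')) = true → m (f i (σB (φ i m) j)) = true := by
        intro i j j' hjj' h
        have := hσBm (φ i m) hjj'
        simp only [Function.comp_apply, φ] at this
        rw [h] at this
        revert this
        cases m (f i (σB (φ i m) j)) <;> simp
      have hκ : ∀ i, κ m i = !(m (f i (σB (φ i m) ⟨θ, hθ⟩))) := by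
        intro i
        simp only [κ]
        rw [hval]
        rfl
      have hκi : κ m (τ i) = false := by
        rw [hκ, hmono (τ i) ⟨θ, hθ⟩ j hj hne]
        rfl
      -- A mark at row `i ≥ E` and column `j ≥ θ` makes row `i` dense, hence all rows before it. The
      -- first `E + 1` rows then contain `(E + 1) * (θ + 1) > M` distinct marks.
      have hdense : ∀ k ≤ i, ∀ j : Fin B, j.val ≤ θ →
          m (f (τ k) (σB (φ (τ k) m) j)) = true := by
        intro k hk j hj
        have h1 := hσqm (κ m) hk
        simp only [Function.comp_apply] at h1
        rw [← hτ, hκi, hκ] at h1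
        refine hmono (τ k) j ⟨θ, hθ⟩ hj ?_
        revert h1
        cases m (f (τ k) (σB (φ (τ k) m) ⟨θ, hθ⟩)) <;> simp
      let k : Fin (E + 1) → Fin q := Fin.castLE (by have := i.isLt; omega)
      let l : Fin (θ + 1) → Fin B := Fin.castLE (by omega)
      let F : Fin (E + 1) × Fin (θ + 1) → Fin n := fun p =>
        f (τ (k p.1)) (σB (φ (τ (k p.1)) m) (l p.2))
      have hF : Function.Injective F := by
        rintro ⟨a, b⟩ ⟨a', b'⟩ h
        have h1 := Prod.mk.inj (@hf (τ (k a), σB (φ (τ (k a)) m) (l b))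
          (τ (k a'), σB (φ (τ (k a')) m) (l b')) h)
        have h2 : a = a' := Fin.castLE_injective _ (τ.injective h1.1)
        subst h2
        have h3 : b = b' := Fin.castLE_injective _ ((σB (φ (τ (k a)) m)).injective h1.2)
        rw [h3]
      have hsub : Finset.univ.image F ⊆ Finset.univ.filter fun i => m i = true := by
        intro r hr
        obtain ⟨⟨a, b⟩, -, rfl⟩ := Finset.mem_image.1 hr
        refine Finset.mem_filter.2 ⟨Finset.mem_univ _, ?_⟩
        refine hdense _ ?_ _ ?_
        · rw [Fin.le_def]
          have := a.isLt
          simp only [k, Fin.val_castLE]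
          omega
        · have := b.isLt
          simp only [l, Fin.val_castLE]
          omega
      have := Finset.card_le_card hsub
      rw [Finset.card_image_of_injective _ hF] at this
      simp only [Finset.card_univ, Fintype.card_prod, Fintype.card_fin] at this
      omega
    · have e2 : N₂.perm m (Sum.inr d) = Sum.inr d := r4 _ (by simp)
      have e1 : N₁.perm m (Sum.inr d) = Sum.inr d := r2 _ (by simp)
      rw [e2, e1]
      rfl

/-! ### Random graphs -/

/-- Union bound: `D * n` random pairs all miss a given product of two sets larger than `n / h` with
probability at most `(1 - 1/h^2)^(D * n)`, and there are at most `4^n` pairs of sets. Choose `D`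
with `(1 - 1/h^2)^D < 1/4`. -/
theorem exists_isMixing (h : ℕ) (hh : 1 ≤ h) :
    ∃ D : ℕ, ∀ n : ℕ, ∃ E : List (Fin n × Fin n), E.length ≤ D * n ∧ IsMixing E (n / h) := by
  classical
  set δ : ℝ := 1 - 1 / (h : ℝ) ^ 2 with hδ
  have hh' : (1 : ℝ) ≤ h := by exact_mod_cast hh
  have hδ0 : 0 ≤ δ := by
    rw [hδ, sub_nonneg, div_le_one (by positivity)]
    exact one_le_pow₀ hh'
  have hδ1 : δ < 1 := by
    rw [hδ]
    have : 0 < 1 / (h : ℝ) ^ 2 := by positivity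
    linarith
  obtain ⟨D, hD⟩ := exists_pow_lt_of_lt_one (show (0 : ℝ) < 1 / 4 by norm_num) hδ1
  refine ⟨D, fun n => ?_⟩
  rcases Nat.eq_zero_or_pos n with rfl | hn
  · refine ⟨[], by simp, fun R B _ hR => ?_⟩
    have := Finset.card_le_univ R
    simp at this
    simp [this] at hR
  let good : Finset (Finset (Fin n) × Finset (Fin n)) :=
    Finset.univ.filter fun p => n / h < p.1.card ∧ n / h < p.2.card
  let bad : Finset (Fin n) × Finset (Fin n) → Finset (Fin (D * n) → Fin n × Fin n) :=
    fun p => Fintype.piFinset fun _ => Finset.univ \ (p.1 ×ˢ p.2)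
  have hbad : ∀ p ∈ good, ((bad p).card : ℝ) ≤ (δ * (n : ℝ) ^ 2) ^ (D * n) := by
    intro p hp
    have hp' := (Finset.mem_filter.1 hp).2
    have h1 : n < p.1.card * h := (Nat.div_lt_iff_lt_mul (by omega)).1 hp'.1
    have h2 : n < p.2.card * h := (Nat.div_lt_iff_lt_mul (by omega)).1 hp'.2
    have h1' : (n : ℝ) / h ≤ p.1.card := by
      rw [div_le_iff₀ (by linarith)]; exact_mod_cast h1.le
    have h2' : (n : ℝ) / h ≤ p.2.card := by
      rw [div_le_iff₀ (by linarith)]; exact_mod_cast h2.le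
    rw [Fintype.card_piFinset, Finset.prod_const, Finset.card_univ, Fintype.card_fin, Nat.cast_pow]
    refine pow_le_pow_left₀ (Nat.cast_nonneg _) ?_ _
    rw [Finset.card_sdiff_of_subset (Finset.subset_univ _), Finset.card_product,
      Nat.cast_sub (by
        have := Finset.card_le_univ (p.1 ×ˢ p.2)
        rwa [Finset.card_product] at this)]
    simp only [Finset.card_univ, Fintype.card_prod, Fintype.card_fin, Nat.cast_mul]
    have h3 : ((n : ℝ) / h) * (n / h) ≤ p.1.card * p.2.card :=
      mul_le_mul h1' h2' (by positivity) (by positivity)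
    have h4 : δ * (n : ℝ) ^ 2 = n * n - (n / h) * (n / h) := by
      rw [hδ]; field_simp
    rw [h4]
    linarith
  have hlt : ((good.biUnion bad).card : ℝ) <
      (Finset.univ : Finset (Fin (D * n) → Fin n × Fin n)).card := by
    have h1 : ((good.biUnion bad).card : ℝ) ≤ ∑ p ∈ good, ((bad p).card : ℝ) := by
      exact_mod_cast Finset.card_biUnion_le
    have h2 : ∑ p ∈ good, ((bad p).card : ℝ) ≤ good.card * (δ * (n : ℝ) ^ 2) ^ (D * n) := by
      rw [← nsmul_eq_mul]
      exact Finset.sum_le_card_nsmul _ _ _ hbad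
    have h3 : (good.card : ℝ) ≤ 4 ^ n := by
      have : good.card ≤ 4 ^ n := by
        refine (Finset.card_le_univ _).trans ?_
        rw [Fintype.card_prod, Fintype.card_finset, Fintype.card_fin, ← mul_pow]
        exact le_rfl
      exact_mod_cast this
    have h4 : ((Finset.univ : Finset (Fin (D * n) → Fin n × Fin n)).card : ℝ) =
        ((n : ℝ) ^ 2) ^ (D * n) := by
      simp [sq]
    rw [h4]
    have h5 : (4 : ℝ) ^ n * (δ * (n : ℝ) ^ 2) ^ (D * n) =
        (4 * δ ^ D) ^ n * ((n : ℝ) ^ 2) ^ (D * n) := by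
      rw [mul_pow δ, mul_pow 4 (δ ^ D), ← pow_mul δ]
      ring
    have h6 : (4 * δ ^ D) ^ n < 1 := by
      refine pow_lt_one₀ (by positivity) (by linarith) (by omega)
    have h7 : (0 : ℝ) < ((n : ℝ) ^ 2) ^ (D * n) := by positivity
    calc ((good.biUnion bad).card : ℝ) ≤ good.card * (δ * (n : ℝ) ^ 2) ^ (D * n) := h1.trans h2
      _ ≤ 4 ^ n * (δ * (n : ℝ) ^ 2) ^ (D * n) := by
        exact mul_le_mul_of_nonneg_right h3 (by positivity)
      _ = (4 * δ ^ D) ^ n * ((n : ℝ) ^ 2) ^ (D * n) := h5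
      _ < 1 * ((n : ℝ) ^ 2) ^ (D * n) := mul_lt_mul_of_pos_right h6 h7
      _ = _ := one_mul _
  have hlt' : (good.biUnion bad).card <
      (Finset.univ : Finset (Fin (D * n) → Fin n × Fin n)).card := by exact_mod_cast hlt
  obtain ⟨f, -, hf⟩ := Finset.exists_mem_notMem_of_card_lt_card hlt'
  refine ⟨List.ofFn f, by simp, fun R B hRB hR => ?_⟩
  by_contra hcon
  push Not at hcon
  refine hf (Finset.mem_biUnion.2 ⟨(R, B), ?_, ?_⟩)
  · exact Finset.mem_filter.2 ⟨Finset.mem_univ _, hR, hRB ▸ hR⟩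
  · refine Fintype.mem_piFinset.2 fun k => ?_
    simp only [Finset.mem_sdiff, Finset.mem_univ, true_and, Finset.mem_product, not_and]
    exact hcon (f k) (by simp [List.mem_ofFn])

/-! ### Expanders by the union bound -/

/-- The bound `choose n s ≤ (e * n / s)^s`, with 3 for `e` and without division. -/
theorem choose_mul_self_pow_le (n s : ℕ) : (n.choose s : ℝ) * (s : ℝ) ^ s ≤ (3 * n : ℝ) ^ s := by
  have h1 : (n.choose s : ℝ) ≤ (n : ℝ) ^ s / (s.factorial : ℝ) := Nat.choose_le_pow_div s n
  have h2 : (s : ℝ) ^ s / (s.factorial : ℝ) ≤ Real.exp s :=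
    Real.pow_div_factorial_le_exp _ (Nat.cast_nonneg s) s
  have h3 : Real.exp s ≤ 3 ^ s := by
    rw [← Real.exp_one_pow]
    exact pow_le_pow_left₀ (Real.exp_pos _).le (by linarith [Real.exp_one_lt_d9]) _
  have hs : (0 : ℝ) < s.factorial := by exact_mod_cast s.factorial_pos
  calc (n.choose s : ℝ) * (s : ℝ) ^ s ≤ (n : ℝ) ^ s / s.factorial * (s : ℝ) ^ s := by gcongr
    _ = (s : ℝ) ^ s / s.factorial * (n : ℝ) ^ s := by ring
    _ ≤ 3 ^ s * (n : ℝ) ^ s := by gcongr; exact h2.trans h3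
    _ = _ := by rw [mul_pow]

/-- Bounds the expected number of sets of size `s` whose `8 * s` edges all end in some set of `6 *
s` vertices by `4^(-s)`. Multiplying by `s^s` clears the denominators. -/
theorem expander_term_le {n m s : ℕ} (hs : 1 ≤ s) (hm : n ≤ 3 * m) (hsn : 3000000 * s ≤ n) :
    (n.choose s : ℝ) * (m.choose (6 * s) : ℝ) * (6 * s : ℝ) ^ (8 * s) ≤
      (1 / 4) ^ s * (m : ℝ) ^ (8 * s) := by
  have hs0 : (0 : ℝ) < s := by exact_mod_cast hs
  have h1 := choose_mul_self_pow_le n s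
  have h2 := choose_mul_self_pow_le m (6 * s)
  push_cast at h2
  have hm0 : (0 : ℝ) < m := by
    have : 0 < m := by omega
    exact_mod_cast this
  have hmn : (n : ℝ) ≤ 3 * m := by exact_mod_cast hm
  have hsn' : 3000000 * (s : ℝ) ≤ n := by exact_mod_cast hsn
  have hpos : (0 : ℝ) < (s : ℝ) ^ s := by positivity
  rw [← mul_le_mul_iff_of_pos_right hpos]
  calc (n.choose s : ℝ) * (m.choose (6 * s) : ℝ) * (6 * s : ℝ) ^ (8 * s) * (s : ℝ) ^ s
      = ((n.choose s : ℝ) * (s : ℝ) ^ s) * ((m.choose (6 * s) : ℝ) * (6 * s : ℝ) ^ (6 * s)) *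
          (6 * s : ℝ) ^ (2 * s) := by
        rw [show 8 * s = 6 * s + 2 * s by ring, pow_add]; ring
    _ ≤ (3 * n : ℝ) ^ s * (3 * m : ℝ) ^ (6 * s) * (6 * s : ℝ) ^ (2 * s) := by
        gcongr
    _ = (3 * n * (3 * m) ^ 6 * (6 * s) ^ 2 : ℝ) ^ s := by
        rw [pow_mul (3 * m : ℝ) 6 s, pow_mul (6 * s : ℝ) 2 s, ← mul_pow, ← mul_pow]
    _ ≤ ((1 / 4) * (m : ℝ) ^ 8 * s) ^ s := by
        refine pow_le_pow_left₀ (by positivity) ?_ _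
        have h3 : 3 * (n : ℝ) * (3 * m) ^ 6 * (6 * s) ^ 2 = (78732 * n * s) * ((m : ℝ) ^ 6 * s) := by
          ring
        have h4 : (1 / 4) * (m : ℝ) ^ 8 * s = ((1 / 4) * m * m) * ((m : ℝ) ^ 6 * s) := by ring
        rw [h3, h4]
        refine mul_le_mul_of_nonneg_right ?_ (by positivity)
        -- Here `78732 * n * s ≤ 78732 * 9 / 3000000 * m^2 < m^2 / 4`, which is where the constant
        -- 3000000 is needed.
        nlinarith
    _ = _ := by
        rw [mul_pow, mul_pow, ← pow_mul]

/-- Bipartite graphs of left degree 8 in which all small sets of left vertices have many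
neighbours. -/
theorem exists_expander (n m : ℕ) (hm : n ≤ 3 * m) :
    ∃ Γ : Fin n × Fin 8 → Fin m, ∀ S : Finset (Fin n), S.Nonempty → 3000000 * S.card ≤ n →
      6 * S.card < ((S ×ˢ (Finset.univ : Finset (Fin 8))).image Γ).card := by
  classical
  rcases Nat.eq_zero_or_pos n with rfl | hn
  · exact ⟨fun p => p.1.elim0, fun S hS => by
      obtain ⟨x, -⟩ := hS
      exact x.elim0⟩
  have hm0 : 0 < m := by omega
  let fam : ℕ → Finset (Finset (Fin n) × Finset (Fin m)) := fun s =>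
    Finset.powersetCard s Finset.univ ×ˢ Finset.powersetCard (6 * s) Finset.univ
  -- The graphs in which all edges from the first set end in the second.
  let bad : Finset (Fin n) × Finset (Fin m) → Finset (Fin n × Fin 8 → Fin m) := fun p =>
    Fintype.piFinset fun q => if q.1 ∈ p.1 then p.2 else Finset.univ
  let I := Finset.Icc 1 (n / 3000000)
  have hbad : ∀ s, ∀ p ∈ fam s,
      ((bad p).card : ℝ) * (m : ℝ) ^ (8 * s) = (6 * s : ℝ) ^ (8 * s) * (m : ℝ) ^ (8 * n) := by
    intro s p hp
    obtain ⟨h1, h2⟩ := Finset.mem_product.1 hp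
    have h1 := (Finset.mem_powersetCard.1 h1).2
    have h2 := (Finset.mem_powersetCard.1 h2).2
    have hsn : s ≤ n := by
      have := Finset.card_le_univ p.1
      rw [h1] at this
      simpa using this
    have e1 : (Finset.univ.filter fun q : Fin n × Fin 8 => q.1 ∈ p.1) =
        p.1 ×ˢ (Finset.univ : Finset (Fin 8)) := by
      ext q; simp
    have e2 : (Finset.univ.filter fun q : Fin n × Fin 8 => q.1 ∉ p.1) =
        (p.1)ᶜ ×ˢ (Finset.univ : Finset (Fin 8)) := by
      ext q; simp
    have e3 : (bad p).card = (6 * s) ^ (8 * s) * m ^ (8 * (n - s)) := by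
      rw [Fintype.card_piFinset]
      have : ∀ q : Fin n × Fin 8, (if q.1 ∈ p.1 then p.2 else Finset.univ).card =
          if q.1 ∈ p.1 then 6 * s else m := by
        intro q
        split_ifs
        · exact h2
        · simp
      rw [Finset.prod_congr rfl fun q _ => this q, Finset.prod_ite, Finset.prod_const,
        Finset.prod_const, e1, e2, Finset.card_product, Finset.card_product, Finset.card_compl, h1]
      simp [mul_comm]
    rw [e3]
    push_cast
    rw [mul_assoc, ← pow_add]
    congr 2
    omega
  have hfam : ∀ s ∈ I, (((fam s).biUnion bad).card : ℝ) ≤ (1 / 4) ^ s * (m : ℝ) ^ (8 * n) := by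
    intro s hs
    obtain ⟨hs1, hs2⟩ := Finset.mem_Icc.1 hs
    have hsn : 3000000 * s ≤ n := by
      have := (Nat.le_div_iff_mul_le (by norm_num)).1 hs2
      omega
    have h1 : (((fam s).biUnion bad).card : ℝ) ≤ ∑ p ∈ fam s, ((bad p).card : ℝ) := by
      exact_mod_cast Finset.card_biUnion_le
    have hpos : (0 : ℝ) < (m : ℝ) ^ (8 * s) := by positivity
    rw [← mul_le_mul_iff_of_pos_right hpos]
    calc (((fam s).biUnion bad).card : ℝ) * (m : ℝ) ^ (8 * s)
        ≤ (∑ p ∈ fam s, ((bad p).card : ℝ)) * (m : ℝ) ^ (8 * s) := by gcongr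
      _ = ∑ p ∈ fam s, (6 * s : ℝ) ^ (8 * s) * (m : ℝ) ^ (8 * n) := by
          rw [Finset.sum_mul]
          exact Finset.sum_congr rfl (hbad s)
      _ = ((n.choose s : ℝ) * (m.choose (6 * s) : ℝ) * (6 * s : ℝ) ^ (8 * s)) *
            (m : ℝ) ^ (8 * n) := by
          rw [Finset.sum_const, Finset.card_product, Finset.card_powersetCard,
            Finset.card_powersetCard]
          simp
          ring
      _ ≤ ((1 / 4) ^ s * (m : ℝ) ^ (8 * s)) * (m : ℝ) ^ (8 * n) := by
          exact mul_le_mul_of_nonneg_right (expander_term_le hs1 hm hsn) (by positivity)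
      _ = _ := by ring
  have hgeom : ∀ k : ℕ, ∑ s ∈ Finset.Icc 1 k, (1 / 4 : ℝ) ^ s < 1 := by
    intro k
    have : ∀ k : ℕ, ∑ s ∈ Finset.Icc 1 k, (1 / 4 : ℝ) ^ s = (1 - (1 / 4) ^ k) / 3 := by
      intro k
      induction k with
      | zero => simp
      | succ k ih => rw [Finset.sum_Icc_succ_top (by omega), ih]; ring
    rw [this]
    have : (0 : ℝ) < (1 / 4) ^ k := by positivity
    linarith
  have hlt : ((I.biUnion fun s => (fam s).biUnion bad).card : ℝ) <
      (Finset.univ : Finset (Fin n × Fin 8 → Fin m)).card := by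
    have h1 : ((I.biUnion fun s => (fam s).biUnion bad).card : ℝ) ≤
        ∑ s ∈ I, (((fam s).biUnion bad).card : ℝ) := by
      exact_mod_cast Finset.card_biUnion_le
    have h2 : ((Finset.univ : Finset (Fin n × Fin 8 → Fin m)).card : ℝ) = (m : ℝ) ^ (8 * n) := by
      simp [mul_comm]
    have hpos : (0 : ℝ) < (m : ℝ) ^ (8 * n) := by positivity
    rw [h2]
    refine (h1.trans (Finset.sum_le_sum hfam)).trans_lt ?_
    rw [← Finset.sum_mul]
    have := mul_lt_mul_of_pos_right (hgeom (n / 3000000)) hpos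
    rwa [one_mul] at this
  have hlt' : (I.biUnion fun s => (fam s).biUnion bad).card <
      (Finset.univ : Finset (Fin n × Fin 8 → Fin m)).card := by exact_mod_cast hlt
  obtain ⟨Γ, -, hΓ⟩ := Finset.exists_mem_notMem_of_card_lt_card hlt'
  refine ⟨Γ, fun S hS hSn => ?_⟩
  by_contra hcon
  push Not at hcon
  -- A neighbourhood that is too small is enlarged to exactly `6 * S.card` vertices, the only size
  -- covered by the union bound.
  obtain ⟨T, hT1, hT2⟩ := Finset.exists_superset_card_eq hcon (by
    rw [Fintype.card_fin]; omega)
  refine hΓ (Finset.mem_biUnion.2 ⟨S.card, ?_, Finset.mem_biUnion.2 ⟨(S, T), ?_, ?_⟩⟩)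
  · refine Finset.mem_Icc.2 ⟨hS.card_pos, ?_⟩
    rw [Nat.le_div_iff_mul_le (by norm_num)]
    omega
  · simp [fam, hT2]
  · refine Fintype.mem_piFinset.2 fun q => ?_
    split_ifs with hq
    · exact hT1 (Finset.mem_image_of_mem _ (by simpa using hq))
    · exact Finset.mem_univ _

/-! ### Loose compaction along an expander -/

theorem countWires_map_toList {Ω κ : Type} (s : Finset κ) (F : κ → Ω → Bool) (ω : Ω) :
    countWires (s.toList.map F) ω = (s.filter fun e => F e ω = true).card := by
  rw [countWires, List.countP_map, List.countP_eq_length_filter, Finset.card_def,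
    Finset.filter_val, ← Finset.coe_toList s, Multiset.filter_coe, Multiset.coe_card]
  simp [Function.comp_def]

section ExpanderMatching

variable {n m : ℕ} (Γ : Fin n × Fin 8 → Fin m)

/-- The edges joining `v` to the left vertices in `s`. -/
def activeEdges (s : Fin n → Bool) (v : Fin m) : Finset (Fin n × Fin 8) :=
  (Finset.univ.filter fun e => Γ e = v).filter fun e => s e.1 = true

/-- The edge `e` is the only one joining its right end to `s`. -/
def acceptsEdge (s : Fin n → Bool) (e : Fin n × Fin 8) : Bool :=
  s e.1 && !(decide (1 < (activeEdges Γ s (Γ e)).card))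

/-- The edge `e` is the first accepted edge at its left end. -/
def selectsEdge (s : Fin n → Bool) (e : Fin n × Fin 8) : Bool :=
  acceptsEdge Γ s e && !(((List.finRange 8).filter (· < e.2)).any fun j => acceptsEdge Γ s (e.1, j))

/-- The left vertices without an accepted edge. -/
def unmatchedPart (s : Fin n → Bool) (u : Fin n) : Bool :=
  s u && !((List.finRange 8).any fun j => acceptsEdge Γ s (u, j))

/-- The edges selected in the first rounds. -/
def matchingEdges : ℕ → (Fin n → Bool) → Fin n × Fin 8 → Bool
  | 0, _, _ => false
  | t + 1, s, e => matchingEdges t s e || selectsEdge Γ ((unmatchedPart Γ)^[t] s) e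

theorem eq_of_acceptsEdge {s : Fin n → Bool} {e e' : Fin n × Fin 8}
    (h : acceptsEdge Γ s e = true) (h' : s e'.1 = true) (hΓ : Γ e' = Γ e) : e' = e := by
  simp only [acceptsEdge, Bool.and_eq_true, Bool.not_eq_true', decide_eq_false_iff_not,
    not_lt, Finset.card_le_one] at h
  exact h.2 _ (by simp [activeEdges, hΓ, h']) _ (by simp [activeEdges, h.1])

theorem unmatchedPart_eq_true {s : Fin n → Bool} {u : Fin n} :
    unmatchedPart Γ s u = true ↔ s u = true ∧ ∀ j, acceptsEdge Γ s (u, j) = false := by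
  simp [unmatchedPart]

theorem selectsEdge_eq_true {s : Fin n → Bool} {e : Fin n × Fin 8} :
    selectsEdge Γ s e = true ↔
      acceptsEdge Γ s e = true ∧ ∀ j < e.2, acceptsEdge Γ s (e.1, j) = false := by
  simp [selectsEdge]

/-- The fourth clause is the invariant behind the third: an accepting right vertex had only one
active edge, and the left end of that edge leaves once matched, so the right vertex sees no active
neighbour afterwards and cannot be chosen again. -/
theorem matchingEdges_spec (x : Fin n → Bool) (t : ℕ) :
    (∀ e, matchingEdges Γ t x e = true → (unmatchedPart Γ)^[t] x e.1 = false) ∧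
    (∀ e e', matchingEdges Γ t x e = true → matchingEdges Γ t x e' = true → e.1 = e'.1 →
      e = e') ∧
    (∀ e e', matchingEdges Γ t x e = true → matchingEdges Γ t x e' = true → Γ e = Γ e' →
      e = e') ∧
    (∀ e e', matchingEdges Γ t x e = true → (unmatchedPart Γ)^[t] x e'.1 = true → Γ e' ≠ Γ e) ∧
    ∀ u, x u = true → (unmatchedPart Γ)^[t] x u = true ∨ ∃ j, matchingEdges Γ t x (u, j) = true := by
  induction t with
  | zero => simp [matchingEdges]
  | succ t ih =>
    obtain ⟨ha, hb, hc, hd, he⟩ := ih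
    set s := (unmatchedPart Γ)^[t] x with hs
    have hsucc : (unmatchedPart Γ)^[t + 1] x = unmatchedPart Γ s :=
      Function.iterate_succ_apply' _ _ _
    have hm : ∀ e, matchingEdges Γ (t + 1) x e = true ↔
        matchingEdges Γ t x e = true ∨ selectsEdge Γ s e = true := by
      intro e; simp [matchingEdges, hs]
    have hact : ∀ e, selectsEdge Γ s e = true → s e.1 = true := by
      intro e h
      rw [selectsEdge_eq_true, acceptsEdge, Bool.and_eq_true] at h
      exact h.1.1
    rw [hsucc]
    refine ⟨?_, ?_, ?_, ?_, ?_⟩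
    · intro e h
      rw [Bool.eq_false_iff, Ne, unmatchedPart_eq_true]
      rintro ⟨h1, h2⟩
      rcases (hm e).1 h with h | h
      · rw [ha e h] at h1; cases h1
      · have := ((selectsEdge_eq_true Γ).1 h).1
        rw [h2 e.2] at this
        cases this
    · intro e e' h h' hee
      rcases (hm e).1 h with h | h <;> rcases (hm e').1 h' with h' | h'
      · exact hb e e' h h' hee
      · have h1 := ha e h
        rw [hee, hact e' h'] at h1; cases h1
      · have h1 := ha e' h'
        rw [← hee, hact e h] at h1; cases h1
      · rw [selectsEdge_eq_true] at h h'
        rcases lt_trichotomy e.2 e'.2 with h1 | h1 | h1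
        · have h2 := h'.2 e.2 h1
          rw [← hee, h.1] at h2; cases h2
        · exact Prod.ext hee h1
        · have h2 := h.2 e'.2 h1
          rw [hee, h'.1] at h2; cases h2
    · intro e e' h h' hee
      rcases (hm e).1 h with h | h <;> rcases (hm e').1 h' with h' | h'
      · exact hc e e' h h' hee
      · exact absurd hee.symm (hd e e' h (hact e' h'))
      · exact absurd hee (hd e' e h' (hact e h))
      · exact eq_of_acceptsEdge Γ ((selectsEdge_eq_true Γ).1 h').1 (hact e h) hee
    · intro e e' h h' hee
      rw [unmatchedPart_eq_true] at h'
      rcases (hm e).1 h with h | h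
      · exact hd e e' h h'.1 hee
      · have h1 := ((selectsEdge_eq_true Γ).1 h).1
        have h2 := eq_of_acceptsEdge Γ h1 h'.1 hee
        rw [← h2, h'.2 e'.2] at h1
        cases h1
    · intro u hu
      rcases he u hu with h | ⟨j, h⟩
      · by_cases hex : ∃ j, acceptsEdge Γ s (u, j) = true
        · right
          obtain ⟨j, hj, hmin⟩ := Finset.exists_min_image
            (Finset.univ.filter fun j => acceptsEdge Γ s (u, j) = true) id
            (by obtain ⟨j, hj⟩ := hex; exact ⟨j, by simpa using hj⟩)
          refine ⟨j, (hm _).2 (Or.inr ((selectsEdge_eq_true Γ).2 ⟨by simpa using hj, ?_⟩))⟩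
          intro j' hj'
          by_contra hne
          have := hmin j' (by simpa using hne)
          exact absurd hj' (not_lt.2 this)
        · left
          push Not at hex
          exact (unmatchedPart_eq_true Γ).2 ⟨h, fun j => by simpa using hex j⟩
      · exact Or.inr ⟨j, (hm _).2 (Or.inl h)⟩

/-- The `8 * |S|` edges reach more than `6 * |S|` vertices, so more than `4 * |S|` of these are
reached by a single edge and accept it. A left vertex has at most 8 accepted edges, so more than
half of `S` is matched. -/
theorem card_unmatchedPart_le (s : Fin n → Bool)
    (hΓ : 6 * (Finset.univ.filter fun u => s u = true).card <
      (((Finset.univ.filter fun u => s u = true) ×ˢ (Finset.univ : Finset (Fin 8))).image Γ).card) :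
    2 * (Finset.univ.filter fun u => unmatchedPart Γ s u = true).card ≤
      (Finset.univ.filter fun u => s u = true).card := by
  classical
  set S := Finset.univ.filter fun u => s u = true with hS
  set NS := (S ×ˢ (Finset.univ : Finset (Fin 8))).image Γ with hNS
  set acc := Finset.univ.filter fun e => acceptsEdge Γ s e = true with hacc
  set matched := S.filter fun u => ∃ j, acceptsEdge Γ s (u, j) = true with hmatched
  have h1 : ∑ v ∈ NS, (activeEdges Γ s v).card = 8 * S.card := by
    have := Finset.card_eq_sum_card_fiberwise (f := Γ) (s := S ×ˢ (Finset.univ : Finset (Fin 8)))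
      (t := NS) (fun e he => Finset.mem_image_of_mem _ he)
    rw [Finset.card_product, Finset.card_fin] at this
    rw [mul_comm, this]
    refine Finset.sum_congr rfl fun v _ => ?_
    congr 1
    ext e
    simp [activeEdges, hS, and_comm]
  have h2 : ∀ v ∈ NS, 2 ≤ (activeEdges Γ s v).card + (acc.filter fun e => Γ e = v).card := by
    intro v hv
    obtain ⟨e, he, rfl⟩ := Finset.mem_image.1 hv
    have hse : s e.1 = true := by simpa [hS] using he
    have hpos : e ∈ activeEdges Γ s (Γ e) := by simp [activeEdges, hse]
    have hpos' := Finset.card_pos.2 ⟨e, hpos⟩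
    by_cases hlt : 1 < (activeEdges Γ s (Γ e)).card
    · omega
    · have : e ∈ acc.filter fun e' => Γ e' = Γ e := by
        simp [hacc, acceptsEdge, hse]
        omega
      have := Finset.card_pos.2 ⟨e, this⟩
      omega
  have h3 : ∑ v ∈ NS, (acc.filter fun e => Γ e = v).card ≤ acc.card := by
    have := Finset.card_eq_sum_card_fiberwise (f := Γ) (s := acc) (t := NS) (fun e he => by
      have : acceptsEdge Γ s e = true := by simpa [hacc] using he
      rw [acceptsEdge, Bool.and_eq_true] at this
      exact Finset.mem_image_of_mem _ (by simp [hS, this.1]))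
    exact this.ge
  have h4 : acc.card ≤ 8 * matched.card := by
    have hsub : acc ⊆ matched ×ˢ (Finset.univ : Finset (Fin 8)) := by
      intro e he
      have he' : acceptsEdge Γ s e = true := by simpa [hacc] using he
      have hs : s e.1 = true := by
        rw [acceptsEdge, Bool.and_eq_true] at he'
        exact he'.1
      simp only [Finset.mem_product, Finset.mem_univ, and_true, hmatched, Finset.mem_filter, hS,
        true_and]
      exact ⟨hs, e.2, he'⟩
    have := Finset.card_le_card hsub
    rw [Finset.card_product, Finset.card_fin] at this
    omega
  have h5 : 2 * NS.card ≤ 8 * S.card + acc.card := by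
    have := Finset.sum_le_sum h2
    rw [Finset.sum_const, Finset.sum_add_distrib, h1, smul_eq_mul] at this
    omega
  have h6 : (Finset.univ.filter fun u => unmatchedPart Γ s u = true).card + matched.card =
      S.card := by
    have e1 : (Finset.univ.filter fun u => unmatchedPart Γ s u = true) =
        S.filter fun u => ¬ ∃ j, acceptsEdge Γ s (u, j) = true := by
      ext u
      simp [hS, unmatchedPart_eq_true]
    rw [e1, add_comm]
    exact Finset.card_filter_add_card_filter_not _
  omega

theorem unmatchedPart_iterate_card {M : ℕ} (hM : 3000000 * M ≤ n)
    (hΓ : ∀ S : Finset (Fin n), S.Nonempty → 3000000 * S.card ≤ n →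
      6 * S.card < ((S ×ˢ (Finset.univ : Finset (Fin 8))).image Γ).card)
    (x : Fin n → Bool) (hx : (Finset.univ.filter fun u => x u = true).card ≤ M) (t : ℕ) :
    2 ^ t * (Finset.univ.filter fun u => (unmatchedPart Γ)^[t] x u = true).card ≤ M := by
  induction t with
  | zero =>
    rw [pow_zero, one_mul]
    exact hx
  | succ t ih =>
    rw [Function.iterate_succ_apply']
    set s := (unmatchedPart Γ)^[t] x
    by_cases hne : (Finset.univ.filter fun u => s u = true).Nonempty
    · have hle : (Finset.univ.filter fun u => s u = true).card ≤ M :=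
        (Nat.le_mul_of_pos_left _ (by positivity)).trans ih
      have := card_unmatchedPart_le Γ s (hΓ _ hne (by omega))
      calc 2 ^ (t + 1) * _ = 2 ^ t *
            (2 * (Finset.univ.filter fun u => unmatchedPart Γ s u = true).card) := by ring
        _ ≤ 2 ^ t * _ := Nat.mul_le_mul_left _ this
        _ ≤ M := ih
    · have h0 : (Finset.univ.filter fun u => unmatchedPart Γ s u = true) = ∅ := by
        rw [Finset.not_nonempty_iff_eq_empty] at hne
        rw [Finset.filter_eq_empty_iff] at hne ⊢
        intro u hu h
        exact hne hu ((unmatchedPart_eq_true Γ).1 h).1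
      rw [h0]
      simp

/-- One round of the matching algorithm takes linearly many gates. -/
theorem computes_matching_round {Ω : Type} {S : Set (Ω → Bool)} (hc : constWires Ω ⊆ S)
    (X : Fin n → Ω → Bool) (hX : ∀ u, X u ∈ S) :
    Computes S (240 * n)
      ((Set.range fun e ω => selectsEdge Γ (fun u => X u ω) e) ∪
        Set.range fun u ω => unmatchedPart Γ (fun u => X u ω) u) := by
  classical
  have hfalse := hc false_mem_constWires
  -- The counters of all right vertices read `8 * n` edges in total, with 16 gates per edge, however
  -- unevenly the degrees are distributed.
  have c1 : Computes S (128 * n) (Set.range fun v ω =>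
      decide (1 < (activeEdges Γ (fun u => X u ω) v).card)) := by
    have h1 : ∀ v : Fin m, Computes S (16 * (Finset.univ.filter fun e => Γ e = v).card)
        {fun ω => decide (1 < (activeEdges Γ (fun u => X u ω) v).card)} := by
      intro v
      have := computes_thresholds
        ((Finset.univ.filter fun e => Γ e = v).toList.map fun e => X e.1) hc (by
          intro f hf
          obtain ⟨e, -, rfl⟩ := List.mem_map.1 hf
          exact hX _)
      rw [List.length_map, Finset.length_toList] at this
      refine this.mono_right ?_
      rintro _ rfl
      refine ⟨1, ?_⟩
      funext ω
      simp only
      rw [countWires_map_toList]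
      rfl
    have h2 := Computes.iUnion h1
    rw [Set.iUnion_singleton_eq_range, ← Finset.mul_sum,
      ← Finset.card_eq_sum_card_fiberwise (fun _ _ => Finset.mem_coe.2 (Finset.mem_univ _))] at h2
    refine h2.mono_cost ?_
    simp only [Finset.card_univ, Fintype.card_prod, Fintype.card_fin]
    omega
  set S₁ := S ∪ Set.range fun v ω => decide (1 < (activeEdges Γ (fun u => X u ω) v).card) with hS₁
  have c2 : Computes S₁ (n * 8 * 2) (Set.range fun e ω => acceptsEdge Γ (fun u => X u ω) e) := by
    have := Computes.range (S := S₁) (k := 2)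
      (F := fun e ω => acceptsEdge Γ (fun u => X u ω) e) (fun e =>
        (Computes.of_mem (Or.inl (hX e.1))).and
          (Computes.of_mem (f := fun ω => decide (1 < (activeEdges Γ (fun u => X u ω) (Γ e)).card))
            (Or.inr ⟨Γ e, rfl⟩)).not)
    simpa using this
  have c12 := c1.trans' (U := S ∪ Set.range fun e ω => acceptsEdge Γ (fun u => X u ω) e)
    (((Computes.of_subset (k := 0) Set.subset_union_left).union c2))
  set S₂ := S ∪ (S ∪ Set.range fun e ω => acceptsEdge Γ (fun u => X u ω) e) with hS₂
  have acc : ∀ e, Computes S₂ 0 {fun ω => acceptsEdge Γ (fun u => X u ω) e} :=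
    fun e => .of_mem (Or.inr (Or.inr ⟨e, rfl⟩))
  have hany : ∀ (L : List (Fin 8)) (u : Fin n), L.length ≤ 8 →
      Computes S₂ 8 {fun ω => L.any fun j => acceptsEdge Γ (fun u => X u ω) (u, j)} := by
    intro L u hL
    have := Computes.any (S := S₂) (k := 0) L
      (fun j ω => acceptsEdge Γ (fun u => X u ω) (u, j)) (Or.inl hfalse) (fun j _ => acc (u, j))
    exact this.mono_cost (by omega)
  have c3 : Computes S₂ (n * 8 * 10) (Set.range fun e ω => selectsEdge Γ (fun u => X u ω) e) := by
    have := Computes.range (S := S₂) (k := 10)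
      (F := fun e ω => selectsEdge Γ (fun u => X u ω) e) (fun e =>
        ((acc e).and (hany ((List.finRange 8).filter (· < e.2)) e.1 (by
          refine (List.length_filter_le _ _).trans ?_
          simp)).not).mono_cost (by norm_num))
    simpa using this
  have c4 : Computes S₂ (n * 10) (Set.range fun u ω => unmatchedPart Γ (fun u => X u ω) u) := by
    have := Computes.range (S := S₂) (k := 10)
      (F := fun u ω => unmatchedPart Γ (fun u => X u ω) u) (fun u =>
        ((Computes.of_mem (Or.inl (hX u))).and
          (hany (List.finRange 8) u (by simp)).not).mono_cost (by norm_num))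
    simpa using this
  exact (c12.trans' (c3.union c4)).mono_cost (by omega)

theorem computes_matchingEdges (t : ℕ) :
    Computes (bitWires n) (248 * n * t)
      ((Set.range fun e (x : Fin n → Bool) => matchingEdges Γ t x e) ∪
        Set.range fun u (x : Fin n → Bool) => (unmatchedPart Γ)^[t] x u) := by
  induction t with
  | zero =>
    refine Computes.of_subset ?_
    rintro _ (⟨e, rfl⟩ | ⟨u, rfl⟩)
    · exact Or.inl false_mem_constWires
    · exact Or.inr ⟨u, rfl⟩
  | succ t ih =>
    have c1 := computes_matching_round Γ (S := bitWires n ∪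
        ((Set.range fun e (x : Fin n → Bool) => matchingEdges Γ t x e) ∪
        Set.range fun u (x : Fin n → Bool) => (unmatchedPart Γ)^[t] x u))
      (fun f hf => Or.inl (Or.inl hf)) (fun u x => (unmatchedPart Γ)^[t] x u)
      (fun u => Or.inr (Or.inr ⟨u, rfl⟩))
    have c2 := ih.trans c1
    set S₁ := bitWires n ∪ (((Set.range fun e (x : Fin n → Bool) => matchingEdges Γ t x e) ∪
        Set.range fun u (x : Fin n → Bool) => (unmatchedPart Γ)^[t] x u) ∪
        ((Set.range fun e (x : Fin n → Bool) =>
          selectsEdge Γ (fun u => (unmatchedPart Γ)^[t] x u) e) ∪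
        Set.range fun u (x : Fin n → Bool) =>
          unmatchedPart Γ (fun u => (unmatchedPart Γ)^[t] x u) u)) with hS₁
    have c3 : Computes S₁ (n * 8 * 1)
        (Set.range fun e (x : Fin n → Bool) => matchingEdges Γ (t + 1) x e) := by
      have := Computes.range (S := S₁) (k := 1)
        (F := fun e (x : Fin n → Bool) => matchingEdges Γ (t + 1) x e) (fun e =>
          (Computes.of_mem (f := fun x : Fin n → Bool => matchingEdges Γ t x e)
            (Or.inr (Or.inl (Or.inl ⟨e, rfl⟩)))).or
          (Computes.of_mem (f := fun x : Fin n → Bool =>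
            selectsEdge Γ (fun u => (unmatchedPart Γ)^[t] x u) e)
            (Or.inr (Or.inr (Or.inl ⟨e, rfl⟩)))))
      simpa using this
    refine (c2.trans c3).mono_cost (by ring_nf; omega) |>.mono_right ?_
    rintro _ (⟨e, rfl⟩ | ⟨u, rfl⟩)
    · exact Or.inr ⟨e, rfl⟩
    · refine Or.inl (Or.inr (Or.inr ⟨u, ?_⟩))
      funext x
      simp only
      rw [Function.iterate_succ_apply']

end ExpanderMatching

/-- Every edge is a potential swap of its left position with the dummy position of its right end; it
is carried out if the edge belongs to the matching, so the active swaps are disjoint. The number of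
rounds affects only the controls. -/
theorem hasLooseCompaction_of_expander {n m M : ℕ} (hm : n ≤ 3 * m) (hM : 3000000 * M ≤ n) :
    HasLooseCompaction n M m (248 * n * (Nat.clog 2 n + 1)) (8 * n) := by
  classical
  obtain ⟨Γ, hΓ⟩ := exists_expander n m hm
  set R := Nat.clog 2 n + 1 with hR
  let N : Fin n × Fin 8 → SwapNet (Slot n) (Fin n → Bool) := fun e =>
    [((Sum.inl e.1, Sum.inr (Γ e).val), fun x => matchingEdges Γ R x e)]
  -- The collecting positions are the dummies below `m`; the dummies of the smaller instance are
  -- shifted past them.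
  refine ⟨(Finset.univ : Finset (Fin n × Fin 8)).toList.flatMap N, ?_, ?_,
    Sum.elim (fun i => Sum.inr i.val) (fun d => Sum.inr (m + d)), ?_, ?_⟩
  · have := SwapNet.length_flatMap_le (N := N) (b := 1)
      (Finset.univ : Finset (Fin n × Fin 8)).toList (fun i => by simp [N])
    rw [Finset.length_toList] at this
    simp only [Finset.card_univ, Fintype.card_prod, Fintype.card_fin] at this
    omega
  · refine (computes_matchingEdges Γ R).mono_right ?_
    rw [SwapNet.controls_flatMap]
    intro c hc
    simp only [Set.mem_iUnion] at hc
    obtain ⟨e, -, s, hs, rfl⟩ := hc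
    rw [List.mem_singleton.1 hs]
    exact Or.inl ⟨e, rfl⟩
  · rintro (i | d) (j | d') h
    · have h1 : i.val = j.val := Sum.inr_injective h
      rw [Fin.ext h1]
    · have h1 : i.val = m + d' := Sum.inr_injective h
      omega
    · have h1 : m + d = j.val := Sum.inr_injective h
      omega
    · have h1 : m + d = m + d' := Sum.inr_injective h
      rw [Nat.add_left_cancel h1]
  · intro x hx p hp
    obtain ⟨-, hb, hc, -, he⟩ := matchingEdges_spec Γ x R
    let A : Fin n × Fin 8 → Set (Slot n) := fun e =>
      {p | matchingEdges Γ R x e = true ∧ (p = Sum.inl e.1 ∨ p = Sum.inr (Γ e).val)}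
    have hNp : ∀ e, (N e).perm x =
        if matchingEdges Γ R x e then Equiv.swap (Sum.inl e.1) (Sum.inr (Γ e).val) else 1 := by
      intro e
      simp [N, SwapNet.perm_cons]
    obtain ⟨h1, h2⟩ := SwapNet.perm_flatMap N A x (by
      intro e e' hne
      rw [Set.disjoint_left]
      rintro p ⟨h1, h2⟩ ⟨h3, h4⟩
      rcases h2 with rfl | rfl <;> rcases h4 with h4 | h4
      · exact hne (hb e e' h1 h3 (Sum.inl_injective h4))
      · cases h4
      · cases h4
      · exact hne (hc e e' h1 h3 (Fin.ext (Sum.inr_injective h4)))) (by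
      intro e p hp
      rw [hNp]
      split_ifs with h
      · refine Equiv.swap_apply_of_ne_of_ne (fun h1 => hp ⟨h, Or.inl h1⟩)
          (fun h1 => hp ⟨h, Or.inr h1⟩)
      · rfl) _ (Finset.nodup_toList _)
    rcases p with u | d
    · by_cases hex : ∃ j, matchingEdges Γ R x (u, j) = true
      · obtain ⟨j, hj⟩ := hex
        rw [h1 (u, j) (by simp) (Sum.inl u) ⟨hj, Or.inl rfl⟩, hNp, if_pos hj,
          Equiv.swap_apply_left]
        rfl
      · rw [h2 (Sum.inl u)]
        · show x u = false
          by_contra hne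
          rcases he u (by simpa using hne) with h | h
          · have hcard := unmatchedPart_iterate_card Γ hM hΓ x hx R
            have hpos : 0 < (Finset.univ.filter fun u =>
                (unmatchedPart Γ)^[R] x u = true).card :=
              Finset.card_pos.2 ⟨u, by simpa using h⟩
            have h3 : 2 ^ R ≤ M := (Nat.le_mul_of_pos_right _ hpos).trans hcard
            have h4 : n ≤ 2 ^ Nat.clog 2 n := Nat.le_pow_clog (by norm_num) n
            have h5 : 2 ^ R = 2 * 2 ^ Nat.clog 2 n := by rw [hR, pow_succ]; ring
            have := u.isLt
            omega
          · exact hex h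
        · rintro ⟨u', j⟩ - ⟨h3, h4⟩
          rcases h4 with h4 | h4
          · have : u = u' := Sum.inl_injective h4
            subst this
            exact hex ⟨j, h3⟩
          · cases h4
    · rw [h2]
      · rfl
      · rintro e - ⟨-, h4⟩
        rcases h4 with h4 | h4
        · cases h4
        · exact hp (Γ e) h4

/-! ### Bootstrapping -/

theorem isMixing_complete (n : ℕ) :
    ∃ E : List (Fin n × Fin n), E.length = n * n ∧ IsMixing E 0 := by
  refine ⟨(Finset.univ : Finset (Fin n × Fin n)).toList, by simp, fun R B h hR => ?_⟩
  obtain ⟨r, hr⟩ := Finset.card_pos.1 hR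
  obtain ⟨b, hb⟩ := Finset.card_pos.1 (h ▸ hR)
  exact ⟨(r, b), by simp, hr, hb⟩

theorem hasLooseCompaction_zero (n : ℕ) : HasLooseCompaction n 0 0 0 0 := by
  refine ⟨[], le_rfl, Computes.of_subset (by rintro c ⟨s, hs, -⟩; cases hs),
    Sum.elim (fun i => i.elim0) Sum.inr, ?_, ?_⟩
  · rintro (i | d) (j | d') h
    · exact i.elim0
    · exact i.elim0
    · exact j.elim0
    · exact congrArg Sum.inr (Sum.inr_injective h)
  · intro m hm p _
    rcases p with i | d
    · have h0 := Finset.card_eq_zero.1 (Nat.le_zero.1 hm)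
      have := Finset.filter_eq_empty_iff.1 h0 (Finset.mem_univ i)
      show m i = false
      simpa using this
    · rfl

theorem hasMatching_zero : HasMatching 0 0 0 :=
  ⟨[], le_rfl, Computes.of_subset (by rintro c ⟨s, hs, -⟩; cases hs), fun _ _ _ =>
    ⟨1, by ext p; rcases p with i | d <;> rfl, fun i => i.elim0, fun i => i.elim0⟩⟩

/-- Base case of the recursion: a pass over all pairs leaves nothing misplaced, so an empty loose
compaction suffices. -/
theorem hasMatching_small (n : ℕ) : HasMatching n (22 * (n * n) + 4 * n) (n * n) := by
  obtain ⟨E, hE, hmix⟩ := isMixing_complete n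
  have := HasMatching.of_looseCompaction E (μ := 0) hmix (hasLooseCompaction_zero n)
    hasMatching_zero
  rw [hE] at this
  simpa using this

/-- If loose compaction with swap cost `B n` and control cost `A n ℓ(n)` shrinks the array by
a constant factor, then matching has costs of the same order. -/
theorem exists_hasMatching {h n₀ D : ℕ} {A B θ : ℝ} {ℓ : ℕ → ℝ} (hA : 0 ≤ A) (hB : 0 ≤ B)
    (hθ0 : 0 ≤ θ) (hθ : θ < 1) (hn₀ : 1 ≤ n₀) (hn₀D : n₀ ≤ D) (hℓ : Monotone ℓ) (hℓ1 : ∀ n, 1 ≤ ℓ n)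
    (hmix : ∀ n, ∃ E : List (Fin n × Fin n), E.length ≤ D * n ∧ IsMixing E (n / h))
    (hLC : ∀ n ≥ n₀, ∃ n' a b, HasLooseCompaction n (2 * (n / h)) n' a b ∧ (n' : ℝ) ≤ θ * n ∧
      (a : ℝ) ≤ A * (n * ℓ n) ∧ (b : ℝ) ≤ B * n) (n : ℕ) :
    ∃ a b, HasMatching n a b ∧ (a : ℝ) ≤ (A + 16 * B + 22 * D + 4) / (1 - θ) * (n * ℓ n) ∧
      (b : ℝ) ≤ (D + 2 * B) / (1 - θ) * n := by
  have hθ' : 0 < 1 - θ := by linarith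
  induction n using Nat.strong_induction_on with
  | _ n ih =>
  have hnℓ : (n : ℝ) ≤ n * ℓ n := le_mul_of_one_le_right (Nat.cast_nonneg n) (hℓ1 n)
  have hnℓ0 : (0 : ℝ) ≤ n * ℓ n := (Nat.cast_nonneg n).trans hnℓ
  have hD0 : (0 : ℝ) ≤ D := Nat.cast_nonneg D
  -- For small `n` the quadratic cost is linear because `n < n₀ ≤ D`.
  rcases lt_or_ge n n₀ with hlt | hge
  · have hnD : (n : ℝ) ≤ D := by exact_mod_cast hlt.le.trans hn₀D
    have hnn : (n : ℝ) * n ≤ D * n := mul_le_mul_of_nonneg_right hnD (Nat.cast_nonneg n)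
    refine ⟨_, _, hasMatching_small n, ?_, ?_⟩
    · have h1 : A + 16 * B + 22 * D + 4 ≤ (A + 16 * B + 22 * D + 4) / (1 - θ) :=
        le_div_self (by positivity) hθ' (by linarith)
      have h2 : (22 * D + 4) * (n : ℝ) ≤ (A + 16 * B + 22 * D + 4) * (n * ℓ n) :=
        mul_le_mul (by linarith) hnℓ (Nat.cast_nonneg n) (by positivity)
      have h3 := mul_le_mul_of_nonneg_right h1 hnℓ0
      push_cast
      nlinarith
    · have h1 : D + 2 * B ≤ (D + 2 * B) / (1 - θ) :=
        le_div_self (by positivity) hθ' (by linarith)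
      have h2 : (D : ℝ) * n ≤ (D + 2 * B) * n :=
        mul_le_mul_of_nonneg_right (by linarith) (Nat.cast_nonneg n)
      have h3 := mul_le_mul_of_nonneg_right h1 (Nat.cast_nonneg (α := ℝ) n)
      push_cast
      linarith
  · obtain ⟨E, hEl, hE⟩ := hmix n
    obtain ⟨n', a₁, b₁, hLC₁, hn', ha₁, hb₁⟩ := hLC n hge
    have hn0 : (0 : ℝ) < n := by exact_mod_cast hn₀.trans hge
    have hn'n : n' < n := by
      have : (n' : ℝ) < n := hn'.trans_lt (by nlinarith)
      exact_mod_cast this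
    obtain ⟨a₂, b₂, hM, ha₂, hb₂⟩ := ih n' hn'n
    refine ⟨_, _, HasMatching.of_looseCompaction E hE hLC₁ hM, ?_, ?_⟩
    · have hEl' : (E.length : ℝ) ≤ D * n := by exact_mod_cast hEl
      set G := (A + 16 * B + 22 * D + 4) / (1 - θ) with hG
      have hG0 : 0 ≤ G := by positivity
      -- `G` is the sum of the geometric series, the fixed point of adding the cost of one step to
      -- `θ * G`.
      have hGe : G * (1 - θ) = A + 16 * B + 22 * D + 4 := by rw [hG]; field_simp
      have h1 : (n' : ℝ) * ℓ n' ≤ θ * (n * ℓ n) := by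
        rw [← mul_assoc]
        exact mul_le_mul hn' (hℓ hn'n.le) (by linarith [hℓ1 n']) (by positivity)
      have h2 := mul_le_mul_of_nonneg_left h1 hG0
      have h3 : (22 * D + 4 + 16 * B) * (n : ℝ) ≤ (22 * D + 4 + 16 * B) * (n * ℓ n) :=
        mul_le_mul_of_nonneg_left hnℓ (by positivity)
      have h4 : G * (n * ℓ n) = (A + 16 * B + 22 * D + 4) * (n * ℓ n) + G * (θ * (n * ℓ n)) := by
        rw [← hGe]; ring
      push_cast
      rw [h4]
      linarith
    · have hEl' : (E.length : ℝ) ≤ D * n := by exact_mod_cast hEl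
      set G := (D + 2 * B) / (1 - θ) with hG
      have hG0 : 0 ≤ G := by positivity
      have hGe : G * (1 - θ) = D + 2 * B := by rw [hG]; field_simp
      have h2 := mul_le_mul_of_nonneg_left hn' hG0
      have h4 : G * n = (D + 2 * B) * n + G * (θ * n) := by
        rw [← hGe]; ring
      push_cast
      rw [h4]
      linarith

/-! ### The hierarchy of compaction levels -/

/-- The `2^k`-fold iterated binary logarithm, each time rounded up. -/
def iterClog (k n : ℕ) : ℕ := (Nat.clog 2)^[2 ^ k] n

theorem clog_iterate_mono (m : ℕ) : Monotone (Nat.clog 2)^[m] :=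
  Monotone.iterate (fun _ _ h => Nat.clog_mono_right 2 h) m

theorem clog_le_self (n : ℕ) : Nat.clog 2 n ≤ n :=
  Nat.clog_le_of_le_pow Nat.lt_two_pow_self.le

theorem clog_iterate_le (m n : ℕ) : (Nat.clog 2)^[m] n ≤ n := by
  induction m generalizing n with
  | zero => exact le_rfl
  | succ m ih => exact (ih _).trans (clog_le_self n)

/-- Absorbs the `+ 1` in the chunk length `iterClog k n + 1` when logarithms are taken again. -/
theorem clog_iterate_succ_le (m n : ℕ) : (Nat.clog 2)^[m] (n + 1) ≤ (Nat.clog 2)^[m] n + 1 := by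
  induction m generalizing n with
  | zero => exact le_rfl
  | succ m ih =>
    have h : Nat.clog 2 (n + 1) ≤ Nat.clog 2 n + 1 := by
      refine Nat.clog_le_of_le_pow ?_
      have h1 := Nat.le_pow_clog (by norm_num : 1 < 2) n
      have h2 := Nat.one_le_two_pow (n := Nat.clog 2 n)
      rw [pow_succ]
      omega
    exact (clog_iterate_mono m h).trans (ih _)

theorem iterClog_succ (k n : ℕ) : iterClog (k + 1) n = iterClog k (iterClog k n) := by
  rw [iterClog, pow_succ, mul_two, Function.iterate_add_apply]
  rfl

theorem iterClog_le_clog (k n : ℕ) : iterClog k n ≤ Nat.clog 2 n := by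
  obtain ⟨m, hm⟩ : ∃ m, 2 ^ k = m + 1 := ⟨2 ^ k - 1, by have := Nat.one_le_two_pow (n := k); omega⟩
  rw [iterClog, hm]
  exact clog_iterate_le m _

theorem exists_clog_le (h : ℕ) : ∃ n₀ : ℕ, 1 ≤ n₀ ∧ ∀ n ≥ n₀, h * (Nat.clog 2 n + 1) ≤ n := by
  have ht := tendsto_pow_const_div_const_pow_of_one_lt 1 (show (1 : ℝ) < 2 by norm_num)
  have hev := ht.eventually (gt_mem_nhds (show (0 : ℝ) < 1 / (4 * (h + 1)) by positivity))
  obtain ⟨j₀, hj₀⟩ := Filter.eventually_atTop.1 hev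
  refine ⟨2 ^ (j₀ + 1), Nat.one_le_two_pow, fun n hn => ?_⟩
  obtain ⟨j, hj⟩ : ∃ j, Nat.clog 2 n = j + 1 := by
    have : j₀ + 1 ≤ Nat.clog 2 n := by
      have := Nat.clog_mono_right 2 hn
      rwa [Nat.clog_pow 2 _ (by norm_num)] at this
    exact ⟨Nat.clog 2 n - 1, by omega⟩
  have hjj₀ : j₀ ≤ j := by
    have := Nat.clog_mono_right 2 hn
    rw [Nat.clog_pow 2 _ (by norm_num)] at this
    omega
  have hlt : 2 ^ j < n := by
    by_contra hle
    have := Nat.clog_le_of_le_pow (not_lt.1 hle)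
    omega
  have h1 := hj₀ (max j 1) (hjj₀.trans (le_max_left _ _))
  have key : ∀ i : ℕ, 1 ≤ i → ((i : ℝ) ^ 1 / 2 ^ i < 1 / (4 * (h + 1))) → h * (i + 2) ≤ 2 ^ i := by
    intro i hi hlt
    rw [pow_one, div_lt_div_iff₀ (by positivity) (by positivity)] at hlt
    have : i * (4 * (h + 1)) < 1 * 2 ^ i := by exact_mod_cast hlt
    nlinarith
  rw [hj]
  rcases Nat.eq_zero_or_pos j with rfl | hjpos
  · have := key 1 le_rfl (by simpa using h1)
    omega
  · rw [max_eq_left (by omega)] at h1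
    have h2 := key j hjpos h1
    exact h2.trans hlt.le

/-- Compaction by linearly many swaps, with controls computed from the keys by a number of gates
that exceeds this by an iterated logarithm. -/
def CompactionLevel (k : ℕ) (α β : ℝ) : Prop :=
  ∀ n : ℕ, ∃ a b, HasCompaction n a b ∧ (a : ℝ) ≤ α * (n * (1 + iterClog k n)) ∧
    (b : ℝ) ≤ β * n

theorem CompactionLevel.mono {k : ℕ} {α β α' β' : ℝ} (h : CompactionLevel k α β) (hα : α ≤ α')
    (hβ : β ≤ β') : CompactionLevel k α' β' := by
  intro n
  obtain ⟨a, b, h1, h2, h3⟩ := h n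
  exact ⟨a, b, h1, h2.trans (mul_le_mul_of_nonneg_right hα (by positivity)),
    h3.trans (mul_le_mul_of_nonneg_right hβ (Nat.cast_nonneg n))⟩

theorem compactionLevel_of_hasMatching {k : ℕ} {α β : ℝ}
    (h : ∀ n : ℕ, ∃ a b, HasMatching n a b ∧ (a : ℝ) ≤ α * (n * (1 + iterClog k n)) ∧
      (b : ℝ) ≤ β * n) : CompactionLevel k (α + 18) β := by
  intro n
  obtain ⟨a, b, h1, h2, h3⟩ := h n
  refine ⟨_, _, h1.hasCompaction, ?_, h3⟩
  have : (n : ℝ) ≤ n * (1 + iterClog k n) :=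
    le_mul_of_one_le_right (Nat.cast_nonneg n) (by
      have : (0 : ℝ) ≤ iterClog k n := Nat.cast_nonneg _
      linarith)
  push_cast
  linarith

theorem monotone_one_add_iterClog (k : ℕ) : Monotone fun n : ℕ => (1 + iterClog k n : ℝ) := by
  intro m n hmn
  have : iterClog k m ≤ iterClog k n := clog_iterate_mono _ hmn
  have : (iterClog k m : ℝ) ≤ iterClog k n := by exact_mod_cast this
  simpa using this

theorem exists_compactionLevel_zero : ∃ α β : ℝ, CompactionLevel 0 α β := by
  obtain ⟨D, hD⟩ := exists_isMixing 6000000 (by norm_num)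
  refine ⟨_, _, compactionLevel_of_hasMatching (exists_hasMatching (h := 6000000) (n₀ := 2)
    (D := D + 2) (A := 248) (B := 8) (θ := 1 / 2) (ℓ := fun n => 1 + iterClog 0 n) (by norm_num)
    (by norm_num) (by norm_num) (by norm_num) (by norm_num) (by omega)
    (monotone_one_add_iterClog 0) (fun n => by simp) (fun n => ?_) (fun n hn => ?_))⟩
  · obtain ⟨E, h1, h2⟩ := hD n
    exact ⟨E, h1.trans (Nat.mul_le_mul_right _ (by omega)), h2⟩
  -- Rounding down still gives `n ≤ 3 * (n / 2)` from `n₀ = 2` on; the mixing parameter 6000000 is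
  -- twice the constant of the expander, as misplaced elements come in two kinds.
  · refine ⟨n / 2, _, _, hasLooseCompaction_of_expander (by omega) (by omega), ?_, ?_, ?_⟩
    · have : (2 * (n / 2 : ℕ) : ℝ) ≤ n := by exact_mod_cast Nat.mul_div_le n 2
      linarith
    · simp only [iterClog, pow_zero, Function.iterate_one]
      push_cast
      linarith
    · push_cast
      exact le_rfl

/-- With chunk length `B = 1 + log^(2^k) n`, compacting the chunks costs `n * (1 + log^(2^k) B)` up
to a constant, twice as many logarithms as before. Compacting the array of `n / B` chunks costs only
a constant times `n`, since `B` cancels the old logarithmic factor. The chunk steps and the column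
steps use at most `β * n` swaps each. -/
theorem CompactionLevel.exists_hasLooseCompaction {k h n : ℕ} {α β : ℝ} (hk : CompactionLevel k α β)
    (hα : 0 ≤ α) (hβ : 0 ≤ β) (hh : 2 ≤ h) (hn : h * (Nat.clog 2 n + 1) ≤ n) :
    ∃ n' a b, HasLooseCompaction n (2 * (n / (2 * h ^ 2))) n' a b ∧ (n' : ℝ) * h ≤ 3 * n ∧
      (a : ℝ) ≤ (3 * α + 8 * β + 2) * (n * (1 + iterClog (k + 1) n)) ∧ (b : ℝ) ≤ 2 * β * n := by
  set B := iterClog k n + 1 with hB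
  set q := n / B with hq
  have hBpos : 0 < B := Nat.succ_pos _
  have hqB : q * B ≤ n := Nat.div_mul_le_self n B
  have hBn : h * B ≤ n :=
    (Nat.mul_le_mul_left h (Nat.succ_le_succ (iterClog_le_clog k n))).trans hn
  obtain ⟨aB, bB, hcB, haB, hbB⟩ := hk B
  obtain ⟨aq, bq, hcq, haq, hbq⟩ := hk q
  -- A chunk is dense with more than `B / h` marks and there are at most `n / (h * B)` dense ones,
  -- because `(n / (h * B)) * (B / h)` is about `n / h^2`. The three groups of collecting positions
  -- then have at most `n / h` elements each.
  have hM : 2 * (n / (2 * h ^ 2)) < (n / (h * B) + 1) * (B / h + 1) := by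
    have h1 : n < (n / (h * B) + 1) * (h * B) := by
      have := Nat.lt_mul_div_succ n (show 0 < h * B by positivity)
      linarith
    have h2 : B < (B / h + 1) * h := by
      have := Nat.lt_mul_div_succ B (show 0 < h by omega)
      linarith
    have h3 : 2 * (n / (2 * h ^ 2)) * h ^ 2 ≤ n := by
      have := Nat.div_mul_le_self n (2 * h ^ 2)
      calc 2 * (n / (2 * h ^ 2)) * h ^ 2 = n / (2 * h ^ 2) * (2 * h ^ 2) := by ring
        _ ≤ n := this
    by_contra hcon
    push Not at hcon
    have h4 : n * B < ((n / (h * B) + 1) * (h * B)) * ((B / h + 1) * h) :=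
      Nat.mul_lt_mul_of_lt_of_le h1 h2.le (by positivity)
    have h5 : ((n / (h * B) + 1) * (h * B)) * ((B / h + 1) * h) =
        ((n / (h * B) + 1) * (B / h + 1)) * h ^ 2 * B := by ring
    rw [h5] at h4
    have h6 : ((n / (h * B) + 1) * (B / h + 1)) * h ^ 2 * B ≤ n * B :=
      Nat.mul_le_mul_right _ ((Nat.mul_le_mul_right _ hcon).trans h3)
    omega
  obtain ⟨n', hn', hLC⟩ := hcB.hasLooseCompaction hcq (M := 2 * (n / (2 * h ^ 2)))
    (θ := B / h) (E := n / (h * B)) hqB (Nat.div_lt_self hBpos (by omega)) hM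
  refine ⟨n', _, _, hLC, ?_, ?_, ?_⟩
  · have h1 : n / (h * B) * B * h ≤ n := by
      have := Nat.div_mul_le_self n (h * B)
      calc n / (h * B) * B * h = n / (h * B) * (h * B) := by ring
        _ ≤ n := this
    have h2 : q * (B / h) * h ≤ n := by
      rw [mul_assoc]
      exact (Nat.mul_le_mul_left q (Nat.div_mul_le_self B h)).trans hqB
    have h3 : (n - q * B) * h ≤ n := by
      have : n < q * B + B := by
        have := Nat.lt_mul_div_succ n hBpos
        rw [← hq] at this
        linarith
      have : n - q * B ≤ B := by omega
      calc (n - q * B) * h ≤ B * h := Nat.mul_le_mul_right _ this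
        _ ≤ n := by rwa [mul_comm]
    have h4 : n' * h ≤ 3 * n := by
      refine (Nat.mul_le_mul_right h hn').trans ?_
      rw [add_mul, add_mul]
      omega
    exact_mod_cast h4
  · have hqB' : (q : ℝ) * B ≤ n := by exact_mod_cast hqB
    have hLB : (iterClog k B : ℝ) ≤ iterClog (k + 1) n + 1 := by
      rw [iterClog_succ]
      exact_mod_cast clog_iterate_succ_le (2 ^ k) (iterClog k n)
    have hLq : (iterClog k q : ℝ) ≤ iterClog k n := by
      exact_mod_cast clog_iterate_mono _ (Nat.div_le_self n B)
    have hBe : (B : ℝ) = 1 + iterClog k n := by rw [hB]; push_cast; ring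
    have hL0 : (0 : ℝ) ≤ iterClog (k + 1) n := Nat.cast_nonneg _
    set L := (iterClog (k + 1) n : ℝ)
    have hn0 : (0 : ℝ) ≤ n := Nat.cast_nonneg n
    have hq0 : (0 : ℝ) ≤ q := Nat.cast_nonneg q
    have h1 : (q : ℝ) * aB ≤ α * (n * (2 + L)) := by
      calc (q : ℝ) * aB ≤ q * (α * (B * (1 + iterClog k B))) := by gcongr
        _ = α * ((q * B) * (1 + iterClog k B)) := by ring
        _ ≤ α * (n * (2 + L)) := by
          refine mul_le_mul_of_nonneg_left ?_ hα
          exact mul_le_mul hqB' (by linarith) (by positivity) hn0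
    have h2 : (aq : ℝ) ≤ α * n := by
      refine haq.trans (mul_le_mul_of_nonneg_left ?_ hα)
      refine le_trans ?_ hqB'
      rw [hBe]
      gcongr
    have h3 : (q : ℝ) * bB ≤ β * n := by
      calc (q : ℝ) * bB ≤ q * (β * B) := by gcongr
        _ = β * (q * B) := by ring
        _ ≤ β * n := by gcongr
    have h4 : (0 : ℝ) ≤ n * L := by positivity
    have h5 : 0 ≤ α * (n * L) := by positivity
    have h6 : 0 ≤ β * (n * L) := by positivity
    push_cast
    nlinarith
  · have hqB' : (q : ℝ) * B ≤ n := by exact_mod_cast hqB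
    have hq0 : (0 : ℝ) ≤ q := Nat.cast_nonneg q
    have h3 : (q : ℝ) * bB ≤ β * n := by
      calc (q : ℝ) * bB ≤ q * (β * B) := by gcongr
        _ = β * (q * B) := by ring
        _ ≤ β * n := by gcongr
    have h4 : (B : ℝ) * bq ≤ β * n := by
      calc (B : ℝ) * bq ≤ B * (β * q) := by gcongr
        _ = β * (q * B) := by ring
        _ ≤ β * n := by gcongr
    push_cast
    linarith

/-- A step of the matching recursion uses `D + 2 * (2 * β)` swaps per element. Shrinking by `θ = 1 -
4 / ρ` multiplies this by `ρ / 4`, so `β` grows by the factor `ρ`. Such shrinking needs only `h ≥ 3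
/ θ`, as the collecting array has at most `3 * n / h` positions. -/
theorem exists_compactionLevel_succ (ρ : ℝ) (hρ : 4 < ρ) :
    ∃ D : ℕ, ∀ k α β, 0 ≤ α → 0 ≤ β → CompactionLevel k α β →
      CompactionLevel (k + 1) (ρ / 4 * (3 * α + 40 * β + 22 * D + 6) + 18)
        (ρ / 4 * (D + 4 * β)) := by
  set θ := 1 - 4 / ρ with hθ
  have hρ0 : 0 < ρ := by linarith
  have hθ0 : 0 < θ := by
    rw [hθ, sub_pos, div_lt_one hρ0]; exact hρ
  have hθ1 : 1 - θ = 4 / ρ := by rw [hθ]; ring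
  obtain ⟨h, hh⟩ := exists_nat_ge (max 2 (3 / θ))
  have hh2 : 2 ≤ h := by exact_mod_cast (le_max_left _ _).trans hh
  have hh3 : 3 ≤ θ * h := by
    have := (le_max_right _ _).trans hh
    rwa [div_le_iff₀' hθ0] at this
  obtain ⟨D, hD⟩ := exists_isMixing (2 * h ^ 2) (Nat.one_le_iff_ne_zero.2 (by positivity))
  obtain ⟨n₀, hn₀, hlog⟩ := exists_clog_le h
  refine ⟨D + n₀, fun k α β hα hβ hk => ?_⟩
  have key := exists_hasMatching (h := 2 * h ^ 2) (n₀ := n₀) (D := D + n₀)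
    (A := 3 * α + 8 * β + 2) (B := 2 * β) (θ := θ) (ℓ := fun n => 1 + iterClog (k + 1) n)
    (by positivity) (by positivity) hθ0.le (by
      have : 0 < 4 / ρ := by positivity
      linarith) hn₀ (by omega)
    (monotone_one_add_iterClog (k + 1)) (fun n => by simp) (fun n => by
      obtain ⟨E, h1, h2⟩ := hD n
      exact ⟨E, h1.trans (Nat.mul_le_mul_right _ (by omega)), h2⟩) (fun n hn => by
      obtain ⟨n', a, b, h1, h2, h3, h4⟩ := hk.exists_hasLooseCompaction hα hβ hh2 (hlog n hn)
      refine ⟨n', a, b, h1, ?_, h3, h4⟩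
      have hhpos : (0 : ℝ) < h := by
        have : 0 < h := by omega
        exact_mod_cast this
      rw [← mul_le_mul_iff_of_pos_right hhpos]
      have : (0 : ℝ) ≤ n := Nat.cast_nonneg n
      nlinarith)
  refine (compactionLevel_of_hasMatching key).mono (le_of_eq ?_) (le_of_eq ?_)
  · rw [hθ1]
    field_simp
    ring
  · rw [hθ1]
    field_simp
    ring

/-- The recursion for `β` has leading factor `ρ`. The one for `α` has only `3 * ρ / 4`, and the gap
of `ρ / 4` absorbs the contribution of `β`. -/
theorem exists_compactionLevel (ρ : ℝ) (hρ : 4 < ρ) :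
    ∃ C : ℝ, 0 ≤ C ∧ ∀ k, CompactionLevel k (C * ρ ^ k) (C * ρ ^ k) := by
  obtain ⟨D, hD⟩ := exists_compactionLevel_succ ρ hρ
  obtain ⟨α₀, β₀, h₀⟩ := exists_compactionLevel_zero
  have hD0 : (0 : ℝ) ≤ D := Nat.cast_nonneg D
  set C₂ : ℝ := |β₀| + D + 1 with hC₂
  set C₁ : ℝ := |α₀| + 40 * C₂ with hC₁
  have hC₂D : (D : ℝ) + 1 ≤ C₂ := by
    have := abs_nonneg β₀
    rw [hC₂]; linarith
  have hC₁C₂ : 40 * C₂ ≤ C₁ := by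
    have := abs_nonneg α₀
    rw [hC₁]; linarith
  -- The slack `- (D + 1)` absorbs the additive terms of both recursions, and `C₁ ≥ 40 * C₂` the
  -- term `40 * β`.
  have key : ∀ k, CompactionLevel k (C₁ * ρ ^ k) (C₂ * ρ ^ k - (D + 1)) := by
    intro k
    induction k with
    | zero =>
      refine h₀.mono ?_ ?_
      · have := le_abs_self α₀
        rw [pow_zero]; linarith
      · have := le_abs_self β₀
        rw [pow_zero, hC₂]; linarith
    | succ k ih =>
      have hρk : (1 : ℝ) ≤ ρ ^ k := one_le_pow₀ (by linarith)
      have hβ : 0 ≤ C₂ * ρ ^ k - (D + 1) := by nlinarith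
      have hα : 0 ≤ C₁ * ρ ^ k := by
        refine mul_nonneg ?_ (by linarith)
        linarith
      refine (hD k _ _ hα hβ ih).mono ?_ ?_
      · rw [pow_succ]
        have h1 : 40 * C₂ * (ρ ^ k * ρ) ≤ C₁ * (ρ ^ k * ρ) :=
          mul_le_mul_of_nonneg_right hC₁C₂ (by positivity)
        nlinarith
      · rw [pow_succ]
        nlinarith
  refine ⟨C₁, by linarith, fun k => (key k).mono le_rfl ?_⟩
  have hρk : (0 : ℝ) ≤ ρ ^ k := by positivity
  have h1 : C₂ * ρ ^ k ≤ C₁ * ρ ^ k := mul_le_mul_of_nonneg_right (by linarith) hρk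
  linarith

/-! ### Tight compaction circuits from wires -/

/-- A family of wires that rearranges every array with sorted keys yields a tight compaction circuit
of bounded fan-out. -/
theorem Computes.exists_tightCompactor {n w k : ℕ}
    (σ : (ArrayBit n w → Bool) → Equiv.Perm (Fin n))
    (h : Computes (Set.range fun i (x : ArrayBit n w → Bool) => x i) k
      (Set.range fun (q : ArrayBit n w) (x : ArrayBit n w → Bool) => x (σ x q.1, q.2)))
    (hσ : ∀ x : ArrayBit n w → Bool, Monotone fun i => x (σ x i, none)) :
    ∃ c : BoolCircuit (ArrayBit n w) (ArrayBit n w), c.size ≤ 3 * k + n * (w + 1) ∧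
      IsTightCompactor c ∧ ∀ s, c.fanOut s ≤ 3 := by
  obtain ⟨c, hc, hce⟩ := Computes.exists_circuit 
    (fun (x : ArrayBit n w → Bool) (q : ArrayBit n w) => x (σ x q.1, q.2)) h
  obtain ⟨c', hc', hce', hf⟩ := c.exists_fanOut_le
  refine ⟨c', ?_, fun A => ⟨σ (arrayToBits A), ?_, hσ (arrayToBits A)⟩, hf⟩
  · rw [hc']
    simp only [Fintype.card_prod, Fintype.card_fin, Fintype.card_option]
    omega
  · rw [hce', hce]
    funext q
    rcases q with ⟨i, _ | j⟩ <;> rfl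

/-- Controls are computed once from the keys; each of the `w + 1` bit planes is then moved with 8
gates per swap. -/
theorem HasCompaction.exists_tightCompactor {n a b : ℕ} (h : HasCompaction n a b) (hn : 1 ≤ n)
    (w : ℕ) : ∃ c : BoolCircuit (ArrayBit n w) (ArrayBit n w),
      c.size ≤ 3 * (5 + a + (w + 1) * (8 * b)) + n * (w + 1) ∧
      IsTightCompactor c ∧ ∀ s, c.fanOut s ≤ 3 := by
  obtain ⟨N, hb, ha, hN⟩ := h
  choose σ hσ hmono using hN
  let φ : (ArrayBit n w → Bool) → Fin n → Bool := fun x i => x (i, none)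
  refine Computes.exists_tightCompactor (fun x => σ (φ x)) ?_ (fun x => hmono (φ x))
  set S : Set ((ArrayBit n w → Bool) → Bool) := Set.range fun i x => x i with hS
  have c0 : Computes S 5 (constWires _) := Computes.constWires ⟨_, ⟨(⟨0, hn⟩, none), rfl⟩⟩
  have c1 : Computes (S ∪ constWires _) a (N.map id φ).controls := by
    rw [SwapNet.controls_map]
    refine (ha.comp φ).mono_left ?_
    rintro _ ⟨f, hf | ⟨i, rfl⟩, rfl⟩
    · exact Or.inr (constWires_comp φ hf)
    · exact Or.inl ⟨(i, none), rfl⟩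
  have c01 := c0.trans c1
  set S₁ := S ∪ (constWires _ ∪ (N.map id φ).controls) with hS₁
  have c2 : ∀ o : Option (Fin w), Computes S₁ (8 * b)
      (Set.range fun p x => extendBits (fun i => x (i, o)) ((N.map id φ).perm x p)) := by
    intro o
    have := (N.map id φ).computes_apply (fun p x => extendBits (fun i => x (i, o)) p) (S := S₁)
      (fun f hf => Or.inr (Or.inr hf)) (by
        rintro (i | d)
        · exact Or.inl ⟨(i, o), rfl⟩
        · exact Or.inr (Or.inl false_mem_constWires))
    refine this.mono_cost ?_
    have e : List.length (N.map id φ) = List.length N := SwapNet.length_map _ _ _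
    rw [e]
    omega
  have c3 := c01.trans' (Computes.iUnion c2)
  refine c3.mono_cost (by simp [Finset.sum_const]) |>.mono_right ?_
  rintro _ ⟨⟨i, o⟩, rfl⟩
  refine Set.mem_iUnion.2 ⟨o, Sum.inl i, ?_⟩
  funext x
  have e : (N.map id φ).perm x (Sum.inl i) = N.perm (φ x) (Sum.inl i) :=
    SwapNet.perm_map_apply Function.injective_id φ N x (Sum.inl i)
  simp only [e, hσ]
  rfl

/-! ### Sorting very short elements -/

section Thresholds

variable {Ω : Type}

/-- Binary to unary: with lowest bit `x` and value `V'` of the other bits, even thresholds of `2 *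
V' + x` are thresholds of `V'` and odd ones take two gates. The sizes double from bit to bit, so the
last step dominates. -/
theorem computes_le_ofBits {k : ℕ} (X : Fin k → Ω → Bool) {S : Set (Ω → Bool)}
    (hc : constWires Ω ⊆ S) (hX : ∀ j, X j ∈ S) :
    Computes S (2 * 2 ^ k) (Set.range fun (v : ℕ) ω => decide (v ≤ Nat.ofBits fun j => X j ω)) := by
  induction k with
  | zero =>
    refine Computes.of_subset ?_
    rintro _ ⟨v, rfl⟩
    rcases v with _ | v
    · convert hc true_mem_constWires using 1
      funext ω; simp
    · convert hc false_mem_constWires using 1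
      funext ω; simp
  | succ k ih =>
    have c1 := ih (fun j => X j.succ) (fun j => hX j.succ)
    set S₁ := S ∪ Set.range fun (v : ℕ) ω => decide (v ≤ Nat.ofBits fun j => X (Fin.succ j) ω)
      with hS₁
    have hV : ∀ ω, (Nat.ofBits fun j => X j ω) =
        2 * (Nat.ofBits fun j => X (Fin.succ j) ω) + (X 0 ω).toNat := fun ω => Nat.ofBits_succ _
    have m : ∀ v : ℕ, Computes S₁ 0
        {fun ω => decide (v ≤ Nat.ofBits fun j => X (Fin.succ j) ω)} :=
      fun v => .of_mem (Or.inr ⟨v, rfl⟩)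
    have c2 : Computes S₁ (2 ^ k * 2) (Set.range fun (u : Fin (2 ^ k)) ω =>
        decide (2 * u.val + 1 ≤ Nat.ofBits fun j => X j ω)) := by
      have := Computes.range (S := S₁) (k := 2) (F := fun (u : Fin (2 ^ k)) ω =>
        decide (2 * u.val + 1 ≤ Nat.ofBits fun j => X j ω)) (fun u => by
          have := (m (u.val + 1)).or ((m u.val).and (.of_mem (Or.inl (hX 0))))
          convert this using 2
          funext ω
          rw [hV]
          cases X 0 ω
          · simp only [Bool.and_false, Bool.or_false, decide_eq_decide, Bool.toNat_false]
            omega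
          · simp only [Bool.and_true, ← Bool.decide_or, decide_eq_decide, Bool.toNat_true]
            omega)
      simpa using this
    refine ((Computes.of_subset (k := 0) (subset_refl S)).union (c1.trans c2)).mono_cost
      (by rw [pow_succ]; omega) |>.mono_right ?_
    rintro _ ⟨v, rfl⟩
    rcases Nat.even_or_odd' v with ⟨u, rfl | rfl⟩
    · refine Or.inr (Or.inl ⟨u, ?_⟩)
      funext ω
      simp only [decide_eq_decide]
      rw [hV]
      cases X 0 ω <;> simp only [Bool.toNat_true, Bool.toNat_false] <;> omega
    · rcases lt_or_ge u (2 ^ k) with hu | hu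
      · exact Or.inr (Or.inr ⟨⟨u, hu⟩, rfl⟩)
      · left
        convert hc false_mem_constWires using 1
        funext ω
        have := Nat.ofBits_lt_two_pow fun j => X j ω
        rw [pow_succ] at this
        simp only [decide_eq_false_iff_not]
        omega

/-- Unary to binary: the lowest bit asks whether the value is `2 * u + 1` for some `u`; the other
bits belong to half the value, whose thresholds are the even ones. -/
theorem computes_testBit {k : ℕ} (V : Ω → ℕ) (hV : ∀ ω, V ω < 2 ^ k) {S : Set (Ω → Bool)}
    (hc : constWires Ω ⊆ S) (hS : ∀ v : ℕ, (fun ω => decide (v ≤ V ω)) ∈ S) :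
    Computes S (3 * 2 ^ k) (Set.range fun (j : ℕ) ω => (V ω).testBit j) := by
  induction k generalizing V with
  | zero =>
    refine Computes.of_subset ?_
    rintro _ ⟨j, rfl⟩
    convert hc false_mem_constWires using 1
    funext ω
    have : V ω = 0 := by have := hV ω; omega
    simp [this]
  | succ k ih =>
    have c1 := ih (fun ω => V ω / 2) (fun ω => by have := hV ω; rw [pow_succ] at this; omega)
      (fun v => by
        convert hS (2 * v) using 1
        funext ω
        simp only [decide_eq_decide]
        omega)
    have c2 := Computes.any (S := S) (k := 2) (List.range (2 ^ k))
      (fun u ω => decide (2 * u + 1 ≤ V ω) && !(decide (2 * u + 2 ≤ V ω))) (hc false_mem_constWires)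
      (fun u _ => (Computes.of_mem (hS _)).and (Computes.of_mem (hS _)).not)
    rw [List.length_range] at c2
    refine (c1.union c2).mono_cost (by rw [pow_succ]; omega) |>.mono_right ?_
    rintro _ ⟨j, rfl⟩
    rcases j with _ | j
    · right
      simp only [Set.mem_singleton_iff]
      funext ω
      rw [Nat.testBit_zero, Bool.eq_iff_iff]
      simp only [decide_eq_true_eq, List.any_eq_true, List.mem_range, Bool.and_eq_true,
        Bool.not_eq_true', decide_eq_false_iff_not]
      constructor
      · intro h
        refine ⟨V ω / 2, ?_, ?_, ?_⟩
        · have := hV ω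
          rw [pow_succ] at this
          omega
        · omega
        · omega
      · rintro ⟨u, -, h1, h2⟩
        omega
    · left
      refine ⟨j, ?_⟩
      funext ω
      simp only [Nat.testBit_succ]

end Thresholds

/-- In sorted order the values below `v` occupy an initial segment, so counting them determines
every threshold of the sorted sequence. -/
theorem le_apply_sort_iff {n : ℕ} (f : Fin n → ℕ) (v : ℕ) (i : Fin n) :
    v ≤ f (Tuple.sort f i) ↔ ¬ i.val < (Finset.univ.filter fun j => f j < v).card := by
  have h1 := Tuple.lt_card_lt_iff_apply_lt_of_monotone (f := f ∘ Tuple.sort f) (a := v) (j := i)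
    (Tuple.monotone_sort f)
  have h2 : (Finset.univ.filter fun j => (f ∘ Tuple.sort f) j < v).card =
      (Finset.univ.filter fun j => f j < v).card := by
    refine Finset.card_bij (fun j _ => Tuple.sort f j) (by simp)
      (fun a _ b _ h => (Tuple.sort f).injective h) ?_
    intro b hb
    exact ⟨(Tuple.sort f).symm b, by simpa using hb, by simp⟩
  rw [← h2, h1]
  simp

/-- The place of a bit of an element: the payload, followed by the key as the leading bit. -/
def bitPlace {w : ℕ} : Fin (w + 1) → Option (Fin w) :=
  Fin.lastCases (motive := fun _ => Option (Fin w)) none some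

/-- Elements are read as numbers below `2^(w+1)` with the key as leading bit. Nothing is moved: the
sorted array is regenerated from counts. Per element and value this takes 2 gates for unary
conversion, 1 for negation, 16 for counting, 1 for the sorted thresholds and 3 for converting back,
in total 23. -/
theorem exists_tightCompactor_short {n : ℕ} (hn : 1 ≤ n) (w : ℕ) :
    ∃ c : BoolCircuit (ArrayBit n w) (ArrayBit n w),
      c.size ≤ 3 * (5 + 23 * n * 2 ^ (w + 1)) + n * (w + 1) ∧
      IsTightCompactor c ∧ ∀ s, c.fanOut s ≤ 3 := by
  let Ω := ArrayBit n w → Bool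
  let V : Fin n → Ω → ℕ := fun i x => Nat.ofBits fun k : Fin (w + 1) => x (i, bitPlace k)
  let σ : Ω → Equiv.Perm (Fin n) := fun x => Tuple.sort fun i => V i x
  have hVlt : ∀ i x, V i x < 2 ^ (w + 1) := fun i x => Nat.ofBits_lt_two_pow _
  have hbit : ∀ i x (k : Fin (w + 1)), (V i x).testBit k.val = x (i, bitPlace k) := fun i x k =>
    Nat.testBit_ofBits_lt _ k.val k.isLt
  refine Computes.exists_tightCompactor σ ?_ ?_
  · set S : Set (Ω → Bool) := Set.range fun i x => x i with hS
    have c0 : Computes S 5 (constWires _) := Computes.constWires ⟨_, ⟨(⟨0, hn⟩, none), rfl⟩⟩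
    set S₀ := S ∪ constWires _ with hS₀
    have c1 : Computes S₀ (n * (2 * 2 ^ (w + 1)))
        (⋃ i, Set.range fun (v : ℕ) x => decide (v ≤ V i x)) := by
      have := Computes.iUnion (S := S₀) (fun i : Fin n => computes_le_ofBits
        (fun (k : Fin (w + 1)) (x : Ω) => x (i, bitPlace k)) (S := S₀)
        (fun f hf => Or.inr hf) (fun k => Or.inl ⟨(i, bitPlace k), rfl⟩))
      simpa using this
    set S₁ := S₀ ∪ ⋃ i, Set.range fun (v : ℕ) x => decide (v ≤ V i x) with hS₁
    have c2 : Computes S₁ (n * 2 ^ (w + 1) * 1)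
        (Set.range fun (p : Fin n × Fin (2 ^ (w + 1))) x => decide (V p.1 x < p.2.val)) := by
      have := Computes.range (S := S₁) (k := 1)
        (F := fun (p : Fin n × Fin (2 ^ (w + 1))) x => decide (V p.1 x < p.2.val)) (fun p => by
          have := (Computes.of_mem (S := S₁) (f := fun x => decide (p.2.val ≤ V p.1 x))
            (Or.inr (Set.mem_iUnion.2 ⟨p.1, _, rfl⟩))).not
          convert this using 2
          funext x
          rw [← decide_not, decide_eq_decide]
          omega)
      simpa using this
    set S₂ := S₁ ∪ Set.range fun (p : Fin n × Fin (2 ^ (w + 1))) x => decide (V p.1 x < p.2.val)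
      with hS₂
    have c3 : Computes S₂ (2 ^ (w + 1) * (16 * n)) (⋃ v : Fin (2 ^ (w + 1)),
        Set.range fun (i : ℕ) x =>
          decide (i < (Finset.univ.filter fun j => decide (V j x < v.val) = true).card)) := by
      have := Computes.iUnion (S := S₂) (fun v : Fin (2 ^ (w + 1)) => computes_card_thresholds
        (fun (j : Fin n) (x : Ω) => decide (V j x < v.val)) (S := S₂)
        (fun f hf => Or.inl (Or.inl (Or.inr hf))) (fun j => Or.inr ⟨(j, v), rfl⟩))
      rw [Finset.sum_const, Finset.card_univ, Fintype.card_fin, smul_eq_mul] at this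
      exact this
    set S₃ := S₂ ∪ ⋃ v : Fin (2 ^ (w + 1)),
        Set.range fun (i : ℕ) x =>
          decide (i < (Finset.univ.filter fun j => decide (V j x < v.val) = true).card) with hS₃
    have c4 : Computes S₃ (n * 2 ^ (w + 1) * 1)
        (Set.range fun (p : Fin n × Fin (2 ^ (w + 1))) x => decide (p.2.val ≤ V (σ x p.1) x)) := by
      have := Computes.range (S := S₃) (k := 1) (F := fun (p : Fin n × Fin (2 ^ (w + 1))) x =>
          decide (p.2.val ≤ V (σ x p.1) x)) (fun p => by
          have := (Computes.of_mem (S := S₃) (f := fun x => decide (p.1.val <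
            (Finset.univ.filter fun j => decide (V j x < p.2.val) = true).card))
            (Or.inr (Set.mem_iUnion.2 ⟨p.2, _, rfl⟩))).not
          convert this using 2
          funext x
          rw [← decide_not, decide_eq_decide, le_apply_sort_iff (fun i => V i x)]
          simp only [decide_eq_true_eq])
      simpa using this
    set S₄ := S₃ ∪ Set.range fun (p : Fin n × Fin (2 ^ (w + 1))) x =>
      decide (p.2.val ≤ V (σ x p.1) x) with hS₄
    have hconst : constWires Ω ⊆ S₄ :=
      fun f hf => Or.inl (Or.inl (Or.inl (Or.inl (Or.inr hf))))
    have c5 : Computes S₄ (n * (3 * 2 ^ (w + 1)))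
        (⋃ i, Set.range fun (k : ℕ) x => (V (σ x i) x).testBit k) := by
      have := Computes.iUnion (S := S₄) (fun i : Fin n => computes_testBit
        (fun x => V (σ x i) x) (fun x => hVlt _ x) (S := S₄) hconst (fun v => by
          rcases lt_or_ge v (2 ^ (w + 1)) with hv | hv
          · exact Or.inr ⟨(i, ⟨v, hv⟩), rfl⟩
          · convert hconst false_mem_constWires using 1
            funext x
            have := hVlt (σ x i) x
            simp only [decide_eq_false_iff_not]
            omega))
      rw [Finset.sum_const, Finset.card_univ, Fintype.card_fin, smul_eq_mul] at this
      exact this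
    refine (c0.trans' (S := S) (U := ⋃ i, Set.range fun (k : ℕ) x => (V (σ x i) x).testBit k)
      (l := 23 * n * 2 ^ (w + 1)) ?_).mono_right ?_
    · have d4 : Computes S₃ _ _ := c4.trans' c5
      have d3 : Computes S₂ _ _ := c3.trans' d4
      have d2 : Computes S₁ _ _ := c2.trans' d3
      have d1 : Computes S₀ _ _ := c1.trans' d2
      exact d1.mono_cost (by ring_nf; omega)
    · rintro _ ⟨⟨i, o⟩, rfl⟩
      obtain ⟨k, rfl⟩ : ∃ k : Fin (w + 1), bitPlace k = o := by
        rcases o with _ | j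
        · exact ⟨Fin.last w, by simp [bitPlace]⟩
        · exact ⟨j.castSucc, by simp [bitPlace]⟩
      refine Set.mem_iUnion.2 ⟨i, k.val, ?_⟩
      funext x
      exact hbit (σ x i) x k
  · intro x i j hij
    have h1 : V (σ x i) x ≤ V (σ x j) x := Tuple.monotone_sort (fun i => V i x) hij
    have hlast : ∀ i, (V i x).testBit w = x (i, none) := fun i => by
      have := hbit i x (Fin.last w)
      simpa [bitPlace] using this
    simp only
    rw [← hlast, ← hlast]
    intro h
    -- Key 1 means a value of at least `2 ^ w` and key 0 a smaller one, so sorting by value sorts by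
    -- key.
    have h2 := Nat.ge_two_pow_of_testBit h
    by_contra hne
    have h3 : V (σ x j) x < 2 ^ w := by
      refine Nat.lt_pow_two_of_testBit _ fun k hk => ?_
      rcases hk.eq_or_lt with rfl | hk
      · simpa using hne
      · exact Nat.testBit_ofBits_ge _ _ hk
    omega

/-! ### Iterated logarithms of natural numbers -/

/-- For positive `x`, both sides are at most `m` exactly if `x ≤ 2^m`. Rounding up thus commutes
with iterated logarithms, so `log*` can be handled with `Nat.clog`. -/
theorem ceil_log_eq_clog_ceil {x : ℝ} (hx : 0 ≤ x) :
    ⌈max 0 (Real.logb 2 x)⌉₊ = Nat.clog 2 ⌈x⌉₊ := by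
  refine eq_of_forall_ge_iff fun m => ?_
  rw [Nat.ceil_le, Nat.clog_le_iff_le_pow (by norm_num), Nat.ceil_le, max_le_iff]
  rcases hx.eq_or_lt with rfl | hx
  · simp
  · rw [Real.logb_le_iff_le_rpow (by norm_num) hx, Real.rpow_natCast]
    push_cast
    exact ⟨fun h => h.2, fun h => ⟨Nat.cast_nonneg m, h⟩⟩

theorem ceil_iterLog (i n : ℕ) : 0 ≤ iterLog i n ∧ ⌈iterLog i n⌉₊ = (Nat.clog 2)^[i] n := by
  induction i with
  | zero => simp [iterLog]
  | succ i ih =>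
    have e : iterLog (i + 1) n = max 0 (Real.logb 2 (iterLog i n)) := by
      simp only [iterLog, Function.iterate_succ_apply']
    rw [e, Function.iterate_succ_apply', ← ih.2]
    exact ⟨le_max_left _ _, ceil_log_eq_clog_ceil ih.1⟩

theorem iterLog_le_natCast_iff (i n m : ℕ) : iterLog i n ≤ m ↔ (Nat.clog 2)^[i] n ≤ m := by
  rw [← (ceil_iterLog i n).2, Nat.ceil_le]

theorem clog_iterate_antitone (n : ℕ) {i j : ℕ} (h : i ≤ j) :
    (Nat.clog 2)^[j] n ≤ (Nat.clog 2)^[i] n := by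
  obtain ⟨d, rfl⟩ := Nat.exists_eq_add_of_le' h
  rw [Function.iterate_add_apply]
  exact clog_iterate_le d _

theorem logStar_le_iff (n i : ℕ) : logStar n ≤ i ↔ (Nat.clog 2)^[i] n ≤ 1 := by
  have hmem : ∀ j, j ∈ {i : ℕ | iterLog i n ≤ 1} ↔ (Nat.clog 2)^[j] n ≤ 1 := fun j => by
    have := iterLog_le_natCast_iff j n 1
    rwa [Nat.cast_one] at this
  constructor
  · intro h
    have := Nat.sInf_mem (exists_iterLog_le_one n)
    exact (clog_iterate_antitone n h).trans ((hmem _).1 this)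
  · intro h
    exact Nat.sInf_le ((hmem i).2 h)

/-- Otherwise `log* w - 1` further logarithms, at least `log* n` in total, bring the value down to
1. By monotonicity they would do the same to `w`, contradicting the minimality of `log* w`; this is
why one extra iteration is needed. -/
theorem clog_iterate_logStar_sub_le {n w : ℕ} (hw : 1 ≤ w) :
    (Nat.clog 2)^[logStar n - logStar w + 1] n ≤ w := by
  by_contra hlt
  push Not at hlt
  rcases ht : logStar (w : ℝ) with _ | t
  · have h1 : (Nat.clog 2)^[logStar n - logStar w + 1] n ≤ 1 := by
      rw [← logStar_le_iff, ht]
      omega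
    omega
  · have h1 : (Nat.clog 2)^[t] ((Nat.clog 2)^[logStar n - logStar w + 1] n) ≤ 1 := by
      rw [← Function.iterate_add_apply, ← logStar_le_iff, ht]
      omega
    have h2 := (clog_iterate_mono t hlt.le).trans h1
    rw [← logStar_le_iff, ht] at h2
    omega

theorem logStar_sub_le_of_iterLog_le {n w c : ℕ} (h : iterLog c n ≤ w) :
    logStar n - logStar w ≤ c := by
  rw [iterLog_le_natCast_iff] at h
  have h1 := clog_iterate_mono (logStar w) h
  rw [← Function.iterate_add_apply] at h1
  have h2 := h1.trans ((logStar_le_iff w _).1 le_rfl)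
  rw [← logStar_le_iff] at h2
  omega

theorem logStarFactor_eq (ε : ℝ) (n w : ℕ) :
    logStarFactor ε n w = max 1 (((logStar n - logStar w : ℕ) : ℝ) ^ (2 + ε)) := by
  have : max 0 ((logStar n : ℝ) - (logStar w : ℝ)) = ((logStar n - logStar w : ℕ) : ℝ) := by
    rcases le_total (logStar w) (logStar n) with h | h
    · rw [Nat.cast_sub h, max_eq_right (sub_nonneg.2 (by exact_mod_cast h))]
    · rw [Nat.sub_eq_zero_of_le h, Nat.cast_zero, max_eq_left (sub_nonpos.2 (by exact_mod_cast h))]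
  rw [logStarFactor, this]

/-! ### The main theorem -/

/-- Exchange the exponents: `ρ^k = (2^k)^(2+ε)`, and rounding up to a power of two loses only a
constant factor. -/
theorem pow_clog_le_logStarFactor {ε : ℝ} (hε : 0 < ε) (n w : ℕ) :
    ((2 : ℝ) ^ (2 + ε)) ^ Nat.clog 2 (logStar n - logStar w + 1) ≤
      (4 : ℝ) ^ (2 + ε) * logStarFactor ε n w := by
  set Δ := logStar n - logStar w with hΔ
  set k := Nat.clog 2 (Δ + 1) with hk
  have h1 : 2 ^ k ≤ 4 * max 1 Δ := by
    rcases Nat.eq_zero_or_pos k with h0 | h0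
    · rw [h0]
      have := le_max_left 1 Δ
      omega
    · have h2 : 2 ^ (k - 1) < Δ + 1 := by
        by_contra hle
        have := Nat.clog_le_of_le_pow (not_lt.1 hle)
        omega
      have h3 : 2 ^ k = 2 * 2 ^ (k - 1) := by
        rw [← pow_succ']
        congr 1
        omega
      have h4 := le_max_left 1 Δ
      have h5 := le_max_right 1 Δ
      omega
  have h2 : ((2 : ℝ) ^ k) ≤ 4 * max 1 (Δ : ℝ) := by exact_mod_cast h1
  have h3 : (max 1 (Δ : ℝ)) ^ (2 + ε) = logStarFactor ε n w := by
    rw [logStarFactor_eq]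
    rcases le_total (1 : ℝ) Δ with h | h
    · rw [max_eq_right h, max_eq_right (Real.one_le_rpow h (by linarith))]
    · rw [max_eq_left h, max_eq_left (Real.rpow_le_one (Nat.cast_nonneg _) h (by linarith)),
        Real.one_rpow]
  calc ((2 : ℝ) ^ (2 + ε)) ^ k = ((2 : ℝ) ^ k) ^ (2 + ε) := by
        rw [← Real.rpow_natCast, ← Real.rpow_mul (by norm_num), mul_comm,
          Real.rpow_mul (by norm_num), Real.rpow_natCast]
    _ ≤ (4 * max 1 (Δ : ℝ)) ^ (2 + ε) :=
        Real.rpow_le_rpow (by positivity) h2 (by linarith)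
    _ = (4 : ℝ) ^ (2 + ε) * logStarFactor ε n w := by
        rw [Real.mul_rpow (by norm_num) (by positivity), h3]

theorem exists_tightCompactor_le {ε : ℝ} (hε : 0 < ε) :
    ∃ C : ℝ, 0 ≤ C ∧ ∀ n w : ℕ, 1 ≤ w →
      ∃ c : BoolCircuit (ArrayBit n w) (ArrayBit n w),
        IsTightCompactor c ∧ (∀ s, c.fanOut s ≤ 3) ∧
        (c.size : ℝ) ≤ C * (n * w) * min (logStarFactor ε n w) (2 ^ w / w) := by
  obtain ⟨C, hC, hlevel⟩ := exists_compactionLevel ((2 : ℝ) ^ (2 + ε)) (by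
    have := Real.rpow_lt_rpow_of_exponent_lt (show (1 : ℝ) < 2 by norm_num)
      (show (2 : ℝ) < 2 + ε by linarith)
    norm_num at this ⊢
    linarith)
  set Q : ℝ := (4 : ℝ) ^ (2 + ε) with hQ
  have hQ0 : 0 ≤ Q := by positivity
  -- Long elements: `17 = 15 + 2` and `54 = 3 * (2 + 16)`, using `w + 1 ≤ 2 * w`. Short elements:
  -- `154 = 15 + 3 * 23 * 2 + 1`.
  refine ⟨max (17 + 54 * (C * Q)) 154, by positivity, fun n w hw => ?_⟩
  have hw1 : (1 : ℝ) ≤ w := by exact_mod_cast hw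
  rcases Nat.eq_zero_or_pos n with rfl | hn
  · refine ⟨⟨0, fun i => i.elim0, fun i => i.elim0, fun q => Sum.inl q⟩, fun A => ⟨1, ?_, ?_⟩,
      ?_, ?_⟩
    · funext q; exact q.1.elim0
    · intro i; exact i.elim0
    · rintro (q | i)
      · exact q.1.elim0
      · exact i.elim0
    · simp
  have hn1 : (1 : ℝ) ≤ n := by exact_mod_cast hn
  have hnw : (1 : ℝ) ≤ n * w := by nlinarith
  rcases min_choice (logStarFactor ε n w) ((2 : ℝ) ^ w / w) with hmin | hmin
  -- The least level whose `2 ^ k` logarithms bring `n` below `w`, as guaranteed by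
  -- `clog_iterate_logStar_sub_le`.
  · set k := Nat.clog 2 (logStar n - logStar w + 1) with hk
    obtain ⟨a, b, hcomp, ha, hb⟩ := hlevel k n
    obtain ⟨c, hc, htight, hfan⟩ := hcomp.exists_tightCompactor hn w
    refine ⟨c, htight, hfan, ?_⟩
    rw [hmin]
    set F := logStarFactor ε n w with hF
    have hF1 : 1 ≤ F := le_max_left _ _
    have hL : (iterClog k n : ℝ) ≤ w := by
      have : iterClog k n ≤ w :=
        (clog_iterate_antitone n (Nat.le_pow_clog (by norm_num) _)).trans
          (clog_iterate_logStar_sub_le hw)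
      exact_mod_cast this
    have hpow : ((2 : ℝ) ^ (2 + ε)) ^ k ≤ Q * F := pow_clog_le_logStarFactor hε n w
    have hCQF : C * ((2 : ℝ) ^ (2 + ε)) ^ k ≤ C * (Q * F) := mul_le_mul_of_nonneg_left hpow hC
    have hCQF0 : 0 ≤ C * (Q * F) := by positivity
    have ha' : (a : ℝ) ≤ C * (Q * F) * (n * (w + w)) := by
      refine ha.trans (mul_le_mul hCQF ?_ (by positivity) hCQF0)
      exact mul_le_mul_of_nonneg_left (by linarith) (by linarith)
    have hb' : (b : ℝ) ≤ C * (Q * F) * n :=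
      hb.trans (mul_le_mul_of_nonneg_right hCQF (by linarith))
    have hwb : (w + 1 : ℝ) * (8 * b) ≤ (w + w) * (8 * (C * (Q * F) * n)) := by
      refine mul_le_mul (by linarith) (by linarith) (by positivity) (by linarith)
    have hc' : (c.size : ℝ) ≤ 3 * (5 + a + (w + 1) * (8 * b)) + n * (w + 1) := by exact_mod_cast hc
    have h1 : (n : ℝ) * (w + 1) ≤ 2 * (n * w) := by nlinarith
    have h2 : (c.size : ℝ) ≤ 17 * (n * w) + 54 * (C * Q) * (n * w) * F := by nlinarith
    have h3 : (n * w : ℝ) ≤ n * w * F := le_mul_of_one_le_right (by linarith) hF1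
    calc (c.size : ℝ) ≤ (17 + 54 * (C * Q)) * (n * w) * F := by nlinarith
      _ ≤ max (17 + 54 * (C * Q)) 154 * (n * w) * F := by
        gcongr
        exact le_max_left _ _
  · obtain ⟨c, hc, htight, hfan⟩ := exists_tightCompactor_short hn w
    refine ⟨c, htight, hfan, ?_⟩
    rw [hmin]
    have hc' : (c.size : ℝ) ≤ 3 * (5 + 23 * n * 2 ^ (w + 1)) + n * (w + 1) := by exact_mod_cast hc
    have h1 : (w + 1 : ℝ) ≤ 2 ^ w := by exact_mod_cast Nat.succ_le_of_lt Nat.lt_two_pow_self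
    have h2 : (n : ℝ) * (w + 1) ≤ n * 2 ^ w := mul_le_mul_of_nonneg_left h1 (by linarith)
    have h3 : (1 : ℝ) ≤ n * 2 ^ w := by nlinarith
    have h4 : (n * w : ℝ) * (2 ^ w / w) = n * 2 ^ w := by
      field_simp
    rw [mul_assoc, h4]
    calc (c.size : ℝ) ≤ 154 * (n * 2 ^ w) := by
          rw [pow_succ] at hc'
          linarith
      _ ≤ max (17 + 54 * (C * Q)) 154 * (n * 2 ^ w) := by
        gcongr
        exact le_max_right _ _

theorem theorem2 :
    ∃ K : ℕ, ∀ ε : ℝ, 0 < ε →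
      ∃ Φ : (n w : ℕ) → BoolCircuit (ArrayBit n w) (ArrayBit n w),
        (∀ n w : ℕ, 1 ≤ w → IsTightCompactor (Φ n w) ∧ ∀ s, (Φ n w).fanOut s ≤ K) ∧
        (∃ C : ℝ, ∀ n w : ℕ, 1 ≤ w →
          ((Φ n w).size : ℝ) ≤
            C * ((n : ℝ) * (w : ℝ)) * min (logStarFactor ε n w) ((2 : ℝ) ^ w / (w : ℝ))) ∧
        (∀ c : ℕ, 1 ≤ c → ∃ C : ℝ, ∀ n w : ℕ, 1 ≤ w → iterLog c n ≤ (w : ℝ) →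
          ((Φ n w).size : ℝ) ≤ C * ((n : ℝ) * (w : ℝ))) ∧
        (∀ w₀ : ℕ, ∃ C : ℝ, ∀ n w : ℕ, 1 ≤ w → w ≤ w₀ →
          ((Φ n w).size : ℝ) ≤ C * ((n : ℝ) * (w : ℝ))) := by
  refine ⟨3, fun ε hε => ?_⟩
  obtain ⟨C, hC, h⟩ := exists_tightCompactor_le hε
  have h' : ∀ n w : ℕ, ∃ c : BoolCircuit (ArrayBit n w) (ArrayBit n w), 1 ≤ w →
      IsTightCompactor c ∧ (∀ s, c.fanOut s ≤ 3) ∧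
        (c.size : ℝ) ≤ C * (n * w) * min (logStarFactor ε n w) (2 ^ w / w) := by
    intro n w
    by_cases hw : 1 ≤ w
    · obtain ⟨c, hc⟩ := h n w hw
      exact ⟨c, fun _ => hc⟩
    -- For `w = 0` nothing is claimed; any circuit will do.
    · exact ⟨⟨0, fun i => i.elim0, fun i => i.elim0, fun q => Sum.inl q⟩, fun h => absurd h hw⟩
  choose Φ hΦ using h'
  refine ⟨Φ, fun n w hw => ⟨(hΦ n w hw).1, (hΦ n w hw).2.1⟩, ⟨C, fun n w hw => (hΦ n w hw).2.2⟩,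
    fun c _ => ⟨C * max 1 ((c : ℝ) ^ (2 + ε)), fun n w hw hcw => ?_⟩,
    fun w₀ => ⟨C * 2 ^ w₀, fun n w hw hw₀ => ?_⟩⟩
  · have h1 : logStarFactor ε n w ≤ max 1 ((c : ℝ) ^ (2 + ε)) := by
      rw [logStarFactor_eq]
      refine max_le_max le_rfl (Real.rpow_le_rpow (Nat.cast_nonneg _) ?_ (by linarith))
      exact_mod_cast logStar_sub_le_of_iterLog_le hcw
    calc ((Φ n w).size : ℝ) ≤ C * (n * w) * min (logStarFactor ε n w) (2 ^ w / w) :=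
          (hΦ n w hw).2.2
      _ ≤ C * (n * w) * max 1 ((c : ℝ) ^ (2 + ε)) :=
          mul_le_mul_of_nonneg_left ((min_le_left _ _).trans h1) (by positivity)
      _ = _ := by ring
  · have hw1 : (1 : ℝ) ≤ w := by exact_mod_cast hw
    have h1 : (2 : ℝ) ^ w / w ≤ 2 ^ w₀ :=
      (div_le_self (by positivity) hw1).trans (pow_le_pow_right₀ (by norm_num) hw₀)
    calc ((Φ n w).size : ℝ) ≤ C * (n * w) * min (logStarFactor ε n w) (2 ^ w / w) :=
          (hΦ n w hw).2.2
      _ ≤ C * (n * w) * 2 ^ w₀ :=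
          mul_le_mul_of_nonneg_left ((min_le_right _ _).trans h1) (by positivity)
      _ = _ := by ring
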